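/- Let $N\in\mathbb N$, $0<\lambda\le\Lambda$, $\tilde N_+=\frac{\lambda}{\Lambda}(N-1)+1$, and assume $\tilde N_+>2$. Let $\alpha>-1$ and $1<\gamma<2+\alpha$. For a symmetric $N\times N$ matrix $M=M^+-M^-$, with $M^\pm$ positive semidefinite and $M^+M^-=0$, let $\mathcal M^+(M)=\Lambda\,\mathrm{tr}(M^+)-\lambda\,\mathrm{tr}(M^-)$ be Pucci's sup operator. Let $\bar\lambda_\gamma$ be the supremum of all $\mu\in\mathbb R$ for which there is a continuous, radial function $u>0$ on $B(0,1)\setminus\{0\}\subset\mathbb R^N$ with $$|\nabla u|^\alpha\mathcal M^+(D^2u)+\mu\,u^{1+\alpha}r^{-\gamma}\le 0\quad\text{in } B(0,1)\setminus\{0\},\qquad r=|x|,$$ in the viscosity sense: for each $x_0$ in the punctured ball, if $\varphi$ is $C^2$ there, $u-\varphi$ has a local minimum at $x_0$ and $\nabla\varphi(x_0)\ne0$, then $|\nabla\varphi(x_0)|^\alpha\mathcal M^+(D^2\varphi(x_0))+\mu\,u(x_0)^{1+\alpha}|x_0|^{-\gamma}\le0$; and if $u$ is equal to a constant $c$ on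 a ball contained in the punctured ball, then $\mu\,c^{1+\alpha}|x|^{-\gamma}\le0$ on that ball. Let $\mathcal H^1_0$ be the closure of $\{u\in C^2([0,1]):u'(0)=0,\ \mathrm{supp}\,u\text{ compact in }[0,1)\}$ for the norm $\left(\int_0^1|u'|^{\alpha+2}r^{(\tilde N_+-1)(1+\alpha)}dr\right)^{1/(\alpha+2)}$, and $$\bar\lambda_{\gamma,var}=\inf\left\{\int_0^1|v'|^{\alpha+2}r^{(\tilde N_+-1)(1+\alpha)}dr\ :\ v\in\mathcal H^1_0,\ \int_0^1|v|^{\alpha+2}r^{(\tilde N_+-1)(1+\alpha)-\gamma}dr=1\right\}.$$ Then the supremum defining $\bar\lambda_\gamma$ is finite and $$\bar\lambda_\gamma=\frac{\Lambda}{\alpha+1}\,\bar\lambda_{\gamma,var}.$$ Moreover, the infimum defining $\bar\lambda_{\gamma,var}$ is attained by a function that is positive on $(0,1)$, and every minimizer $v_\gamma$ that is positive on $(0,1)$ is bounded and satisfies $v_\gamma'<0$ and $(|v_\gamma'|^\alpha v_\gamma')'>0$ on $(0,1)$. -/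

import Mathlib

open MeasureTheory Filter Topology Set

noncomputable section

/-- The ambient space `ℝ^N` with its Euclidean norm. -/
abbrev Euc (N : ℕ) : Type := EuclideanSpace ℝ (Fin N)

/-- The punctured open unit ball `B(0,1) \ {0}` of `ℝ^N`. -/
def puncturedBall (N : ℕ) : Set (Euc N) := Metric.ball 0 1 \ {0}

/-- The Hessian matrix `D²φ(x)`, with entries `∂ᵢ∂ⱼ φ(x)`. -/
def hessianMatrix {N : ℕ} (φ : Euc N → ℝ) (x : Euc N) : Matrix (Fin N) (Fin N) ℝ :=
  Matrix.of fun i j =>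
    fderiv ℝ (fderiv ℝ φ) x (EuclideanSpace.single i 1) (EuclideanSpace.single j 1)

/-- Pucci's sup operator `𝓜⁺(M) = Λ tr(M⁺) - l tr(M⁻)`. Here `M = M⁺ - M⁻` is the decomposition
of the symmetric matrix `M` into its positive and negative parts. -/
def pucciSup {N : ℕ} (l L : ℝ) (M : Matrix (Fin N) (Fin N) ℝ) : ℝ :=
  L * (M⁺).trace - l * (M⁻).trace

open scoped MatrixOrder in
/-- The decomposition used in `pucciSup` is the unique `M = P - Q` with `P, Q` positive
semidefinite and `P Q = 0`. -/
theorem pucciSup_sub {N : ℕ} (l L : ℝ) {P Q : Matrix (Fin N) (Fin N) ℝ}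
    (hP : P.PosSemidef) (hQ : Q.PosSemidef) (hPQ : P * Q = 0) :
    pucciSup l L (P - Q) = L * P.trace - l * Q.trace := by
  obtain ⟨h1, h2⟩ := CFC.posPart_negPart_unique (a := P - Q) rfl hPQ hP.nonneg hQ.nonneg
  rw [pucciSup, h1, h2]

/-- `u` is a viscosity supersolution, in the punctured unit ball, of
`|∇u|^α F(D²u) + μ u^(1+α) r^(-γ) ≤ 0`.
As usual for equations that are singular or degenerate where the gradient vanishes, only test
functions with non-zero gradient are used at points around which `u` is not constant, while on a
ball on which `u` is a constant `c` the inequality reads `μ c^(1+α) r^(-γ) ≤ 0`. -/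
def IsViscositySupersolution {N : ℕ} (α γ : ℝ) (F : Matrix (Fin N) (Fin N) ℝ → ℝ) (μ : ℝ)
    (u : Euc N → ℝ) : Prop :=
  ∀ x₀ ∈ puncturedBall N,
    (∀ δ > 0, Metric.ball x₀ δ ⊆ puncturedBall N →
      (∀ x ∈ Metric.ball x₀ δ, u x = u x₀) →
        ∀ x ∈ Metric.ball x₀ δ, μ * (u x ^ (1 + α) / ‖x‖ ^ γ) ≤ 0) ∧
    (∀ φ : Euc N → ℝ, ContDiffOn ℝ 2 φ (puncturedBall N) →
      IsLocalMin (fun x => u x - φ x) x₀ → gradient φ x₀ ≠ 0 →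
        ‖gradient φ x₀‖ ^ α * F (hessianMatrix φ x₀)
          + μ * (u x₀ ^ (1 + α) / ‖x₀‖ ^ γ) ≤ 0)

/-- The set of all `μ` for which there is a continuous, positive, radial viscosity supersolution
of `|∇u|^α F(D²u) + μ u^(1+α) r^(-γ) ≤ 0` in the punctured unit ball. -/
def eigenvalueSet (N : ℕ) (α γ : ℝ) (F : Matrix (Fin N) (Fin N) ℝ → ℝ) : Set ℝ :=
  {μ | ∃ u : Euc N → ℝ, ContinuousOn u (puncturedBall N) ∧
    (∀ x ∈ puncturedBall N, 0 < u x) ∧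
    (∀ x ∈ puncturedBall N, ∀ y ∈ puncturedBall N, ‖x‖ = ‖y‖ → u x = u y) ∧
    IsViscositySupersolution α γ F μ u}

/-- The radial eigenvalue of `|∇·|^α F` with potential `r^(-γ)`. -/
def radialEigenvalue (N : ℕ) (α γ : ℝ) (F : Matrix (Fin N) (Fin N) ℝ → ℝ) : ℝ :=
  sSup (eigenvalueSet N α γ F)

/-- The dimension-like parameter `Ñ₊ = (l / L) (N - 1) + 1`. -/
def dimPlus (N : ℕ) (l L : ℝ) : ℝ := l / L * ((N : ℝ) - 1) + 1

/-- The exponent `(d - 1)(1 + α)` of the weight, for a dimension-like parameter `d`. -/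
def weightExp (α d : ℝ) : ℝ := (d - 1) * (1 + α)

/-- The space `𝓥` of `C²` functions on `[0,1]` with `u'(0) = 0` and compact support in `[0,1)`. -/
def IsTestFun (u : ℝ → ℝ) : Prop :=
  ContDiffOn ℝ 2 u (Icc 0 1) ∧ derivWithin u (Icc 0 1) 0 = 0 ∧
    ∃ b ∈ Ioo (0 : ℝ) 1, ∀ r ∈ Icc b 1, u r = 0

/-- The closure `𝓗₀¹` of `𝓥` for the norm `(∫₀¹ |u'|^(α+2) r^((d-1)(1+α)) dr)^(1/(α+2))`.
For functions of `𝓥` this norm controls the uniform norm on `[ε,1]` for each `ε > 0`, so that the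
elements of the closure are the (locally absolutely continuous) pointwise limits `v` on `(0,1)` of
sequences of `𝓥` whose derivatives converge to `v'` in the weighted `L^(α+2)` space. -/
def MemH01 (α d : ℝ) (v : ℝ → ℝ) : Prop :=
  ∃ u : ℕ → ℝ → ℝ, (∀ n, IsTestFun (u n)) ∧
    (∀ r ∈ Ioo (0 : ℝ) 1, Tendsto (fun n => u n r) atTop (𝓝 (v r))) ∧
    Tendsto (fun n => ∫⁻ r in Ioo (0 : ℝ) 1,
      ENNReal.ofReal (|deriv (u n) r - deriv v r| ^ (α + 2) * r ^ weightExp α d)) atTop (𝓝 0)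

/-- The energy `∫₀¹ |v'|^(α+2) r^((d-1)(1+α)) dr`. -/
def energy (α d : ℝ) (v : ℝ → ℝ) : ℝ :=
  ∫ r in Ioo (0 : ℝ) 1, |deriv v r| ^ (α + 2) * r ^ weightExp α d

/-- The admissible functions: `v ∈ 𝓗₀¹` with `∫₀¹ |v|^(α+2) r^((d-1)(1+α)-γ) dr = 1`. -/
def admissible (α γ d : ℝ) : Set (ℝ → ℝ) :=
  {v | MemH01 α d v ∧
    ∫ r in Ioo (0 : ℝ) 1, |v r| ^ (α + 2) * r ^ (weightExp α d - γ) = 1}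

/-- The variational eigenvalue: the infimum of the energy over the admissible functions. -/
def varEigenvalue (α γ d : ℝ) : ℝ := sInf (energy α d '' admissible α γ d)

/-- `v` is a function that is positive on `(0,1)` and realizes the infimum that defines the
variational eigenvalue. -/
def IsPositiveMinimizer (α γ d : ℝ) (v : ℝ → ℝ) : Prop :=
  v ∈ admissible α γ d ∧ energy α d v = varEigenvalue α γ d ∧ ∀ r ∈ Ioo (0 : ℝ) 1, 0 < v r

end

/-! Write d for the dimension-like parameter and w = (d-1)(1+α). For a decreasing convex radial
function, Pucci's operator puts Λ on the radial second derivative and λ on the N-1 tangential ones.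
Since λ(N-1) = Λ(d-1), the equation then takes the divergence form (r^w |φ'|^α φ')' = -ν r^(w-γ)
φ^(1+α), with μ = Λν/(1+α) (`flux_operator_eq`). This is the Euler-Lagrange equation of the
one-dimensional variational problem. Everything therefore rests on one positive solution φ on [0,1)
with φ(0) = 1 and φ(1) = 0, called a profile. Both eigenvalues are computed from its ν.

Existence. The quotient y = r^w |φ'|^(1+α) / φ^(1+α) solves a first-order Riccati equation with y(0)
= 0. Its minimal solution, obtained by monotone iteration in [0,∞], is finite near 0 and blows up at
a finite radius (`exists_radialRiccati_blowup`), which is the first zero of φ. A dilation moves that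
zero to 1.

The viscosity eigenvalue. The condition γ > 1 makes |φ'| decreasing (`deriv_slope_neg`), so φ is
convex and is itself an admissible supersolution (`IsProfile.mem_eigenvalueSet`). Conversely, let U
be the radial form of any positive supersolution with μ > Λν/(1+α). On a slightly smaller ball the
profile still has an eigenvalue below the critical value. Solving the equation with right-hand side
built from a lower bound mφ ≤ U improves this bound by a fixed factor k > 1 (`improve_lower_bound`).
Iteration forces U to be infinite, a contradiction (`eigenvalue_le`). No behaviour of U at the
origin is assumed: comparison with the singular functions -1/r and r^(2-d) yields monotonicity and a
Hopf-type slope estimate.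

The variational eigenvalue. Picone's identity, with φ as the reference function, shows that the
energy of an admissible v is at least ν plus the integral of a nonnegative remainder (`picone_add`).
The multiple of φ that is normalized attains ν. Equality makes the remainder vanish, so v'/v = φ'/φ
and v is a multiple of φ (`IsProfile.eq_const_mul`). Hence every positive minimizer inherits the
boundedness, monotonicity and convexity properties of φ. -/

/-! ### Exponents, powers and a first integration -/

theorem weightExp_pos {α d : ℝ} (hα : -1 < α) (hd : 2 < d) : 0 < weightExp α d :=
  mul_pos (by linarith) (by linarith)

theorem weightExp_sub_gt {α γ d : ℝ} (hα : -1 < α) (hγα : γ < 2 + α) (hd : 2 < d) :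
    -1 < weightExp α d - γ := by
  have : 0 < (d - 2) * (1 + α) := mul_pos (by linarith) (by linarith)
  unfold weightExp
  nlinarith

theorem abs_neg_rpow_inv_rpow_mul_self {α x : ℝ} (hα : -1 < α) (hx : 0 < x) :
    |-x ^ (1 / (1 + α))| ^ α * (-x ^ (1 / (1 + α))) = -x := by
  have h1 : 0 < 1 + α := by linarith
  rw [abs_neg, abs_of_pos (by positivity), mul_neg, ← Real.rpow_add_one (by positivity),
    ← Real.rpow_mul hx.le, show 1 / (1 + α) * (α + 1) = 1 by field_simp; ring, Real.rpow_one]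

/-- If X = |φ'|^(1+α) is taken as the unknown, then φ' = -X^(1/(1+α)), and the factor |φ'|^α cancels
exactly the power of X produced by differentiating φ'. The possibly singular or degenerate operator
thus becomes linear in X and X'. -/
theorem abs_neg_rpow_inv_rpow_mul_deriv {α x : ℝ} (hα : -1 < α) (hx : 0 < x) (x' : ℝ) :
    |-x ^ (1 / (1 + α))| ^ α * (-(1 / (1 + α) * x ^ (1 / (1 + α) - 1) * x')) =
      -(x' / (1 + α)) := by
  have h1 : 0 < 1 + α := by linarith
  have : (x ^ (1 / (1 + α))) ^ α * x ^ (1 / (1 + α) - 1) = 1 := by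
    rw [← Real.rpow_mul hx.le, ← Real.rpow_add hx,
      show 1 / (1 + α) * α + (1 / (1 + α) - 1) = 0 by field_simp; ring, Real.rpow_zero]
  rw [abs_neg, abs_of_pos (by positivity)]
  linear_combination (-(x' / (1 + α))) * this

theorem hasDerivAt_neg_rpow_inv {α : ℝ} {X : ℝ → ℝ} {X' r : ℝ} (hX : HasDerivAt X X' r)
    (h0 : 0 < X r) :
    HasDerivAt (fun s => -(X s) ^ (1 / (1 + α)))
      (-(1 / (1 + α) * X r ^ (1 / (1 + α) - 1) * X')) r := by
  have := (hX.rpow_const (p := 1 / (1 + α)) (Or.inl h0.ne')).neg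
  refine this.congr_deriv ?_
  ring

theorem hasDerivAt_rpow_div {a r : ℝ} (ha : 0 < a) (hr : 0 < r) (c : ℝ) :
    HasDerivAt (fun s : ℝ => c * (s ^ a / a)) (c * r ^ (a - 1)) r := by
  have := ((Real.hasDerivAt_rpow_const (x := r) (p := a) (Or.inl hr.ne')).div_const a).const_mul c
  refine this.congr_deriv ?_
  field_simp

theorem le_mul_rpow_div {e μ R : ℝ} {Φ g : ℝ → ℝ} (he : 0 < e + 1) (hμ : 0 ≤ μ)
    (hcont : ContinuousOn Φ (Ico 0 R)) (h0 : Φ 0 = 0)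
    (hder : ∀ r ∈ Ioo 0 R, HasDerivAt Φ (μ * (r ^ e * g r)) r) (hg : ∀ r ∈ Ioo 0 R, g r ≤ 1)
    {r : ℝ} (hr : r ∈ Ico 0 R) : Φ r ≤ μ * (r ^ (e + 1) / (e + 1)) := by
  have hanti : AntitoneOn (fun s => Φ s - μ * (s ^ (e + 1) / (e + 1))) (Ico 0 R) := by
    have hder : ∀ s ∈ Ioo 0 R, HasDerivAt (fun s => Φ s - μ * (s ^ (e + 1) / (e + 1)))
        (μ * (s ^ e * g s) - μ * s ^ (e + 1 - 1)) s := fun s hs =>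
      (hder s hs).sub (hasDerivAt_rpow_div he hs.1 μ)
    refine antitoneOn_of_deriv_nonpos (convex_Ico _ _) ?_ ?_ ?_
    · refine hcont.sub (ContinuousOn.mul continuousOn_const ?_)
      exact ((Real.continuous_rpow_const he.le).div_const _).continuousOn
    · rw [interior_Ico]
      exact fun s hs => (hder s hs).differentiableAt.differentiableWithinAt
    · rw [interior_Ico]
      intro s hs
      rw [(hder s hs).deriv, add_sub_cancel_right]
      have h2 : 0 ≤ μ * s ^ e := mul_nonneg hμ (Real.rpow_nonneg hs.1.le _)
      nlinarith [hg s hs]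
  have := hanti (a := 0) ⟨le_rfl, hr.1.trans_lt hr.2⟩ hr hr.1
  simp only [h0, Real.zero_rpow he.ne', zero_div, mul_zero] at this
  linarith

/-! ### Profiles: monotonicity, flux bounds, convexity and scaling -/

/-- A positive radial eigenfunction `φ` on `[0,R)` for the eigenvalue `μ`, with `φ(0) = 1` and
`φ(R) = 0`, together with its flux `Φ = r^w |φ'|^(1+α)`. -/
structure IsProfile (α γ d R μ : ℝ) (φ Φ : ℝ → ℝ) : Prop where
  radius_pos : 0 < R
  eigenvalue_pos : 0 < μ
  continuousOn : ContinuousOn φ (Icc 0 R)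
  apply_zero : φ 0 = 1
  apply_radius : φ R = 0
  pos : ∀ r ∈ Ico 0 R, 0 < φ r
  flux_continuousOn : ContinuousOn Φ (Ico 0 R)
  flux_zero : Φ 0 = 0
  hasDerivAt : ∀ r ∈ Ioo 0 R,
    HasDerivAt φ (-(r ^ (-weightExp α d) * Φ r) ^ (1 / (1 + α))) r
  flux_hasDerivAt : ∀ r ∈ Ioo 0 R,
    HasDerivAt Φ (μ * (r ^ (weightExp α d - γ) * φ r ^ (1 + α))) r

namespace IsProfile

variable {α γ d R μ : ℝ} {φ Φ : ℝ → ℝ}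

theorem flux_strictMonoOn (h : IsProfile α γ d R μ φ Φ) : StrictMonoOn Φ (Ico 0 R) := by
  refine strictMonoOn_of_deriv_pos (convex_Ico _ _) h.flux_continuousOn fun r hr => ?_
  rw [interior_Ico] at hr
  rw [(h.flux_hasDerivAt r hr).deriv]
  have := h.pos r ⟨hr.1.le, hr.2⟩
  have := hr.1
  have := h.eigenvalue_pos
  positivity

theorem flux_pos (h : IsProfile α γ d R μ φ Φ) {r : ℝ} (hr : r ∈ Ioo 0 R) : 0 < Φ r := by
  have := h.flux_strictMonoOn (a := 0) ⟨le_rfl, h.radius_pos⟩ ⟨hr.1.le, hr.2⟩ hr.1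
  rwa [h.flux_zero] at this

theorem slope_pos (h : IsProfile α γ d R μ φ Φ) {r : ℝ} (hr : r ∈ Ioo 0 R) :
    0 < r ^ (-weightExp α d) * Φ r :=
  mul_pos (Real.rpow_pos_of_pos hr.1 _) (h.flux_pos hr)

theorem strictAntiOn (h : IsProfile α γ d R μ φ Φ) : StrictAntiOn φ (Icc 0 R) := by
  refine strictAntiOn_of_deriv_neg (convex_Icc _ _) h.continuousOn fun r hr => ?_
  rw [interior_Icc] at hr
  rw [(h.hasDerivAt r hr).deriv, neg_lt_zero]
  exact Real.rpow_pos_of_pos (h.slope_pos hr) _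

theorem le_one (h : IsProfile α γ d R μ φ Φ) {r : ℝ} (hr : r ∈ Icc 0 R) : φ r ≤ 1 := by
  rw [← h.apply_zero]
  exact h.strictAntiOn.antitoneOn ⟨le_rfl, h.radius_pos.le⟩ hr hr.1

theorem flux_le (hα : -1 < α) (hγα : γ < 2 + α) (hd : 2 < d)
    (h : IsProfile α γ d R μ φ Φ) {r : ℝ} (hr : r ∈ Ico 0 R) :
    Φ r ≤ μ * (r ^ (weightExp α d - γ + 1) / (weightExp α d - γ + 1)) := by
  refine le_mul_rpow_div (by linarith [weightExp_sub_gt hα hγα hd]) h.eigenvalue_pos.le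
    h.flux_continuousOn h.flux_zero h.flux_hasDerivAt (fun s hs => ?_) hr
  exact Real.rpow_le_one (h.pos s ⟨hs.1.le, hs.2⟩).le (h.le_one ⟨hs.1.le, hs.2.le⟩) (by linarith)

/-- As φ decreases, φ(s) ≥ φ(r) for s < r. Freezing φ at its value in r under the integral of Φ'
over (0,r) gives the bound. -/
theorem le_flux (hα : -1 < α) (hγα : γ < 2 + α) (hd : 2 < d)
    (h : IsProfile α γ d R μ φ Φ) {r : ℝ} (hr : r ∈ Ioo 0 R) :
    μ * φ r ^ (1 + α) * (r ^ (weightExp α d - γ + 1) / (weightExp α d - γ + 1)) ≤ Φ r := by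
  have ha : 0 < weightExp α d - γ + 1 := by linarith [weightExp_sub_gt hα hγα hd]
  set a := weightExp α d - γ + 1 with ha'
  have hmono : MonotoneOn (fun s => Φ s - μ * φ r ^ (1 + α) * (s ^ a / a)) (Icc 0 r) := by
    have hder : ∀ s ∈ Ioo 0 r, HasDerivAt (fun s => Φ s - μ * φ r ^ (1 + α) * (s ^ a / a))
        (μ * (s ^ (weightExp α d - γ) * φ s ^ (1 + α)) - μ * φ r ^ (1 + α) * s ^ (a - 1)) s :=
      fun s hs => (h.flux_hasDerivAt s ⟨hs.1, hs.2.trans hr.2⟩).sub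
        (hasDerivAt_rpow_div ha hs.1 _)
    refine monotoneOn_of_deriv_nonneg (convex_Icc _ _) ?_ ?_ ?_
    · refine (h.flux_continuousOn.mono fun s hs => ⟨hs.1, hs.2.trans_lt hr.2⟩).sub
        (ContinuousOn.mul continuousOn_const ?_)
      exact ((Real.continuous_rpow_const ha.le).div_const a).continuousOn
    · rw [interior_Icc]
      exact fun s hs => (hder s hs).differentiableAt.differentiableWithinAt
    · rw [interior_Icc]
      intro s hs
      rw [(hder s hs).deriv, ha', add_sub_cancel_right]
      have h1 : φ r ^ (1 + α) ≤ φ s ^ (1 + α) :=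
        Real.rpow_le_rpow (h.pos r ⟨hr.1.le, hr.2⟩).le
          (h.strictAntiOn.antitoneOn ⟨hs.1.le, (hs.2.trans hr.2).le⟩ ⟨hr.1.le, hr.2.le⟩ hs.2.le)
          (by linarith)
      have h2 : 0 < μ * s ^ (weightExp α d - γ) :=
        mul_pos h.eigenvalue_pos (Real.rpow_pos_of_pos hs.1 _)
      nlinarith
  have := hmono (a := 0) ⟨le_rfl, hr.1.le⟩ ⟨hr.1.le, le_rfl⟩ hr.1.le
  simp only [h.flux_zero, Real.zero_rpow ha.ne', zero_div, mul_zero] at this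
  linarith

theorem hasDerivAt_slope (h : IsProfile α γ d R μ φ Φ) {r : ℝ} (hr : r ∈ Ioo 0 R) :
    HasDerivAt (fun s => s ^ (-weightExp α d) * Φ s)
      (μ * (φ r ^ (1 + α) / r ^ γ) - weightExp α d * (r ^ (-weightExp α d) * Φ r) / r) r := by
  have h1 := (Real.hasDerivAt_rpow_const (x := r) (p := -weightExp α d) (Or.inl hr.1.ne')).mul
    (h.flux_hasDerivAt r hr)
  refine h1.congr_deriv ?_
  have e1 : r ^ (-weightExp α d - 1) = r ^ (-weightExp α d) / r := Real.rpow_sub_one hr.1.ne' _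
  have e2 : r ^ (-weightExp α d) * r ^ (weightExp α d - γ) = (r ^ γ)⁻¹ := by
    rw [← Real.rpow_add hr.1, ← Real.rpow_neg hr.1.le]
    ring_nf
  rw [e1]
  linear_combination (μ * φ r ^ (1 + α)) * e2

/-- By `le_flux` the damping term w X / r is at least w/(w-γ+1) times the source term, and γ > 1
makes this factor larger than 1. So X = |φ'|^(1+α) decreases, that is, φ is convex. This is the only
point where γ > 1 enters. -/
theorem deriv_slope_neg (hα : -1 < α) (hγ : 1 < γ) (hγα : γ < 2 + α) (hd : 2 < d)
    (h : IsProfile α γ d R μ φ Φ) {r : ℝ} (hr : r ∈ Ioo 0 R) :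
    μ * (φ r ^ (1 + α) / r ^ γ) - weightExp α d * (r ^ (-weightExp α d) * Φ r) / r < 0 := by
  have ha : 0 < weightExp α d - γ + 1 := by linarith [weightExp_sub_gt hα hγα hd]
  have hw := weightExp_pos hα hd
  have hr0 := hr.1
  have hφ := h.pos r ⟨hr.1.le, hr.2⟩
  have hμ := h.eigenvalue_pos
  have h1 := mul_le_mul_of_nonneg_left (h.le_flux hα hγα hd hr)
    (mul_pos (Real.rpow_pos_of_pos hr0 (-weightExp α d)) (inv_pos.2 hr0)).le
  have e2 : r ^ (-weightExp α d) * r⁻¹ * r ^ (weightExp α d - γ + 1) = (r ^ γ)⁻¹ := by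
    rw [← Real.rpow_neg_one, ← Real.rpow_add hr0, ← Real.rpow_add hr0, ← Real.rpow_neg hr0.le]
    ring_nf
  have h2 : μ * φ r ^ (1 + α) * (r ^ γ)⁻¹ / (weightExp α d - γ + 1) ≤
      r ^ (-weightExp α d) * r⁻¹ * Φ r := by
    rw [← e2]
    refine le_trans (le_of_eq ?_) h1
    ring
  have h3 : 0 < μ * φ r ^ (1 + α) * (r ^ γ)⁻¹ := by positivity
  have h4 : μ * φ r ^ (1 + α) * (r ^ γ)⁻¹ <
      weightExp α d * (μ * φ r ^ (1 + α) * (r ^ γ)⁻¹ / (weightExp α d - γ + 1)) := by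
    rw [← mul_div_assoc, lt_div_iff₀ ha]
    nlinarith
  have h5 := mul_le_mul_of_nonneg_left h2 hw.le
  have e3 : weightExp α d * (r ^ (-weightExp α d) * r⁻¹ * Φ r) =
    weightExp α d * (r ^ (-weightExp α d) * Φ r) / r := by field_simp
  rw [e3] at h5
  rw [div_eq_mul_inv, ← mul_assoc]
  linarith

/-- Dilation by c multiplies the eigenvalue by c^(γ-(2+α)), a continuous function of c which is 1 at
c = 1. It serves to move the first zero to 1, and later to shrink the ball a little at a small cost
in the eigenvalue. -/
theorem rescale (hα : -1 < α) (h : IsProfile α γ d R μ φ Φ) {c : ℝ} (hc : 0 < c) :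
    IsProfile α γ d (c * R) (μ * c ^ (γ - (2 + α))) (fun r => φ (r / c))
      (fun r => c ^ (weightExp α d - (1 + α)) * Φ (r / c)) := by
  have hmem : ∀ r, r ∈ Ioo 0 (c * R) → r / c ∈ Ioo 0 R := fun r hr =>
    ⟨div_pos hr.1 hc, by rw [div_lt_iff₀ hc, mul_comm]; exact hr.2⟩
  have hder : ∀ r, HasDerivAt (fun s : ℝ => s / c) (1 / c) r := fun r =>
    (hasDerivAt_id r).div_const c
  refine ⟨mul_pos hc h.radius_pos, mul_pos h.eigenvalue_pos (Real.rpow_pos_of_pos hc _), ?_, ?_, ?_,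
    ?_, ?_, ?_, ?_, ?_⟩
  · refine h.continuousOn.comp (by fun_prop) fun r hr => ⟨div_nonneg hr.1 hc.le, ?_⟩
    rw [div_le_iff₀ hc, mul_comm]; exact hr.2
  · simp [h.apply_zero]
  · simp [mul_div_cancel_left₀ _ hc.ne', h.apply_radius]
  · intro r hr
    refine h.pos _ ⟨div_nonneg hr.1 hc.le, ?_⟩
    rw [div_lt_iff₀ hc, mul_comm]; exact hr.2
  · refine continuousOn_const.mul
      (h.flux_continuousOn.comp (by fun_prop) fun r hr => ⟨div_nonneg hr.1 hc.le, ?_⟩)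
    rw [div_lt_iff₀ hc, mul_comm]; exact hr.2
  · simp [h.flux_zero]
  · intro r hr
    have h1 := (h.hasDerivAt _ (hmem r hr)).comp r (hder r)
    refine h1.congr_deriv ?_
    have hα1 : 0 < 1 + α := by linarith
    have hX := (h.slope_pos (hmem r hr)).le
    rw [show r ^ (-weightExp α d) * (c ^ (weightExp α d - (1 + α)) * Φ (r / c)) =
      c ^ (-(1 + α)) * ((r / c) ^ (-weightExp α d) * Φ (r / c)) from ?_,
      Real.mul_rpow (by positivity) hX, ← Real.rpow_mul hc.le,
      show -(1 + α) * (1 / (1 + α)) = -1 by field_simp, Real.rpow_neg_one]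
    · ring
    · rw [Real.div_rpow hr.1.le hc.le, show weightExp α d - (1 + α) =
        -(1 + α) - (-weightExp α d) by ring, Real.rpow_sub hc]
      field_simp
  · intro r hr
    have h1 := ((h.flux_hasDerivAt _ (hmem r hr)).comp r (hder r)).const_mul
      (c ^ (weightExp α d - (1 + α)))
    refine h1.congr_deriv ?_
    have e : c ^ (γ - (2 + α)) =
        c ^ (weightExp α d - (1 + α)) / c ^ (weightExp α d - γ) / c := by
      rw [← Real.rpow_sub hc, ← Real.rpow_sub_one hc.ne']
      ring_nf
    rw [Real.div_rpow hr.1.le hc.le, e]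
    ring

end IsProfile

/-! ### Minimal solutions of Riccati equations with values in [0,∞] -/

open scoped ENNReal

/-- The integral operator whose fixed points solve `y' = A + C y^q`, `y(0) = 0`. -/
noncomputable def riccatiStep (A C : ℝ → ℝ≥0∞) (q : ℝ) (Z : ℝ → ℝ≥0∞) (r : ℝ) : ℝ≥0∞ :=
  ∫⁻ s in Ioo 0 r, (A s + C s * Z s ^ q)

/-- The minimal solution of `y' = A + C y^q`, `y(0) = 0`, with values in `[0,∞]`. -/
noncomputable def riccatiSol (A C : ℝ → ℝ≥0∞) (q : ℝ) (r : ℝ) : ℝ≥0∞ :=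
  ⨆ n : ℕ, (riccatiStep A C q)^[n] 0 r

section Riccati

variable {A C : ℝ → ℝ≥0∞} {q : ℝ}

theorem riccatiStep_le (hq : 0 < q) {Z Z' : ℝ → ℝ≥0∞} {r : ℝ}
    (h : ∀ s ∈ Ioo 0 r, Z s ≤ Z' s) : riccatiStep A C q Z r ≤ riccatiStep A C q Z' r := by
  refine setLIntegral_mono' measurableSet_Ioo fun s hs => ?_
  gcongr
  exact h s hs

theorem riccatiStep_monotone (Z : ℝ → ℝ≥0∞) : Monotone (riccatiStep A C q Z) :=
  fun _ _ h => lintegral_mono_set (Ioo_subset_Ioo_right h)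

theorem riccatiIter_monotone_right (n : ℕ) : Monotone ((riccatiStep A C q)^[n] 0) := by
  cases n with
  | zero => exact monotone_const
  | succ n =>
    rw [Function.iterate_succ_apply']
    exact riccatiStep_monotone _

theorem riccatiIter_monotone (hq : 0 < q) :
    Monotone fun n : ℕ => (riccatiStep A C q)^[n] 0 := by
  refine monotone_nat_of_le_succ fun n => ?_
  induction n with
  | zero => exact fun r => zero_le
  | succ n ih =>
    rw [Function.iterate_succ_apply', Function.iterate_succ_apply']
    exact fun r => riccatiStep_le hq fun s _ => ih s

theorem riccatiSol_monotone : Monotone (riccatiSol A C q) := fun _ _ h =>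
  iSup_mono fun n => riccatiIter_monotone_right n h

/-- The iterates from 0 increase, so monotone convergence lets the integral operator pass to their
supremum. Working in [0,∞] avoids any finiteness assumption. -/
theorem riccatiSol_eq (hq : 0 < q) (hA : Measurable A) (hC : Measurable C) (r : ℝ) :
    riccatiSol A C q r = riccatiStep A C q (riccatiSol A C q) r := by
  have hmono := riccatiIter_monotone (A := A) (C := C) hq
  have hpt : ∀ s, A s + C s * riccatiSol A C q s ^ q =
      ⨆ n : ℕ, (A s + C s * (riccatiStep A C q)^[n] 0 s ^ q) := fun s => by
    have : riccatiSol A C q s ^ q = ⨆ n : ℕ, ((riccatiStep A C q)^[n] 0 s) ^ q :=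
      (ENNReal.orderIsoRpow q hq).map_iSup _
    rw [this, ENNReal.mul_iSup, ENNReal.add_iSup]
  have hst : riccatiStep A C q (riccatiSol A C q) r =
      ⨆ n : ℕ, (riccatiStep A C q)^[n + 1] 0 r := by
    unfold riccatiStep
    simp_rw [hpt]
    rw [lintegral_iSup]
    · simp_rw [Function.iterate_succ_apply']
      rfl
    · intro n
      exact hA.add (hC.mul ((riccatiIter_monotone_right n).measurable.pow_const q))
    · intro m n hmn s
      dsimp only
      gcongr
      exact hmono hmn s
  rw [hst]
  refine le_antisymm (iSup_le fun n => ?_) (iSup_le fun n => ?_)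
  · exact (hmono (Nat.le_succ n) r).trans
      (le_iSup (fun n : ℕ => (riccatiStep A C q)^[n + 1] 0 r) n)
  · exact le_iSup (fun n : ℕ => (riccatiStep A C q)^[n] 0 r) (n + 1)

/-- A supersolution of the integral equation dominates every iterate, starting from 0. Knowledge up
to b suffices because the operator at r only sees values before r. -/
theorem riccatiSol_le (hq : 0 < q) {Z : ℝ → ℝ≥0∞} {b : ℝ}
    (h : ∀ r ≤ b, riccatiStep A C q Z r ≤ Z r) {r : ℝ} (hr : r ≤ b) :
    riccatiSol A C q r ≤ Z r := by
  refine iSup_le fun n => ?_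
  induction n generalizing r with
  | zero => exact zero_le
  | succ n ih =>
    rw [Function.iterate_succ_apply']
    exact (riccatiStep_le hq fun s hs => ih (hs.2.le.trans hr)).trans (h r hr)

end Riccati

/-! ### The radial Riccati equation: start at 0 and blow-up -/

theorem lintegral_Ioo_rpow {a r : ℝ} (ha : 0 < a) (hr : 0 ≤ r) :
    ∫⁻ s in Ioo 0 r, ENNReal.ofReal (s ^ (a - 1)) = ENNReal.ofReal (r ^ a / a) := by
  have hint : IntegrableOn (fun s : ℝ => s ^ (a - 1)) (Ioo 0 r) :=
    (intervalIntegrable_iff_integrableOn_Ioo_of_le hr).1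
      (intervalIntegral.intervalIntegrable_rpow' (by linarith))
  rw [← ofReal_integral_eq_lintegral_ofReal hint, ← integral_Ioc_eq_integral_Ioo,
    ← intervalIntegral.integral_of_le hr, integral_rpow (Or.inl (by linarith))]
  · simp [Real.zero_rpow ha.ne']
  · filter_upwards [ae_restrict_mem measurableSet_Ioo] with s hs
    exact Real.rpow_nonneg hs.1.le _

/-- The minimal solution of the Riccati equation `y' = r^(w-γ) + (1+α) r^(1-d) y^(1+1/(1+α))`. -/
noncomputable def radialRiccati (α γ d : ℝ) : ℝ → ℝ≥0∞ :=
  riccatiSol (fun s => ENNReal.ofReal (s ^ (weightExp α d - γ)))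
    (fun s => ENNReal.ofReal ((1 + α) * s ^ (1 - d))) (1 + 1 / (1 + α))

section RadialRiccati

variable {α γ d : ℝ}

theorem radialRiccati_eq (hα : -1 < α) (r : ℝ) :
    radialRiccati α γ d r = ∫⁻ s in Ioo 0 r, (ENNReal.ofReal (s ^ (weightExp α d - γ)) +
      ENNReal.ofReal ((1 + α) * s ^ (1 - d)) * radialRiccati α γ d s ^ (1 + 1 / (1 + α))) := by
  have h1 : 0 < 1 + α := by linarith
  exact riccatiSol_eq (by positivity) (by fun_prop) (by fun_prop) r

theorem rpow_div_le_radialRiccati (hα : -1 < α) (hγα : γ < 2 + α) (hd : 2 < d) {r : ℝ}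
    (hr : 0 ≤ r) :
    ENNReal.ofReal (r ^ (weightExp α d - γ + 1) / (weightExp α d - γ + 1)) ≤
      radialRiccati α γ d r := by
  rw [radialRiccati_eq hα,
    ← lintegral_Ioo_rpow (by linarith [weightExp_sub_gt hα hγα hd]) hr, add_sub_cancel_right]
  exact lintegral_mono fun s => le_self_add

/-- With this exponent β = (2+α-γ)/(1+α), a trial function of size r^(w-γ+1) makes the nonlinear
term r^β times the size of the forcing term r^(w-γ). Hence the nonlinearity is negligible near 0 and
dominates at infinity. -/
theorem scaling_exponent_pos (hα : -1 < α) (hγα : γ < 2 + α) : 0 < 1 - (γ - 1) / (1 + α) := by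
  rw [sub_pos, div_lt_one (by linarith)]
  linarith

/-- Twice the solution r^a/a of the equation without nonlinear term is a supersolution for small r:
there the nonlinear term is K s^β ≤ 1 times the forcing term. -/
theorem exists_radialRiccati_le (hα : -1 < α) (hγα : γ < 2 + α) (hd : 2 < d) :
    ∃ b > 0, ∀ r ∈ Icc 0 b, radialRiccati α γ d r ≤
      ENNReal.ofReal (2 * (r ^ (weightExp α d - γ + 1) / (weightExp α d - γ + 1))) := by
  have h1 : 0 < 1 + α := by linarith
  have ha : 0 < weightExp α d - γ + 1 := by linarith [weightExp_sub_gt hα hγα hd]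
  set a := weightExp α d - γ + 1 with ha'
  set q := 1 + 1 / (1 + α) with hq
  have hβ := scaling_exponent_pos hα hγα
  set β := 1 - (γ - 1) / (1 + α) with hβ'
  have hq0 : 0 < q := by positivity
  have hexp : 1 - d + a * q = (weightExp α d - γ) + β := by
    rw [ha', hq, hβ']
    unfold weightExp
    field_simp
    ring
  set K := (1 + α) * (2 / a) ^ q with hK
  have hK0 : 0 < K := by positivity
  have hlim : Tendsto (fun s : ℝ => K * s ^ β) (𝓝 0) (𝓝 0) := by
    have := ((Real.continuousAt_rpow_const 0 β (Or.inr hβ.le)).tendsto).const_mul K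
    rwa [Real.zero_rpow hβ.ne', mul_zero] at this
  obtain ⟨b, hb, hbK⟩ := Metric.eventually_nhds_iff.1 (hlim.eventually (gt_mem_nhds one_pos))
  have hsmall : ∀ s ∈ Ioo 0 (b / 2), K * s ^ β ≤ 1 := fun s hs =>
    (hbK (by rw [Real.dist_eq, sub_zero, abs_of_pos hs.1]; linarith [hs.2])).le
  refine ⟨b / 2, by positivity, fun r hr => ?_⟩
  refine riccatiSol_le (b := b / 2)
    (Z := fun r => ENNReal.ofReal (2 * (r ^ a / a))) hq0 (fun r hr => ?_) hr.2
  rcases le_or_gt r 0 with hr0 | hr0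
  · unfold riccatiStep
    simp [Ioo_eq_empty_of_le hr0]
  · calc riccatiStep _ _ q _ r
      ≤ ∫⁻ s in Ioo 0 r, ENNReal.ofReal 2 * ENNReal.ofReal (s ^ (a - 1)) := by
          refine setLIntegral_mono' measurableSet_Ioo fun s hs => ?_
          have hs0 := hs.1
          rw [ENNReal.ofReal_rpow_of_nonneg (by positivity) hq0.le,
            ← ENNReal.ofReal_mul (by positivity), ← ENNReal.ofReal_mul (by positivity),
            ← ENNReal.ofReal_add (by positivity) (by positivity)]
          refine ENNReal.ofReal_le_ofReal ?_
          have e1 : (2 * (s ^ a / a)) ^ q = (2 / a) ^ q * s ^ (a * q) := by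
            rw [Real.rpow_mul hs0.le, ← Real.mul_rpow (by positivity) (by positivity)]
            ring_nf
          have e2 : s ^ (1 - d) * s ^ (a * q) = s ^ (weightExp α d - γ) * s ^ β := by
            rw [← Real.rpow_add hs0, ← Real.rpow_add hs0, hexp]
          have e3 : (1 + α) * s ^ (1 - d) * (2 * (s ^ a / a)) ^ q =
              s ^ (weightExp α d - γ) * (K * s ^ β) := by
            rw [e1, hK]
            linear_combination ((1 + α) * (2 / a) ^ q) * e2
          rw [e3, ha', add_sub_cancel_right]
          have := mul_le_mul_of_nonneg_left (hsmall s ⟨hs0, hs.2.trans_le hr⟩)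
            (Real.rpow_nonneg hs0.le (weightExp α d - γ))
          linarith
      _ = ENNReal.ofReal (2 * (r ^ a / a)) := by
          rw [lintegral_const_mul' _ _ ENNReal.ofReal_ne_top, lintegral_Ioo_rpow ha hr0.le,
            ENNReal.ofReal_mul zero_le_two]

theorem radialRiccati_toReal_zero (hα : -1 < α) : (radialRiccati α γ d 0).toReal = 0 := by
  rw [radialRiccati_eq hα]
  simp

theorem radialRiccati_toReal_monotoneOn {b : ℝ} (hb : ∀ r < b, radialRiccati α γ d r ≠ ∞) :
    MonotoneOn (fun r => (radialRiccati α γ d r).toReal) (Iio b) := fun _ _ s hs h =>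
  ENNReal.toReal_mono (hb s hs) (riccatiSol_monotone h)

/-- Below a radius up to which the solution is finite, the identity in [0,∞] becomes a genuine
integral equation. Continuity follows from it, and then, by bootstrapping, differentiability. -/
theorem radialRiccati_integral (hα : -1 < α) {b : ℝ} (hb : ∀ r < b, radialRiccati α γ d r ≠ ∞)
    {r : ℝ} (hr : r ∈ Ico 0 b) :
    IntervalIntegrable (fun s => s ^ (weightExp α d - γ) + (1 + α) * s ^ (1 - d) *
      (radialRiccati α γ d s).toReal ^ (1 + 1 / (1 + α))) volume 0 r ∧
    (radialRiccati α γ d r).toReal = ∫ s in 0..r, (s ^ (weightExp α d - γ) +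
      (1 + α) * s ^ (1 - d) * (radialRiccati α γ d s).toReal ^ (1 + 1 / (1 + α))) := by
  have h1 : 0 < 1 + α := by linarith
  set q := 1 + 1 / (1 + α) with hq
  have hq0 : 0 < q := by positivity
  set F : ℝ → ℝ := fun s => s ^ (weightExp α d - γ) + (1 + α) * s ^ (1 - d) *
      (radialRiccati α γ d s).toReal ^ q with hF
  have hYm : Measurable (radialRiccati α γ d) := riccatiSol_monotone.measurable
  have hFm : Measurable F := by
    have : Measurable fun s => (radialRiccati α γ d s).toReal ^ q := hYm.ennreal_toReal.pow_const q
    fun_prop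
  have hF0 : ∀ s ∈ Ioo 0 r, 0 ≤ F s := fun s hs => by
    have := hs.1
    positivity
  have heq : ∫⁻ s in Ioo 0 r, ENNReal.ofReal (F s) = radialRiccati α γ d r := by
    rw [radialRiccati_eq hα r]
    refine setLIntegral_congr_fun measurableSet_Ioo fun s hs => ?_
    have hs0 := hs.1
    have h2 : radialRiccati α γ d s ≠ ∞ := hb s (hs.2.trans hr.2)
    rw [ENNReal.ofReal_add (by positivity) (by positivity), ENNReal.ofReal_mul (by positivity),
      ENNReal.ofReal_rpow_of_nonneg (by positivity) hq0.le |>.symm, ENNReal.ofReal_toReal h2]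
  have hint : IntegrableOn F (Ioo 0 r) := by
    refine ⟨hFm.aestronglyMeasurable, ?_⟩
    rw [hasFiniteIntegral_iff_ofReal]
    · rw [heq]
      exact (hb r hr.2).lt_top
    · filter_upwards [ae_restrict_mem measurableSet_Ioo] with s hs using hF0 s hs
  refine ⟨(intervalIntegrable_iff_integrableOn_Ioo_of_le hr.1).2 hint, ?_⟩
  rw [intervalIntegral.integral_of_le hr.1, integral_Ioc_eq_integral_Ioo,
    integral_eq_lintegral_of_nonneg_ae, heq]
  · filter_upwards [ae_restrict_mem measurableSet_Ioo] with s hs using hF0 s hs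
  · exact hFm.aestronglyMeasurable

theorem continuousOn_Ico_of_Icc {f : ℝ → ℝ} {b : ℝ}
    (h : ∀ c ∈ Ico 0 b, ContinuousOn f (Icc 0 c)) : ContinuousOn f (Ico 0 b) := by
  intro x hx
  have hx1 : (x + b) / 2 ∈ Ico 0 b := ⟨by linarith [hx.1, hx.2], by linarith [hx.2]⟩
  refine (h _ hx1 x ⟨hx.1, by linarith [hx.2]⟩).mono_of_mem_nhdsWithin ?_
  filter_upwards [self_mem_nhdsWithin, mem_nhdsWithin_of_mem_nhds
    (Iio_mem_nhds (show x < (x + b) / 2 by linarith [hx.2]))] with y hy hy2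
  exact ⟨hy.1, le_of_lt hy2⟩

theorem continuousOn_of_eq_integral {f F : ℝ → ℝ} {b : ℝ}
    (h : ∀ r ∈ Ico 0 b, IntervalIntegrable F volume 0 r ∧ f r = ∫ s in 0..r, F s) :
    ContinuousOn f (Ico 0 b) := by
  refine continuousOn_Ico_of_Icc fun c hc => ?_
  have h1 := intervalIntegral.continuousOn_primitive_interval'
    (μ := volume) (h c hc).1 (a := 0) left_mem_uIcc
  rw [uIcc_of_le hc.1] at h1
  exact h1.congr fun r hr => (h r ⟨hr.1, hr.2.trans_lt hc.2⟩).2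

theorem hasDerivAt_of_eq_integral {f F : ℝ → ℝ} {b : ℝ}
    (h : ∀ r ∈ Ico 0 b, IntervalIntegrable F volume 0 r ∧ f r = ∫ s in 0..r, F s)
    (hF : ContinuousOn F (Ioo 0 b)) {r : ℝ} (hr : r ∈ Ioo 0 b) : HasDerivAt f (F r) r := by
  have h1 : HasDerivAt (fun r => ∫ s in 0..r, F s) (F r) r :=
    intervalIntegral.integral_hasDerivAt_right (h r ⟨hr.1.le, hr.2⟩).1
      (hF.stronglyMeasurableAtFilter isOpen_Ioo r hr) (hF.continuousAt (isOpen_Ioo.mem_nhds hr))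
  refine h1.congr_of_eventuallyEq ?_
  filter_upwards [isOpen_Ioo.mem_nhds hr] with s hs using (h s ⟨hs.1.le, hs.2⟩).2

theorem radialRiccati_continuousOn (hα : -1 < α) {b : ℝ}
    (hb : ∀ r < b, radialRiccati α γ d r ≠ ∞) :
    ContinuousOn (fun r => (radialRiccati α γ d r).toReal) (Ico 0 b) :=
  continuousOn_of_eq_integral fun _ hr => radialRiccati_integral hα hb hr

theorem radialRiccati_hasDerivAt (hα : -1 < α) {b : ℝ}
    (hb : ∀ r < b, radialRiccati α γ d r ≠ ∞) {r : ℝ} (hr : r ∈ Ioo 0 b) :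
    HasDerivAt (fun r => (radialRiccati α γ d r).toReal)
      (r ^ (weightExp α d - γ) + (1 + α) * r ^ (1 - d) *
        (radialRiccati α γ d r).toReal ^ (1 + 1 / (1 + α))) r := by
  have h1 : 0 < 1 + α := by linarith
  refine hasDerivAt_of_eq_integral (fun _ hr => radialRiccati_integral hα hb hr) ?_ hr
  have hc := (radialRiccati_continuousOn hα hb).mono Ioo_subset_Ico_self
  have hid : ∀ e : ℝ, ContinuousOn (fun s : ℝ => s ^ e) (Ioo 0 b) := fun e =>
    continuousOn_id.rpow_const fun s hs => Or.inl hs.1.ne'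
  exact (hid _).add ((continuousOn_const.mul (hid _)).mul
    (hc.rpow_const fun s _ => Or.inr (by positivity)))

theorem radialRiccati_toReal_ge (hα : -1 < α) (hγα : γ < 2 + α) (hd : 2 < d) {r : ℝ}
    (hr : 0 ≤ r) (hfin : radialRiccati α γ d r ≠ ∞) :
    r ^ (weightExp α d - γ + 1) / (weightExp α d - γ + 1) ≤ (radialRiccati α γ d r).toReal :=
  (ENNReal.ofReal_le_iff_le_toReal hfin).1 (rpow_div_le_radialRiccati hα hγα hd hr)

theorem radialRiccati_toReal_pos (hα : -1 < α) (hγα : γ < 2 + α) (hd : 2 < d) {r : ℝ}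
    (hr : 0 < r) (hfin : radialRiccati α γ d r ≠ ∞) : 0 < (radialRiccati α γ d r).toReal := by
  refine lt_of_lt_of_le ?_ (radialRiccati_toReal_ge hα hγα hd hr.le hfin)
  have : 0 < weightExp α d - γ + 1 := by linarith [weightExp_sub_gt hα hγα hd]
  positivity

/-- If y were finite everywhere, z = y^(-e) with e = 1/(1+α) would satisfy z' ≤ -s^(1-d). Over
[R,2R] it would fall by at least R(2R)^(1-d) = 2^(1-d) R^β R^(-ae), while the lower bound on y gives
z(R) ≤ a^e R^(-ae). For R large this contradicts z > 0. -/
theorem exists_radialRiccati_eq_top (hα : -1 < α) (hγα : γ < 2 + α) (hd : 2 < d) :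
    ∃ r, radialRiccati α γ d r = ∞ := by
  by_contra! hfin
  have h1 : 0 < 1 + α := by linarith
  have ha : 0 < weightExp α d - γ + 1 := by linarith [weightExp_sub_gt hα hγα hd]
  set a := weightExp α d - γ + 1 with ha'
  have hβ := scaling_exponent_pos hα hγα
  set β := 1 - (γ - 1) / (1 + α) with hβ'
  set e := 1 / (1 + α) with he
  have he0 : 0 < e := by positivity
  have hlim : Tendsto (fun R : ℝ => (2 : ℝ) ^ (1 - d) * R ^ β) atTop atTop :=
    (tendsto_rpow_atTop hβ).const_mul_atTop (by positivity)
  obtain ⟨R, hRa, hR⟩ := ((hlim.eventually_gt_atTop (a ^ e)).and (eventually_gt_atTop 0)).exists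
  set y := fun r => (radialRiccati α γ d r).toReal with hy
  have hy0 : ∀ r, 0 < r → 0 < y r := fun r hr =>
    radialRiccati_toReal_pos hα hγα hd hr (hfin r)
  have hder : ∀ r, 0 < r → HasDerivAt (fun s => y s ^ (-e) + s * (2 * R) ^ (1 - d))
      ((r ^ (weightExp α d - γ) + (1 + α) * r ^ (1 - d) * y r ^ (1 + e)) * (-e) *
        y r ^ (-e - 1) + 1 * (2 * R) ^ (1 - d)) r := fun r hr =>
    ((radialRiccati_hasDerivAt hα (b := r + 1) (fun s _ => hfin s)
      ⟨hr, by linarith⟩).rpow_const (Or.inl (hy0 r hr).ne')).add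
      ((hasDerivAt_id r).mul_const _)
  have hanti : AntitoneOn (fun s => y s ^ (-e) + s * (2 * R) ^ (1 - d)) (Icc R (2 * R)) := by
    refine antitoneOn_of_deriv_nonpos (convex_Icc _ _) ?_ ?_ ?_
    · exact fun s hs => (hder s (hR.trans_le hs.1)).continuousAt.continuousWithinAt
    · rw [interior_Icc]
      exact fun s hs => (hder s (hR.trans hs.1)).differentiableAt.differentiableWithinAt
    · rw [interior_Icc]
      intro s hs
      have hs0 := hR.trans hs.1
      rw [(hder s hs0).deriv]
      have hys := hy0 s hs0
      have e1 : y s ^ (1 + e) * y s ^ (-e - 1) = 1 := by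
        rw [← Real.rpow_add hys, show 1 + e + (-e - 1) = 0 by ring, Real.rpow_zero]
      have e2 : (1 + α) * e = 1 := by rw [he]; field_simp
      have e3 : (2 * R) ^ (1 - d) ≤ s ^ (1 - d) :=
        Real.rpow_le_rpow_of_nonpos hs0 hs.2.le (by linarith)
      have e4 : 0 ≤ s ^ (weightExp α d - γ) * e * y s ^ (-e - 1) := by positivity
      have e5 : (s ^ (weightExp α d - γ) + (1 + α) * s ^ (1 - d) * y s ^ (1 + e)) * (-e) *
        y s ^ (-e - 1) = - (s ^ (weightExp α d - γ) * e * y s ^ (-e - 1)) - s ^ (1 - d) := by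
        linear_combination (-(1 + α) * s ^ (1 - d) * e) * e1 - s ^ (1 - d) * e2
      rw [e5]
      linarith
  have h2 := hanti ⟨le_rfl, by linarith⟩ ⟨by linarith, le_rfl⟩ (by linarith : R ≤ 2 * R)
  have h3 : 0 < y (2 * R) ^ (-e) := Real.rpow_pos_of_pos (hy0 _ (by linarith)) _
  have h4 : y R ^ (-e) ≤ (R ^ a / a) ^ (-e) :=
    Real.rpow_le_rpow_of_nonpos (by positivity)
      (radialRiccati_toReal_ge hα hγα hd hR.le (hfin R)) (by linarith)
  have h5 : (R ^ a / a) ^ (-e) = a ^ e * R ^ (-(a * e)) := by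
    rw [Real.div_rpow (by positivity) ha.le, ← Real.rpow_mul hR.le, Real.rpow_neg ha.le]
    field_simp
  have h6 : R * (2 * R) ^ (1 - d) = 2 ^ (1 - d) * R ^ β * R ^ (-(a * e)) := by
    rw [Real.mul_rpow zero_le_two hR.le, mul_assoc, ← Real.rpow_add hR,
      show β + -(a * e) = 1 - d + 1 from ?_, Real.rpow_add_one hR.ne']
    · ring
    · rw [hβ', ha', he]
      unfold weightExp
      field_simp
      ring
  have h7 : 0 < R ^ (-(a * e)) := Real.rpow_pos_of_pos hR _
  nlinarith

/-- Take b as the supremum of the radii with finite value. Were the solution bounded to the left of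
b, extending it past b by a slightly larger constant would give a supersolution, hence a finite
solution beyond b. -/
theorem exists_radialRiccati_blowup (hα : -1 < α) (hγα : γ < 2 + α) (hd : 2 < d) :
    ∃ b > 0, (∀ r < b, radialRiccati α γ d r ≠ ∞) ∧
      Tendsto (fun r => (radialRiccati α γ d r).toReal) (𝓝[<] b) atTop := by
  have h1 : 0 < 1 + α := by linarith
  obtain ⟨b0, hb0, hle⟩ := exists_radialRiccati_le hα hγα hd
  obtain ⟨r1, hr1⟩ := exists_radialRiccati_eq_top hα hγα hd
  have hmono : Monotone (radialRiccati α γ d) := riccatiSol_monotone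
  set S := {r | radialRiccati α γ d r ≠ ∞} with hS
  have hbS : b0 ∈ S := ne_top_of_le_ne_top ENNReal.ofReal_ne_top (hle b0 ⟨hb0.le, le_rfl⟩)
  have hbdd : BddAbove S := ⟨r1, fun r hr => by
    by_contra! hlt
    exact hr (top_le_iff.1 (hr1 ▸ hmono hlt.le))⟩
  set b := sSup S with hb
  have hbpos : 0 < b := hb0.trans_le (le_csSup hbdd hbS)
  have hfin : ∀ r < b, radialRiccati α γ d r ≠ ∞ := fun r hr => by
    obtain ⟨s, hs, hrs⟩ := exists_lt_of_lt_csSup ⟨b0, hbS⟩ hr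
    exact ne_top_of_le_ne_top hs (hmono hrs.le)
  refine ⟨b, hbpos, hfin, ?_⟩
  suffices h : ∀ M : ℝ, 0 ≤ M → ∃ r < b, M < (radialRiccati α γ d r).toReal by
    refine tendsto_atTop.2 fun M => ?_
    obtain ⟨r, hr, hM⟩ := h (max M 0) (le_max_right _ _)
    filter_upwards [Ioo_mem_nhdsLT hr] with s hs
    exact ((le_max_left M 0).trans hM.le).trans
      (radialRiccati_toReal_monotoneOn hfin hr hs.2 hs.1.le)
  by_contra! hcon
  obtain ⟨M, hM0, hM⟩ := hcon
  set G : ℝ → ℝ := fun s => s ^ (weightExp α d - γ) +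
    (1 + α) * s ^ (1 - d) * (M + 1) ^ (1 + 1 / (1 + α)) with hG
  have hGc : ContinuousOn G (Icc b (b + 1)) := by
    have hid : ∀ e : ℝ, ContinuousOn (fun s : ℝ => s ^ e) (Icc b (b + 1)) := fun e =>
      continuousOn_id.rpow_const fun s hs => Or.inl (hbpos.trans_le hs.1).ne'
    exact (hid _).add ((continuousOn_const.mul (hid _)).mul continuousOn_const)
  obtain ⟨K, hK⟩ := isCompact_Icc.exists_bound_of_continuousOn hGc
  have hK0 : 0 ≤ K := (norm_nonneg _).trans (hK b ⟨le_rfl, by linarith⟩)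
  -- The right-hand side with y frozen at M + 1 is at most K on [b, b+1], so over a length ε the
  -- solution gains at most Kε ≤ 1 and stays below M + 1.
  set ε := 1 / (K + 1) with hε
  have hε0 : 0 < ε := by positivity
  have hε1 : ε ≤ 1 := by rw [hε, div_le_one (by positivity)]; linarith
  have hKε : K * ε ≤ 1 := by rw [hε, mul_one_div, div_le_one (by positivity)]; linarith
  -- The value at b is bounded too: the integral over (0,b) is the supremum of the integrals over an
  -- increasing sequence of smaller intervals.
  have hbM : radialRiccati α γ d b ≤ ENNReal.ofReal M := by
    refine iSup_le fun n => ?_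
    cases n with
    | zero => exact zero_le
    | succ n =>
      rw [Function.iterate_succ_apply']
      have hU : Ioo 0 b = ⋃ n : ℕ, Ioo 0 (b - 1 / (n + 1)) := by
        ext x
        simp only [mem_Ioo, mem_iUnion]
        constructor
        · rintro ⟨h0, hx⟩
          obtain ⟨n, hn⟩ := exists_nat_one_div_lt (sub_pos.2 hx)
          exact ⟨n, h0, by linarith⟩
        · rintro ⟨n, h0, hx⟩
          have : (0 : ℝ) < 1 / (n + 1) := by positivity
          exact ⟨h0, by linarith⟩
      unfold riccatiStep
      rw [hU, setLIntegral_iUnion_of_directed]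
      · refine iSup_le fun m => ?_
        have hlt : b - 1 / ((m : ℝ) + 1) < b := by
          have : (0 : ℝ) < 1 / (m + 1) := by positivity
          linarith
        refine le_trans ?_ ((ENNReal.le_ofReal_iff_toReal_le (hfin _ hlt) hM0).2 (hM _ hlt))
        rw [radialRiccati_eq hα]
        refine lintegral_mono fun s => ?_
        gcongr
        exact le_iSup (fun n : ℕ => (riccatiStep _ _ _)^[n] 0 s) n
      · refine directed_of_isDirected_le fun i j hij => Ioo_subset_Ioo_right ?_
        gcongr
  have hbε : radialRiccati α γ d (b + ε) ≠ ∞ := by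
    have hZ := riccatiSol_le (A := fun s => ENNReal.ofReal (s ^ (weightExp α d - γ)))
      (C := fun s => ENNReal.ofReal ((1 + α) * s ^ (1 - d))) (q := 1 + 1 / (1 + α))
      (Z := fun r => if r < b then radialRiccati α γ d r else ENNReal.ofReal (M + 1))
      (b := b + ε) (by positivity) ?_ le_rfl
    · rw [if_neg (by linarith)] at hZ
      exact ne_top_of_le_ne_top ENNReal.ofReal_ne_top hZ
    · intro r hr
      have hcongr : ∀ t ≤ b, riccatiStep (fun s => ENNReal.ofReal (s ^ (weightExp α d - γ)))
          (fun s => ENNReal.ofReal ((1 + α) * s ^ (1 - d))) (1 + 1 / (1 + α))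
          (fun r => if r < b then radialRiccati α γ d r else ENNReal.ofReal (M + 1)) t =
          radialRiccati α γ d t := fun t ht => by
        rw [radialRiccati_eq hα]
        refine setLIntegral_congr_fun measurableSet_Ioo fun s hs => ?_
        simp only [if_pos (hs.2.trans_le ht)]
      rcases lt_or_ge r b with hrb | hrb
      · rw [hcongr r hrb.le, if_pos hrb]
      · rw [if_neg hrb.not_gt]
        have hsub : Ioo 0 r ⊆ Ioo 0 b ∪ Icc b r := fun x hx => by
          rcases lt_or_ge x b with h | h
          · exact Or.inl ⟨hx.1, h⟩
          · exact Or.inr ⟨h, hx.2.le⟩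
        unfold riccatiStep
        refine (lintegral_mono_set hsub).trans ((lintegral_union_le _ _ _).trans ?_)
        refine le_trans (add_le_add ((hcongr b le_rfl).le.trans hbM) ?_)
          (ENNReal.ofReal_add hM0 zero_le_one).ge
        have h2 : ∀ s ∈ Icc b r, (ENNReal.ofReal (s ^ (weightExp α d - γ)) +
            ENNReal.ofReal ((1 + α) * s ^ (1 - d)) *
            (if s < b then radialRiccati α γ d s else ENNReal.ofReal (M + 1)) ^
              (1 + 1 / (1 + α))) ≤ ENNReal.ofReal K := fun s hs => by
          have hs0 := hbpos.trans_le hs.1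
          rw [if_neg hs.1.not_gt, ENNReal.ofReal_rpow_of_nonneg (by positivity) (by positivity),
            ← ENNReal.ofReal_mul (by positivity),
            ← ENNReal.ofReal_add (by positivity) (by positivity)]
          exact ENNReal.ofReal_le_ofReal ((le_abs_self _).trans
            (hK s ⟨hs.1, hs.2.trans (by linarith)⟩))
        refine (setLIntegral_mono' measurableSet_Icc h2).trans ?_
        rw [setLIntegral_const, Real.volume_Icc, ← ENNReal.ofReal_mul hK0]
        exact ENNReal.ofReal_le_ofReal
          ((mul_le_mul_of_nonneg_left (by linarith : r - b ≤ ε) hK0).trans hKε)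
  have := le_csSup hbdd (show b + ε ∈ S from hbε)
  linarith

end RadialRiccati

/-! ### From the Riccati solution to a profile -/

/-- Inverting y = Φ/φ^(1+α): the logarithmic slope -φ'/φ must be k = r^(1-d) y^(1/(1+α)), so φ =
exp(-∫k), and Φ is defined as y φ^(1+α). The Riccati equation is then the flux equation with
eigenvalue 1. -/
theorem exists_isProfile_one {α γ d : ℝ} (hα : -1 < α) (hγα : γ < 2 + α)
    (hd : 2 < d) : ∃ R φ Φ, IsProfile α γ d R 1 φ Φ := by
  have h1 : 0 < 1 + α := by linarith
  have ha : 0 < weightExp α d - γ + 1 := by linarith [weightExp_sub_gt hα hγα hd]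
  obtain ⟨b, hb0, hfin, hblow⟩ := exists_radialRiccati_blowup (α := α) (γ := γ) (d := d) hα hγα hd
  obtain ⟨b0, hb00, hle⟩ := exists_radialRiccati_le (α := α) (γ := γ) (d := d) hα hγα hd
  set a := weightExp α d - γ + 1 with ha'
  set y : ℝ → ℝ := fun r => (radialRiccati α γ d r).toReal with hy
  set e := 1 / (1 + α) with he
  have he0 : 0 < e := by positivity
  have hycont : ContinuousOn y (Ico 0 b) := radialRiccati_continuousOn hα hfin
  have hy0 : ∀ r ∈ Ioo 0 b, 0 < y r := fun r hr =>
    radialRiccati_toReal_pos hα hγα hd hr.1 (hfin r hr.2)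
  have hyder := fun r (hr : r ∈ Ioo 0 b) => radialRiccati_hasDerivAt hα hfin hr
  set k : ℝ → ℝ := fun s => s ^ (1 - d) * y s ^ e with hk
  have hkcont : ContinuousOn k (Ioo 0 b) :=
    (continuousOn_id.rpow_const fun s hs => Or.inl hs.1.ne').mul
      ((hycont.mono Ioo_subset_Ico_self).rpow_const fun s _ => Or.inr he0.le)
  have hkm : Measurable k := by
    have : Measurable y := (riccatiSol_monotone.measurable).ennreal_toReal
    have := this.pow_const e
    fun_prop
  have hkint : ∀ r ∈ Ico 0 b, IntervalIntegrable k volume 0 r := by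
    intro r hr
    set c := min (b / 2) b0 with hc
    have hc0 : 0 < c := lt_min (by positivity) hb00
    have hcb : c < b := (min_le_left _ _).trans_lt (by linarith)
    have hfirst : IntervalIntegrable k volume 0 c := by
      -- Near 0, y ≤ 2 s^a/a bounds k by a constant times s^(β-1), which is integrable since β > 0.
      have hdom : IntervalIntegrable (fun s : ℝ => (2 / a) ^ e * s ^ (1 - d + a * e)) volume 0 c := by
        refine (intervalIntegral.intervalIntegrable_rpow' ?_).const_mul _
        have hβ := scaling_exponent_pos hα hγα
        have : 1 - d + a * e = (1 - (γ - 1) / (1 + α)) - 1 := by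
          rw [ha', he]
          unfold weightExp
          field_simp
          ring
        linarith
      rw [intervalIntegrable_iff_integrableOn_Ioo_of_le hc0.le] at hdom ⊢
      refine hdom.mono' hkm.aestronglyMeasurable ?_
      filter_upwards [ae_restrict_mem measurableSet_Ioo] with s hs
      have hs0 := hs.1
      have hys := hy0 s ⟨hs.1, hs.2.trans hcb⟩
      have hyle : y s ≤ 2 * (s ^ a / a) :=
        ENNReal.toReal_le_of_le_ofReal (by positivity)
          (hle s ⟨hs.1.le, hs.2.le.trans (min_le_right _ _)⟩)
      rw [Real.norm_of_nonneg (by positivity)]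
      have h2 : y s ^ e ≤ (2 * (s ^ a / a)) ^ e := Real.rpow_le_rpow hys.le hyle he0.le
      have h3 : (2 * (s ^ a / a)) ^ e = (2 / a) ^ e * s ^ (a * e) := by
        rw [Real.rpow_mul hs0.le, ← Real.mul_rpow (by positivity) (by positivity)]
        ring_nf
      calc k s ≤ s ^ (1 - d) * ((2 / a) ^ e * s ^ (a * e)) := 
          mul_le_mul_of_nonneg_left (h2.trans h3.le) (by positivity)
        _ = _ := by rw [Real.rpow_add hs0]; ring
    rcases le_or_gt r c with hrc | hrc
    · refine hfirst.mono_set ?_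
      rw [uIcc_of_le hr.1, uIcc_of_le hc0.le]
      exact Icc_subset_Icc_right hrc
    · refine hfirst.trans (ContinuousOn.intervalIntegrable ?_)
      rw [uIcc_of_le hrc.le]
      exact hkcont.mono fun s hs => ⟨hc0.trans_le hs.1, hs.2.trans_lt hr.2⟩
  set E : ℝ → ℝ := fun r => ∫ s in 0..r, k s with hE
  have hEcont : ContinuousOn E (Ico 0 b) :=
    continuousOn_of_eq_integral (F := k) fun r hr => ⟨hkint r hr, rfl⟩
  have hEder : ∀ r ∈ Ioo 0 b, HasDerivAt E (k r) r := fun r hr =>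
    hasDerivAt_of_eq_integral (fun r hr => ⟨hkint r hr, rfl⟩) hkcont hr
  set φ : ℝ → ℝ := fun r => if r < b then Real.exp (-E r) else 0 with hφ
  have hφeq : EqOn φ (fun r => Real.exp (-E r)) (Ico 0 b) := fun r hr => if_pos hr.2
  have hφcont : ContinuousOn φ (Ico 0 b) := (hEcont.neg.rexp).congr hφeq
  have hφpos : ∀ r ∈ Ico 0 b, 0 < φ r := fun r hr => by rw [hφeq hr]; exact Real.exp_pos _
  have hφder : ∀ r ∈ Ioo 0 b, HasDerivAt φ (-(φ r * k r)) r := fun r hr => by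
    have h2 : HasDerivAt (fun r => Real.exp (-E r)) (-(φ r * k r)) r := by
      refine ((hEder r hr).fun_neg.exp).congr_deriv ?_
      rw [hφeq ⟨hr.1.le, hr.2⟩]
      ring
    refine h2.congr_of_eventuallyEq ?_
    filter_upwards [isOpen_Ioo.mem_nhds hr] with s hs using hφeq ⟨hs.1.le, hs.2⟩
  set Φ : ℝ → ℝ := fun r => y r * φ r ^ (1 + α) with hΦ
  have hy00 : y 0 = 0 := radialRiccati_toReal_zero hα
  have hΦ0 : Φ 0 = 0 := by simp [hΦ, hy00]
  have hΦcont : ContinuousOn Φ (Ico 0 b) := hycont.mul (hφcont.rpow_const fun _ _ => Or.inr h1.le)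
  have hΦder : ∀ r ∈ Ioo 0 b, HasDerivAt Φ (1 * (r ^ (weightExp α d - γ) * φ r ^ (1 + α))) r := by
    intro r hr
    have hp := hφpos r ⟨hr.1.le, hr.2⟩
    have hyr := hy0 r hr
    refine ((hyder r hr).mul ((hφder r hr).rpow_const (p := 1 + α) (Or.inl hp.ne'))).congr_deriv ?_
    have e1 : φ r ^ (1 + α) = φ r ^ (1 + α - 1) * φ r := by
      rw [← Real.rpow_add_one hp.ne']
      ring_nf
    have e2 : y r ^ (1 + e) = y r * y r ^ e := by rw [Real.rpow_add hyr, Real.rpow_one]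
    rw [show (radialRiccati α γ d r).toReal = y r from rfl, e2, e1]
    simp only [hk]
    ring
  have hφle : ∀ r ∈ Ico 0 b, φ r ≤ 1 := fun r hr => by
    rw [hφeq hr, Real.exp_le_one_iff, neg_nonpos]
    refine intervalIntegral.integral_nonneg hr.1 fun s hs => ?_
    exact mul_nonneg (Real.rpow_nonneg hs.1 _) (Real.rpow_nonneg ENNReal.toReal_nonneg _)
  have hΦle : ∀ r ∈ Ico 0 b, Φ r ≤ b ^ a / a := fun r hr => by
    refine (le_mul_rpow_div ha zero_le_one hΦcont hΦ0 hΦder (fun s hs => ?_) hr).trans ?_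
    · exact Real.rpow_le_one (hφpos s ⟨hs.1.le, hs.2⟩).le (hφle s ⟨hs.1.le, hs.2⟩) h1.le
    · rw [one_mul]
      exact div_le_div_of_nonneg_right (Real.rpow_le_rpow hr.1 hr.2.le ha.le) ha.le
  -- The flux Φ is bounded while y blows up, so φ^(1+α) = Φ/y tends to 0. This is why the value 0
  -- assigned at b keeps φ continuous.
  have hφend : Tendsto φ (𝓝[<] b) (𝓝 0) := by
    have hlim : Tendsto (fun r => (b ^ a / a / y r) ^ e) (𝓝[<] b) (𝓝 0) := by
      have := (hblow.const_div_atTop (b ^ a / a)).rpow_const (p := e) (Or.inr he0.le)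
      rwa [Real.zero_rpow he0.ne'] at this
    refine squeeze_zero' ?_ ?_ hlim
    · filter_upwards [Ioo_mem_nhdsLT hb0] with r hr using (hφpos r ⟨hr.1.le, hr.2⟩).le
    · filter_upwards [Ioo_mem_nhdsLT hb0] with r hr
      have hp := hφpos r ⟨hr.1.le, hr.2⟩
      have e1 : φ r = (φ r ^ (1 + α)) ^ e := by
        rw [← Real.rpow_mul hp.le, he, show (1 + α) * (1 / (1 + α)) = 1 by field_simp,
          Real.rpow_one]
      rw [e1]
      refine Real.rpow_le_rpow (by positivity) ?_ he0.le
      rw [le_div_iff₀ (hy0 r hr), mul_comm]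
      exact hΦle r ⟨hr.1.le, hr.2⟩
  refine ⟨b, φ, Φ, hb0, one_pos, ?_, ?_, ?_, hφpos, hΦcont, hΦ0, ?_, hΦder⟩
  · intro r hr
    rcases hr.2.lt_or_eq with hrb | rfl
    · refine (hφcont r ⟨hr.1, hrb⟩).mono_of_mem_nhdsWithin ?_
      filter_upwards [self_mem_nhdsWithin, mem_nhdsWithin_of_mem_nhds (Iio_mem_nhds hrb)] with s h h'
      exact ⟨h.1, h'⟩
    · have h2 : φ r = 0 := if_neg (lt_irrefl _)
      refine (continuousWithinAt_Iio_iff_Iic.1 ?_).mono Icc_subset_Iic_self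
      rw [ContinuousWithinAt, h2]
      exact hφend
  · simp [hφeq ⟨le_rfl, hb0⟩, hE]
  · exact if_neg (lt_irrefl _)
  · intro r hr
    refine (hφder r hr).congr_deriv ?_
    have hp := hφpos r ⟨hr.1.le, hr.2⟩
    have hyr := hy0 r hr
    have hr0 := hr.1
    simp only [hΦ, hk]
    rw [Real.mul_rpow (by positivity) (by positivity), Real.mul_rpow hyr.le (by positivity),
      ← Real.rpow_mul hr.1.le, ← Real.rpow_mul hp.le,
      show (1 + α) * (1 / (1 + α)) = 1 by field_simp, Real.rpow_one,
      show -weightExp α d * (1 / (1 + α)) = 1 - d by unfold weightExp; field_simp; ring]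
    ring

/-! ### Pucci's operator on radial Hessians -/

/-- Pucci's sup operator on a symmetric matrix with the simple eigenvalue `b` and the eigenvalue
`a` of multiplicity `N - 1`. -/
noncomputable def pucciRadial (N : ℕ) (l L a b : ℝ) : ℝ :=
  max (L * b) (l * b) + ((N : ℝ) - 1) * max (L * a) (l * a)

theorem max_mul_eq {l L : ℝ} (hlL : l ≤ L) (x : ℝ) :
    max (L * x) (l * x) = L * max x 0 - l * max (-x) 0 := by
  rcases le_total 0 x with hx | hx
  · rw [max_eq_left hx, max_eq_right (neg_nonpos.2 hx), max_eq_left (by gcongr)]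
    ring
  · rw [max_eq_right hx, max_eq_left (neg_nonneg.2 hx), max_eq_right (by nlinarith)]
    ring

theorem max_mul_add_le {l L s t x y : ℝ} (hs : 0 ≤ s) (ht : 0 ≤ t) :
    max (L * (s * x + t * y)) (l * (s * x + t * y)) ≤
      s * max (L * x) (l * x) + t * max (L * y) (l * y) := by
  have h1 := mul_le_mul_of_nonneg_left (le_max_left (L * x) (l * x)) hs
  have h2 := mul_le_mul_of_nonneg_left (le_max_right (L * x) (l * x)) hs
  have h3 := mul_le_mul_of_nonneg_left (le_max_left (L * y) (l * y)) ht
  have h4 := mul_le_mul_of_nonneg_left (le_max_right (L * y) (l * y)) ht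
  refine max_le ?_ ?_ <;> linarith

/-- In an eigenbasis, the positive and negative parts are the diagonal matrices of the positive and
negative parts of the eigenvalues; uniqueness of the decomposition identifies them with `M⁺` and
`M⁻`. -/
theorem pucciSup_eq_sum {N : ℕ} {l L : ℝ} (hlL : l ≤ L) {M : Matrix (Fin N) (Fin N) ℝ}
    (hM : M.IsHermitian) :
    pucciSup l L M = ∑ i, max (L * hM.eigenvalues i) (l * hM.eigenvalues i) := by
  set U : Matrix (Fin N) (Fin N) ℝ := (hM.eigenvectorUnitary : Matrix (Fin N) (Fin N) ℝ) with hU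
  set V : Matrix (Fin N) (Fin N) ℝ := star U with hV
  have hVU : V * U = 1 := Unitary.coe_star_mul_self hM.eigenvectorUnitary
  have hP : ∀ f : Fin N → ℝ, (∀ i, 0 ≤ f i) → (U * Matrix.diagonal f * V).PosSemidef :=
    fun f hf => (Matrix.PosSemidef.diagonal hf).mul_mul_conjTranspose_same U
  have htr : ∀ f : Fin N → ℝ, (U * Matrix.diagonal f * V).trace = ∑ i, f i := fun f => by
    rw [Matrix.trace_mul_comm, ← mul_assoc, hVU, one_mul, Matrix.trace_diagonal]
  have hmul : ∀ f g : Fin N → ℝ, (∀ i, f i * g i = 0) →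
      (U * Matrix.diagonal f * V) * (U * Matrix.diagonal g * V) = 0 := fun f g hfg => by
    have : (U * Matrix.diagonal f * V) * (U * Matrix.diagonal g * V) =
      U * (Matrix.diagonal f * (V * U) * Matrix.diagonal g) * V := by noncomm_ring
    rw [this, hVU, mul_one, Matrix.diagonal_mul_diagonal]
    simp [hfg]
  have hdec : M = U * Matrix.diagonal (fun i => max (hM.eigenvalues i) 0) * V -
      U * Matrix.diagonal (fun i => max (-hM.eigenvalues i) 0) * V := by
    rw [← sub_mul, ← mul_sub, Matrix.diagonal_sub]
    have h1 := hM.spectral_theorem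
    rw [Unitary.conjStarAlgAut_apply] at h1
    conv_lhs => rw [h1]
    congr 3
    funext i
    simp only [Function.comp, RCLike.ofReal_real_eq_id, id]
    rcases le_total 0 (hM.eigenvalues i) with h | h
    · simp [h]
    · simp [h]
  conv_lhs => rw [hdec]
  rw [pucciSup_sub l L (hP _ fun i => le_max_right _ _) (hP _ fun i => le_max_right _ _)
    (hmul _ _ fun i => ?_), htr, htr, Finset.mul_sum, Finset.mul_sum, ← Finset.sum_sub_distrib]
  · simp_rw [max_mul_eq hlL]
  · rcases le_total 0 (hM.eigenvalues i) with h | h <;> simp [h]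

/-- Each eigenvalue is at most t_i b + (1-t_i) a with t_i = ⟨e, v_i⟩², and the t_i sum to 1. The
function x ↦ max(Lx, lx) is increasing and sublinear, so summing gives weight 1 to b and N-1 to a.
-/
theorem pucciSup_le_pucciRadial {N : ℕ} {l L : ℝ} (hl : 0 < l) (hlL : l ≤ L)
    {M : Matrix (Fin N) (Fin N) ℝ} (hM : M.IsHermitian) {e : Euc N} (he : ‖e‖ = 1) {a b : ℝ}
    (h : ∀ v : Euc N, v.ofLp ⬝ᵥ M.mulVec v.ofLp ≤
      b * inner ℝ e v ^ 2 + a * (‖v‖ ^ 2 - inner ℝ e v ^ 2)) :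
    pucciSup l L M ≤ pucciRadial N l L a b := by
  rw [pucciSup_eq_sum hlL hM]
  have hev : ∀ i, hM.eigenvalues i ≤ inner ℝ e (hM.eigenvectorBasis i) ^ 2 * b +
      (1 - inner ℝ e (hM.eigenvectorBasis i) ^ 2) * a := fun i => by
    have h1 := h (hM.eigenvectorBasis i)
    rw [hM.mulVec_eigenvectorBasis, dotProduct_smul] at h1
    have h2 : (hM.eigenvectorBasis i).ofLp ⬝ᵥ (hM.eigenvectorBasis i).ofLp = 1 := by
      have := real_inner_self_eq_norm_sq (hM.eigenvectorBasis i)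
      rw [hM.eigenvectorBasis.norm_eq_one, EuclideanSpace.inner_eq_star_dotProduct] at this
      simpa using this
    rw [h2, hM.eigenvectorBasis.norm_eq_one, smul_eq_mul, mul_one] at h1
    linarith
  have hsum : ∑ i, inner ℝ e (hM.eigenvectorBasis i) ^ 2 = 1 := by
    rw [hM.eigenvectorBasis.sum_sq_inner_left, he, one_pow]
  have hle1 : ∀ i, inner ℝ e (hM.eigenvectorBasis i) ^ 2 ≤ 1 := fun i => by
    rw [← hsum]
    exact Finset.single_le_sum (f := fun i => inner ℝ e (hM.eigenvectorBasis i) ^ 2)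
      (fun j _ => sq_nonneg _) (Finset.mem_univ i)
  have hmono : ∀ {x y : ℝ}, x ≤ y → max (L * x) (l * x) ≤ max (L * y) (l * y) := fun hxy =>
    max_le_max (mul_le_mul_of_nonneg_left hxy (hl.le.trans hlL))
      (mul_le_mul_of_nonneg_left hxy hl.le)
  refine (Finset.sum_le_sum fun i _ => (hmono (hev i)).trans
    (max_mul_add_le (sq_nonneg _) (sub_nonneg.2 (hle1 i)))).trans (le_of_eq ?_)
  rw [Finset.sum_add_distrib, ← Finset.sum_mul, ← Finset.sum_mul, Finset.sum_sub_distrib, hsum]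
  simp [pucciRadial]

/-- The projections onto e and onto its orthogonal complement annihilate each other, so taking
positive and negative parts of the two coefficients decomposes the matrix. -/
theorem pucciSup_radial {N : ℕ} {l L : ℝ} (hlL : l ≤ L) {e : Fin N → ℝ} (he : e ⬝ᵥ e = 1)
    (a b : ℝ) :
    pucciSup l L (a • (1 - Matrix.vecMulVec e e) + b • Matrix.vecMulVec e e) =
      pucciRadial N l L a b := by
  set E := Matrix.vecMulVec e e with hE
  have hEE : E * E = E := by rw [hE, Matrix.vecMulVec_mul_vecMulVec, he]; simp
  have hEP : E.PosSemidef := by simpa using Matrix.posSemidef_vecMulVec_self_star e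
  have hFF : (1 - E) * (1 - E) = 1 - E := by
    rw [sub_mul, mul_sub, mul_sub, hEE]; simp
  have hFP : (1 - E).PosSemidef := by
    have h1 : (1 - E).conjTranspose = 1 - E := by
      rw [Matrix.conjTranspose_sub, Matrix.conjTranspose_one, hEP.isHermitian.eq]
    have := Matrix.posSemidef_conjTranspose_mul_self (1 - E)
    rwa [h1, hFF] at this
  have hEF : E * (1 - E) = 0 := by rw [mul_sub, hEE]; simp
  have hFE : (1 - E) * E = 0 := by rw [sub_mul, hEE]; simp
  have htE : E.trace = 1 := by rw [hE, Matrix.trace_vecMulVec, he]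
  have htF : (1 - E).trace = (N : ℝ) - 1 := by
    rw [Matrix.trace_sub, htE, Matrix.trace_one, Fintype.card_fin]
  have hpos : ∀ s t : ℝ, 0 ≤ s → 0 ≤ t → (s • (1 - E) + t • E).PosSemidef := fun s t hs ht =>
    (hFP.smul hs).add (hEP.smul ht)
  have hdec : a • (1 - E) + b • E = (max a 0 • (1 - E) + max b 0 • E) -
      (max (-a) 0 • (1 - E) + max (-b) 0 • E) := by
    have h1 : ∀ x : ℝ, x = max x 0 - max (-x) 0 := fun x => by
      rcases le_total 0 x with h | h <;> simp [h]
    conv_lhs => rw [h1 a, h1 b]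
    module
  have h0 : ∀ x : ℝ, max x 0 * max (-x) 0 = 0 := fun x => by
    rcases le_total 0 x with h | h <;> simp [h]
  rw [hdec, pucciSup_sub l L (hpos _ _ (le_max_right _ _) (le_max_right _ _))
    (hpos _ _ (le_max_right _ _) (le_max_right _ _))]
  · rw [pucciRadial, max_mul_eq hlL, max_mul_eq hlL]
    simp only [Matrix.trace_add, Matrix.trace_smul, htE, htF, smul_eq_mul]
    ring
  · simp only [add_mul, mul_add, smul_mul_smul, hEE, hFF, hEF, hFE, h0]
    simp

theorem pucciRadial_ge {N : ℕ} {l L a : ℝ} (hN : 1 ≤ N) (b : ℝ) :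
    L * b + ((N : ℝ) - 1) * (l * a) ≤ pucciRadial N l L a b := by
  have : (0 : ℝ) ≤ (N : ℝ) - 1 := by
    rw [sub_nonneg]
    exact_mod_cast hN
  exact add_le_add (le_max_left _ _) (mul_le_mul_of_nonneg_left (le_max_right _ _) this)

theorem hessianMatrix_dotProduct {N : ℕ} (ψ : Euc N → ℝ) (x v : Euc N) :
    v.ofLp ⬝ᵥ (hessianMatrix ψ x).mulVec v.ofLp = fderiv ℝ (fderiv ℝ ψ) x v v := by
  have hv : v = ∑ i, v.ofLp i • EuclideanSpace.single i (1 : ℝ) := by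
    ext j
    simp [Finset.sum_apply, Pi.single_apply]
  conv_rhs => rw [hv]
  simp only [map_sum, map_smul, sum_apply, smul_apply, dotProduct, Matrix.mulVec, hessianMatrix, Matrix.of_apply, Finset.mul_sum, smul_eq_mul]
  rw [Finset.sum_comm]
  refine Finset.sum_congr rfl fun j _ => Finset.sum_congr rfl fun i _ => ?_
  ring

theorem isHermitian_hessianMatrix {N : ℕ} {ψ : Euc N → ℝ} {x : Euc N} (h : ContDiffAt ℝ 2 ψ x) :
    (hessianMatrix ψ x).IsHermitian := by
  refine Matrix.IsHermitian.ext fun i j => ?_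
  have := h.isSymmSndFDerivAt (by simp)
  simp only [hessianMatrix, Matrix.of_apply, star_trivial]
  exact this _ _

/-- Even quartics in |x| are smooth test functions with an explicit Hessian. At any r > 0 they can
take any prescribed radial first and second derivatives, so they suffice as radial test functions.
-/
theorem hasFDerivAt_quartic {N : ℕ} (A B C : ℝ) (x : Euc N) :
    HasFDerivAt (fun x : Euc N => A + B * ‖x‖ ^ 2 + C * (‖x‖ ^ 2) ^ 2)
      ((2 * B + 4 * C * ‖x‖ ^ 2) • innerSL ℝ x) x := by
  have h1 : HasFDerivAt (fun x : Euc N => ‖x‖ ^ 2) (2 • innerSL ℝ x) x :=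
    (hasStrictFDerivAt_norm_sq x).hasFDerivAt
  have h2 := ((h1.const_mul B).const_add A).add ((h1.pow 2).const_mul C)
  refine h2.congr_fderiv ?_
  ext v
  simp
  ring

theorem gradient_quartic {N : ℕ} (A B C : ℝ) (x : Euc N) :
    gradient (fun x : Euc N => A + B * ‖x‖ ^ 2 + C * (‖x‖ ^ 2) ^ 2) x =
      (2 * B + 4 * C * ‖x‖ ^ 2) • x := by
  refine HasGradientAt.gradient ?_
  rw [hasGradientAt_iff_hasFDerivAt]
  refine (hasFDerivAt_quartic A B C x).congr_fderiv ?_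
  ext v
  simp

theorem hessianMatrix_quartic {N : ℕ} (A B C : ℝ) (x : Euc N) :
    hessianMatrix (fun x : Euc N => A + B * ‖x‖ ^ 2 + C * (‖x‖ ^ 2) ^ 2) x =
      (2 * B + 4 * C * ‖x‖ ^ 2) • (1 : Matrix (Fin N) (Fin N) ℝ) +
        (8 * C) • Matrix.vecMulVec x.ofLp x.ofLp := by
  have hf : fderiv ℝ (fun x : Euc N => A + B * ‖x‖ ^ 2 + C * (‖x‖ ^ 2) ^ 2) =
      fun x => (2 * B + 4 * C * ‖x‖ ^ 2) • innerSL ℝ x :=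
    funext fun x => (hasFDerivAt_quartic A B C x).fderiv
  have h1 : HasFDerivAt (fun x : Euc N => ‖x‖ ^ 2) (2 • innerSL ℝ x) x :=
    (hasStrictFDerivAt_norm_sq x).hasFDerivAt
  have h2 : fderiv ℝ (fun x : Euc N => (2 * B + 4 * C * ‖x‖ ^ 2) • innerSL ℝ x) x = _ :=
    (((h1.const_mul (4 * C)).const_add (2 * B)).smul
      ((innerSL ℝ : Euc N →L[ℝ] Euc N →L[ℝ] ℝ).hasFDerivAt (x := x))).fderiv
  have h3 : ∀ v w : Euc N,
      fderiv ℝ (fun x : Euc N => (2 * B + 4 * C * ‖x‖ ^ 2) • innerSL ℝ x) x v w =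
        (2 * B + 4 * C * ‖x‖ ^ 2) * inner ℝ v w +
          4 * C * (2 * inner ℝ x v) * inner ℝ x w := fun v w => by
    rw [h2]
    simp
    rfl
  ext i j
  simp only [hessianMatrix, Matrix.of_apply]
  rw [hf, h3]
  simp [EuclideanSpace.inner_single_right, Matrix.one_apply, Matrix.vecMulVec_apply,
    eq_comm (a := i)]
  ring

/-! ### From viscosity supersolutions to a one-dimensional inequality -/

theorem mem_puncturedBall_iff {N : ℕ} {x : Euc N} : x ∈ puncturedBall N ↔ ‖x‖ ∈ Ioo (0 : ℝ) 1 := by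
  simp [puncturedBall, and_comm]

theorem isOpen_puncturedBall (N : ℕ) : IsOpen (puncturedBall N) :=
  Metric.isOpen_ball.sdiff isClosed_singleton

section RadialTest

variable {N : ℕ} {l L α γ μ : ℝ} {u : Euc N → ℝ} {U : ℝ → ℝ}

theorem quartic_test (hlL : l ≤ L)
    (hu : IsViscositySupersolution α γ (pucciSup l L) μ u)
    (hU : ∀ x ∈ puncturedBall N, u x = U ‖x‖) {e : Euc N} (he : ‖e‖ = 1)
    {r : ℝ} (hr : r ∈ Ioo (0 : ℝ) 1) {A B C : ℝ} (hne : (2 * B + 4 * C * r ^ 2) * r ≠ 0)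
    (hmin : IsLocalMin (fun s => U s - (A + B * s ^ 2 + C * (s ^ 2) ^ 2)) r) :
    |(2 * B + 4 * C * r ^ 2) * r| ^ α *
      pucciRadial N l L (2 * B + 4 * C * r ^ 2) (2 * B + 12 * C * r ^ 2) +
        μ * (U r ^ (1 + α) / r ^ γ) ≤ 0 := by
  have hnorm : ‖r • e‖ = r := by rw [norm_smul, he, mul_one, Real.norm_of_nonneg hr.1.le]
  have hx : r • e ∈ puncturedBall N := by rwa [mem_puncturedBall_iff, hnorm]
  have hgrad := gradient_quartic A B C (r • e)
  have hmin' : IsLocalMin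
      (fun x => u x - (A + B * ‖x‖ ^ 2 + C * (‖x‖ ^ 2) ^ 2)) (r • e) := by
    have h1 : ContinuousAt (fun x : Euc N => ‖x‖) (r • e) := continuous_norm.continuousAt
    rw [ContinuousAt, hnorm] at h1
    have h2 := h1.eventually hmin
    filter_upwards [h2, (isOpen_puncturedBall N).mem_nhds hx] with x hx1 hx2
    rw [hU x hx2, hU _ hx, hnorm]
    exact hx1
  have hcd : ContDiffOn ℝ 2 (fun x : Euc N => A + B * ‖x‖ ^ 2 + C * (‖x‖ ^ 2) ^ 2)
      (puncturedBall N) := by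
    have : ContDiff ℝ 2 (fun x : Euc N => ‖x‖ ^ 2) := contDiff_norm_sq ℝ
    exact ((contDiff_const.add (contDiff_const.mul this)).add
      (contDiff_const.mul (this.pow 2))).contDiffOn
  rw [hnorm, smul_smul] at hgrad
  have h3 := (hu _ hx).2 _ hcd hmin' (by
    rw [hgrad]
    refine smul_ne_zero hne fun h => ?_
    simp [h] at he)
  have hee : e.ofLp ⬝ᵥ e.ofLp = 1 := by
    have := real_inner_self_eq_norm_sq e
    rw [he, EuclideanSpace.inner_eq_star_dotProduct] at this
    simpa using this
  have hess : hessianMatrix (fun x : Euc N => A + B * ‖x‖ ^ 2 + C * (‖x‖ ^ 2) ^ 2) (r • e) =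
      (2 * B + 4 * C * r ^ 2) • (1 - Matrix.vecMulVec e.ofLp e.ofLp) +
        (2 * B + 12 * C * r ^ 2) • Matrix.vecMulVec e.ofLp e.ofLp := by
    rw [hessianMatrix_quartic, hnorm, WithLp.ofLp_smul, Matrix.smul_vecMulVec,
      Matrix.vecMulVec_smul]
    module
  rw [hgrad, norm_smul, he, mul_one, Real.norm_eq_abs, hess, pucciSup_radial hlL hee, hU _ hx,
    hnorm] at h3
  exact h3

theorem continuous_pucciRadial (N : ℕ) (l L a : ℝ) : Continuous (pucciRadial N l L a) := by
  unfold pucciRadial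
  fun_prop

/-- A function g touching U from below is replaced by a quartic with the same first derivative at r
and second derivative lowered by ε. The quartic still touches from below, and ε → 0 recovers the
inequality for g. -/
theorem radial_test (hlL : l ≤ L)
    (hu : IsViscositySupersolution α γ (pucciSup l L) μ u)
    (hU : ∀ x ∈ puncturedBall N, u x = U ‖x‖) {e : Euc N} (he : ‖e‖ = 1)
    {r : ℝ} (hr : r ∈ Ioo (0 : ℝ) 1) {g g1 : ℝ → ℝ} {g2 : ℝ}
    (hg : ∀ᶠ s in 𝓝 r, HasDerivAt g (g1 s) s) (hg1 : HasDerivAt g1 g2 r) (hne : g1 r ≠ 0)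
    (hmin : IsLocalMin (fun s => U s - g s) r) :
    |g1 r| ^ α * pucciRadial N l L (g1 r / r) g2 + μ * (U r ^ (1 + α) / r ^ γ) ≤ 0 := by
  have hr0 := hr.1.ne'
  have key : ∀ ε > 0, |g1 r| ^ α * pucciRadial N l L (g1 r / r) (g2 - ε) +
      μ * (U r ^ (1 + α) / r ^ γ) ≤ 0 := fun ε hε => by
    -- B and C solve the two linear equations that match the slope g1 r and the second derivative g2
    -- - ε.
    set C := (g2 - ε - g1 r / r) / (8 * r ^ 2) with hC
    set B := g1 r / (2 * r) - 2 * C * r ^ 2 with hB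
    have e1 : 2 * B + 4 * C * r ^ 2 = g1 r / r := by rw [hB]; field_simp; ring
    have e2 : 2 * B + 12 * C * r ^ 2 = g2 - ε := by rw [hB, hC]; field_simp; ring
    have e3 : (2 * B + 4 * C * r ^ 2) * r = g1 r := by rw [e1]; field_simp
    have hq : ∀ s, HasDerivAt (fun s : ℝ => 0 + B * s ^ 2 + C * (s ^ 2) ^ 2)
        (2 * B * s + 4 * C * s ^ 3) s := fun s => by
      have h1 := hasDerivAt_pow 2 s
      refine (((h1.const_mul B).const_add 0).add ((h1.pow 2).const_mul C)).congr_deriv ?_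
      simp
      ring
    have hq1 : HasDerivAt (fun s => 2 * B * s + 4 * C * s ^ 3) (2 * B + 12 * C * r ^ 2) r := by
      refine (((hasDerivAt_id r).const_mul (2 * B)).add
        ((hasDerivAt_pow 3 r).const_mul (4 * C))).congr_deriv ?_
      simp
      ring
    have hd : deriv (fun s => g s - (0 + B * s ^ 2 + C * (s ^ 2) ^ 2)) =ᶠ[𝓝 r]
        fun s => g1 s - (2 * B * s + 4 * C * s ^ 3) := by
      filter_upwards [hg] with s hs using (hs.sub (hq s)).deriv
    have hloc : IsLocalMin (fun s => g s - (0 + B * s ^ 2 + C * (s ^ 2) ^ 2)) r := by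
      refine isLocalMin_of_deriv_deriv_pos ?_ ?_ ?_
      · rw [hd.deriv_eq, (hg1.fun_sub hq1).deriv, e2]
        linarith
      · rw [hd.eq_of_nhds]
        linear_combination -e3
      · exact (hg.self_of_nhds.sub (hq r)).continuousAt
    have hmin' : IsLocalMin (fun s => U s - (0 + B * s ^ 2 + C * (s ^ 2) ^ 2)) r := by
      have := hmin.add hloc
      simpa using this
    have := quartic_test hlL hu hU he hr (by rwa [e3]) hmin'
    rwa [e3, e1, e2] at this
  have hlim : Tendsto (fun ε : ℝ => |g1 r| ^ α * pucciRadial N l L (g1 r / r) (g2 - ε) +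
      μ * (U r ^ (1 + α) / r ^ γ)) (𝓝[>] 0) (𝓝 (|g1 r| ^ α * pucciRadial N l L (g1 r / r) (g2 - 0) +
      μ * (U r ^ (1 + α) / r ^ γ))) := by
    refine tendsto_nhdsWithin_of_tendsto_nhds (Continuous.tendsto ?_ 0)
    have := continuous_pucciRadial N l L (g1 r / r)
    fun_prop
  rw [sub_zero] at hlim
  exact le_of_tendsto hlim (by filter_upwards [self_mem_nhdsWithin] with ε hε using key ε hε)

end RadialTest

/-- The properties of the profile `U` of a radial positive viscosity supersolution that are used
to bound the eigenvalue from above. -/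
structure IsRadialSupersolution (N : ℕ) (l L α γ μ : ℝ) (U : ℝ → ℝ) : Prop where
  continuousOn : ContinuousOn U (Ioo 0 1)
  pos : ∀ r ∈ Ioo (0 : ℝ) 1, 0 < U r
  not_const : ∀ r s : ℝ, 0 < r → r < s → s < 1 → ¬ ∀ t ∈ Icc r s, U t = U r
  test : ∀ r ∈ Ioo (0 : ℝ) 1, ∀ (g g1 : ℝ → ℝ) (g2 : ℝ), (∀ᶠ s in 𝓝 r, HasDerivAt g (g1 s) s) →
    HasDerivAt g1 g2 r → g1 r ≠ 0 → IsLocalMin (fun s => U s - g s) r →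
      |g1 r| ^ α * pucciRadial N l L (g1 r / r) g2 + μ * (U r ^ (1 + α) / r ^ γ) ≤ 0

theorem IsViscositySupersolution.exists_radial {N : ℕ} {l L α γ μ : ℝ} (hN : 1 ≤ N)
    (hlL : l ≤ L) (hμ : 0 < μ) {u : Euc N → ℝ}
    (hu : IsViscositySupersolution α γ (pucciSup l L) μ u) (hc : ContinuousOn u (puncturedBall N))
    (hpos : ∀ x ∈ puncturedBall N, 0 < u x)
    (hrad : ∀ x ∈ puncturedBall N, ∀ y ∈ puncturedBall N, ‖x‖ = ‖y‖ → u x = u y) :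
    ∃ U, IsRadialSupersolution N l L α γ μ U := by
  have : Nonempty (Fin N) := ⟨⟨0, hN⟩⟩
  set e : Euc N := EuclideanSpace.single ⟨0, hN⟩ 1 with he'
  have he : ‖e‖ = 1 := by simp [he']
  have hnorm : ∀ r : ℝ, 0 < r → ‖r • e‖ = r := fun r hr => by
    rw [norm_smul, he, mul_one, Real.norm_of_nonneg hr.le]
  have hmem : ∀ r ∈ Ioo (0 : ℝ) 1, r • e ∈ puncturedBall N := fun r hr => by
    rwa [mem_puncturedBall_iff, hnorm r hr.1]
  have hU : ∀ x ∈ puncturedBall N, u x = u (‖x‖ • e) := fun x hx => by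
    have h := mem_puncturedBall_iff.1 hx
    exact hrad x hx _ (hmem _ h) (hnorm _ h.1).symm
  refine ⟨fun r => u (r • e), ?_, fun r hr => hpos _ (hmem r hr), ?_, ?_⟩
  · exact hc.comp (by fun_prop) hmem
  · intro r s hr hrs hs hconst
    -- A ball of radius (s-r)/2 about a point of norm (r+s)/2 lies in the shell r ≤ |x| ≤ s. If U
    -- were constant on [r,s], the constancy clause on this ball would contradict μ > 0.
    set m := (r + s) / 2 with hm
    set δ := (s - r) / 2 with hδ
    have hm0 : m ∈ Ioo (0 : ℝ) 1 := ⟨by linarith, by linarith⟩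
    have hin : ∀ x ∈ Metric.ball (m • e) δ, ‖x‖ ∈ Icc r s := fun x hx => by
      rw [Metric.mem_ball, dist_eq_norm] at hx
      have h1 := abs_norm_sub_norm_le x (m • e)
      rw [hnorm m hm0.1] at h1
      have := abs_le.1 (h1.trans hx.le)
      exact ⟨by linarith [this.1], by linarith [this.2]⟩
    have hball : Metric.ball (m • e) δ ⊆ puncturedBall N := fun x hx => by
      have := hin x hx
      exact mem_puncturedBall_iff.2 ⟨hr.trans_le this.1, this.2.trans_lt hs⟩
    have hδ0 : 0 < δ := by linarith
    have h2 := (hu _ (hmem m hm0)).1 δ hδ0 hball (fun x hx => by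
      rw [hU x (hball hx), hconst _ (hin x hx), hconst m ⟨by linarith, by linarith⟩])
      _ (Metric.mem_ball_self hδ0)
    have h3 := hpos _ (hmem m hm0)
    rw [hnorm m hm0.1] at h2
    have h4 : 0 < μ * (u (m • e) ^ (1 + α) / m ^ γ) :=
      mul_pos hμ (div_pos (Real.rpow_pos_of_pos h3 _) (Real.rpow_pos_of_pos hm0.1 _))
    linarith
  · intro r hr g g1 g2 hg hg1 hne hmin
    exact radial_test (U := fun r => u (r • e)) hlL hu hU he hr hg hg1 hne hmin

/-! ### Barriers and the upper bound for the eigenvalue -/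

theorem hasDerivAt_const_mul_rpow (B e : ℝ) {r : ℝ} (hr : 0 < r) :
    HasDerivAt (fun s : ℝ => B * s ^ e) (B * e * r ^ (e - 1)) r := by
  refine ((Real.hasDerivAt_rpow_const (p := e) (Or.inl hr.ne')).const_mul B).congr_deriv ?_
  ring

theorem HasDerivAt.nonneg_of_forall_gt_le {f : ℝ → ℝ} {f' x c : ℝ} (hf : HasDerivAt f f' x)
    (hc : x < c) (h : ∀ y ∈ Ioo x c, f x ≤ f y) : 0 ≤ f' := by
  refine ge_of_tendsto ((hasDerivWithinAt_iff_tendsto_slope' self_notMem_Ioi).1 hf.hasDerivWithinAt) ?_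
  filter_upwards [Ioo_mem_nhdsGT hc] with y hy
  rw [slope_def_field]
  exact div_nonneg (sub_nonneg.2 (h y hy)) (sub_nonneg.2 hy.1.le)

namespace IsRadialSupersolution

variable {N : ℕ} {l L α γ μ d : ℝ} {U : ℝ → ℝ}

theorem potential_pos (hU : IsRadialSupersolution N l L α γ μ U) (hμ : 0 < μ) {r : ℝ}
    (hr : r ∈ Ioo (0 : ℝ) 1) : 0 < μ * (U r ^ (1 + α) / r ^ γ) :=
  mul_pos hμ (div_pos (Real.rpow_pos_of_pos (hU.pos r hr) _) (Real.rpow_pos_of_pos hr.1 _))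

/-- An interior minimum of U - g would make g an admissible test function violating the strict
inequality. The potential in that inequality is evaluated on U, not on g. -/
theorem comparison (hU : IsRadialSupersolution N l L α γ μ U) {a b : ℝ} (ha : 0 < a) (hab : a < b)
    (hb : b < 1) {g g1 g2 : ℝ → ℝ} (hgc : ContinuousOn g (Icc a b))
    (hg : ∀ r ∈ Ioo a b, HasDerivAt g (g1 r) r) (hg1 : ∀ r ∈ Ioo a b, HasDerivAt g1 (g2 r) r)
    (hne : ∀ r ∈ Ioo a b, g1 r ≠ 0)
    (hst : ∀ r ∈ Ioo a b, 0 < |g1 r| ^ α * pucciRadial N l L (g1 r / r) (g2 r) +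
      μ * (U r ^ (1 + α) / r ^ γ)) {r : ℝ} (hr : r ∈ Icc a b) :
    min (U a - g a) (U b - g b) ≤ U r - g r := by
  have hUc : ContinuousOn U (Icc a b) :=
    hU.continuousOn.mono fun s hs => ⟨ha.trans_le hs.1, hs.2.trans_lt hb⟩
  obtain ⟨m, hm, hmin⟩ := isCompact_Icc.exists_isMinOn ⟨a, le_rfl, hab.le⟩ (hUc.sub hgc)
  refine le_trans ?_ (hmin hr)
  rcases hm.1.eq_or_lt with h1 | h1
  · rw [← h1]; exact min_le_left _ _
  rcases hm.2.eq_or_lt with h2 | h2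
  · rw [h2]; exact min_le_right _ _
  exfalso
  have hmI : m ∈ Ioo a b := ⟨h1, h2⟩
  have hev : ∀ᶠ s in 𝓝 m, HasDerivAt g (g1 s) s := by
    filter_upwards [isOpen_Ioo.mem_nhds hmI] with s hs using hg s hs
  have := hU.test m ⟨ha.trans h1, h2.trans hb⟩ g g1 (g2 m) hev (hg1 m hmI) (hne m hmI)
    (hmin.isLocalMin (Icc_mem_nhds h1 h2))
  linarith [hst m hmI]

/-- For N ≥ 3 the increasing function -B/t has nonnegative Pucci operator, since the tangential
terms outweigh the radial one. It tends to -∞ at 0, so positivity of U is all that is needed there.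
-/
theorem le_of_lt (hU : IsRadialSupersolution N l L α γ μ U) (hμ : 0 < μ) (hl : 0 < l)
    (hN : 3 ≤ N) {r s : ℝ} (hr : 0 < r) (hrs : r < s) (hs : s < 1) : U s ≤ U r := by
  by_contra! hlt
  have hN' : (3 : ℝ) ≤ N := by exact_mod_cast hN
  have hinv : s⁻¹ < r⁻¹ := inv_strictAnti₀ hr hrs
  -- With half the critical constant, U + B/t is strictly smaller at r than at s. Taking ε small
  -- makes it larger at ε than at r as well, contradicting comparison on [ε,s].
  set B := (U s - U r) / (2 * (r⁻¹ - s⁻¹)) with hB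
  have hB0 : 0 < B := div_pos (by linarith) (by linarith)
  have hBeq : B * (r⁻¹ - s⁻¹) = (U s - U r) / 2 := by
    have : r⁻¹ - s⁻¹ ≠ 0 := by linarith
    rw [hB, div_mul_eq_mul_div, div_eq_div_iff (by positivity) two_ne_zero]
    ring
  have hUr : 0 < U r := hU.pos r ⟨hr, hrs.trans hs⟩
  set ε := min (r / 2) (B / (U r + B * r⁻¹ + 1)) with hε
  have hden : 0 < U r + B * r⁻¹ + 1 := by positivity
  have hε0 : 0 < ε := lt_min (by positivity) (by positivity)
  have hεr : ε < r := (min_le_left _ _).trans_lt (by linarith)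
  have hεB : U r + B * r⁻¹ + 1 ≤ B * ε⁻¹ := by
    rw [← div_eq_mul_inv B ε, le_div_iff₀ hε0, mul_comm, ← le_div_iff₀ hden]
    exact min_le_right _ _
  have hpow : ∀ t : ℝ, t ^ (-1 : ℝ) = t⁻¹ := Real.rpow_neg_one
  have hcmp := hU.comparison (a := ε) (b := s) hε0 (hεr.trans hrs) hs
    (g := fun t => -B * t ^ (-1 : ℝ)) (g1 := fun t => -B * -1 * t ^ (-1 - 1 : ℝ))
    (g2 := fun t => -B * -1 * (-1 - 1) * t ^ (-1 - 1 - 1 : ℝ))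
    (fun t ht => (hasDerivAt_const_mul_rpow _ _ (hε0.trans_le ht.1)).continuousAt.continuousWithinAt)
    (fun t ht => hasDerivAt_const_mul_rpow _ _ (hε0.trans ht.1))
    (fun t ht => hasDerivAt_const_mul_rpow _ _ (hε0.trans ht.1))
    (fun t ht => by
      have := Real.rpow_pos_of_pos (hε0.trans ht.1) (-1 - 1 : ℝ)
      have : 0 < -B * -1 * t ^ (-1 - 1 : ℝ) := by nlinarith
      exact this.ne')
    (fun t ht => by
      have ht0 := hε0.trans ht.1
      have hp := hU.potential_pos hμ ⟨ht0, ht.2.trans hs⟩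
      have h1 : 0 < t ^ (-1 - 1 - 1 : ℝ) := Real.rpow_pos_of_pos ht0 _
      have h2 : -B * -1 * t ^ (-1 - 1 : ℝ) / t = B * t ^ (-1 - 1 - 1 : ℝ) := by
        rw [Real.rpow_sub_one ht0.ne' (-1 - 1)]
        ring
      have h3 : 0 ≤ pucciRadial N l L (-B * -1 * t ^ (-1 - 1 : ℝ) / t)
          (-B * -1 * (-1 - 1) * t ^ (-1 - 1 - 1 : ℝ)) := by
        rw [h2, pucciRadial]
        have h4 := le_max_right (L * (-B * -1 * (-1 - 1) * t ^ (-1 - 1 - 1 : ℝ)))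
          (l * (-B * -1 * (-1 - 1) * t ^ (-1 - 1 - 1 : ℝ)))
        have h5 := le_max_right (L * (B * t ^ (-1 - 1 - 1 : ℝ))) (l * (B * t ^ (-1 - 1 - 1 : ℝ)))
        have h6 : 0 < l * (B * t ^ (-1 - 1 - 1 : ℝ)) := by positivity
        have h7 := mul_le_mul (show (2 : ℝ) ≤ N - 1 by linarith) h5 h6.le (by linarith)
        linarith
      have h4 := mul_nonneg (Real.rpow_nonneg (abs_nonneg (-B * -1 * t ^ (-1 - 1 : ℝ))) α) h3
      linarith)
    (r := r) ⟨hεr.le, hrs.le⟩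
  simp only [hpow] at hcmp
  have hUε : 0 < U ε := hU.pos ε ⟨hε0, (hεr.trans hrs).trans hs⟩
  rcases min_le_iff.1 hcmp with h | h
  · linarith
  · linarith

theorem lt_of_lt (hU : IsRadialSupersolution N l L α γ μ U) (hμ : 0 < μ) (hl : 0 < l)
    (hN : 3 ≤ N) {r s : ℝ} (hr : 0 < r) (hrs : r < s) (hs : s < 1) : U s < U r := by
  refine lt_of_le_of_ne (hU.le_of_lt hμ hl hN hr hrs hs) fun heq => ?_
  refine hU.not_const r s hr hrs hs fun t ht => ?_
  have h1 : U t ≤ U r := by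
    rcases ht.1.eq_or_lt with h | h
    · rw [h]
    · exact hU.le_of_lt hμ hl hN hr h (ht.2.trans_lt hs)
  have h2 : U s ≤ U t := by
    rcases ht.2.eq_or_lt with h | h
    · rw [h]
    · exact hU.le_of_lt hμ hl hN (hr.trans_le ht.1) h hs
  linarith

/-- A Hopf-type estimate: t^(2-d) is annihilated by L g'' + (N-1) l g'/t. A small multiple of it
lies below the strict drop of U from r/2 to r, so comparison on [r/2,s] must be decided at s. The
constant B does not depend on s. -/
theorem exists_slope (hU : IsRadialSupersolution N l L α γ μ U) (hμ : 0 < μ) (hl : 0 < l)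
    (hN : 3 ≤ N) (hd : 2 < d) (hdN : l * ((N : ℝ) - 1) = L * (d - 1)) {r : ℝ}
    (hr : r ∈ Ioo (0 : ℝ) 1) :
    ∃ B > 0, ∀ s ∈ Ioo r 1, U s ≤ U r - B * (r ^ (2 - d) - s ^ (2 - d)) := by
  have hr0 := hr.1
  set q := r / 2 with hq
  have hq0 : 0 < q := by positivity
  have hqr : q < r := by linarith
  have hτ : r ^ (2 - d) < q ^ (2 - d) := Real.rpow_lt_rpow_of_neg hq0 hqr (by linarith)
  have hUq := hU.lt_of_lt hμ hl hN hq0 hqr hr.2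
  set B := (U q - U r) / (2 * (q ^ (2 - d) - r ^ (2 - d))) with hB
  have hB0 : 0 < B := div_pos (by linarith) (by linarith)
  have hBeq : B * (q ^ (2 - d) - r ^ (2 - d)) = (U q - U r) / 2 := by
    have : q ^ (2 - d) - r ^ (2 - d) ≠ 0 := by linarith
    rw [hB]
    field_simp
  refine ⟨B, hB0, fun s hs => ?_⟩
  have hcmp := hU.comparison (a := q) (b := s) hq0 (hqr.trans hs.1) hs.2
    (g := fun t => B * t ^ (2 - d)) (g1 := fun t => B * (2 - d) * t ^ (2 - d - 1))
    (g2 := fun t => B * (2 - d) * (2 - d - 1) * t ^ (2 - d - 1 - 1))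
    (fun t ht => (hasDerivAt_const_mul_rpow _ _ (hq0.trans_le ht.1)).continuousAt.continuousWithinAt)
    (fun t ht => hasDerivAt_const_mul_rpow _ _ (hq0.trans ht.1))
    (fun t ht => hasDerivAt_const_mul_rpow _ _ (hq0.trans ht.1))
    (fun t ht => by
      have := Real.rpow_pos_of_pos (hq0.trans ht.1) (2 - d - 1)
      have h2 : B * (2 - d) ≠ 0 := mul_ne_zero hB0.ne' (by linarith)
      exact mul_ne_zero h2 this.ne')
    (fun t ht => by
      have ht0 := hq0.trans ht.1
      have hp := hU.potential_pos hμ ⟨ht0, ht.2.trans hs.2⟩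
      have h2 : B * (2 - d) * t ^ (2 - d - 1) / t = B * (2 - d) * t ^ (2 - d - 1 - 1) := by
        rw [Real.rpow_sub_one ht0.ne' (2 - d - 1)]
        ring
      have h3 : 0 ≤ pucciRadial N l L (B * (2 - d) * t ^ (2 - d - 1) / t)
          (B * (2 - d) * (2 - d - 1) * t ^ (2 - d - 1 - 1)) := by
        rw [h2]
        refine le_trans (le_of_eq ?_) (pucciRadial_ge (by omega) _)
        linear_combination (-(B * (2 - d) * t ^ (2 - d - 1 - 1))) * hdN
      have h4 := mul_nonneg (Real.rpow_nonneg (abs_nonneg (B * (2 - d) * t ^ (2 - d - 1))) α) h3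
      linarith)
    (r := r) ⟨hqr.le, hs.1.le⟩
  rcases min_le_iff.1 hcmp with h | h
  · linarith
  · linarith

end IsRadialSupersolution

/-- The bracket x' + w x/s is s^(-w)(s^w x)', so the operator is in divergence form. The factor
L/(1+α) that relates the two eigenvalues appears here. -/
theorem flux_operator_eq {N : ℕ} {l L α d x : ℝ} (hα : -1 < α)
    (hdN : l * ((N : ℝ) - 1) = L * (d - 1)) (hx : 0 < x) (x' s : ℝ) :
    |-x ^ (1 / (1 + α))| ^ α * (L * -(1 / (1 + α) * x ^ (1 / (1 + α) - 1) * x') +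
      ((N : ℝ) - 1) * (l * (-x ^ (1 / (1 + α)) / s))) =
        -(L / (1 + α) * (x' + weightExp α d * x / s)) := by
  have h1 : 0 < 1 + α := by linarith
  have e1 := abs_neg_rpow_inv_rpow_mul_self hα hx
  have e2 := abs_neg_rpow_inv_rpow_mul_deriv hα hx x'
  have e3 : weightExp α d / (1 + α) = d - 1 := by unfold weightExp; field_simp
  linear_combination L * e2 + l * ((N : ℝ) - 1) / s * e1 - x / s * hdN + L * x / s * e3

namespace IsRadialSupersolution

variable {N : ℕ} {l L α γ μ d : ℝ} {U : ℝ → ℝ}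

/-- Replace U by mφ in the source and solve the equation with a slightly smaller constant than μ
allows: the solution b is a strict subsolution for the potential of U. Comparison gives U ≥ b, and b
exceeds c^(1/(1+α)) m (φ(r) - φ(ρ)). Then ρ → R. -/
theorem improve_lower_bound (hU : IsRadialSupersolution N l L α γ μ U) (hμ : 0 < μ) (hl : 0 < l)
    (hN : 3 ≤ N) (hα : -1 < α) (hd : 2 < d) (hdN : l * ((N : ℝ) - 1) = L * (d - 1))
    {R ν : ℝ} {φ Φ : ℝ → ℝ} (hφ : IsProfile α γ d R ν φ Φ) (hR : R < 1) {m c c' : ℝ} (hm : 0 < m)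
    (hc : 0 < c) (hcc : c < c') (hcν : L / (1 + α) * (c' * ν) < μ)
    (hle : ∀ r ∈ Ioo 0 R, m * φ r ≤ U r) {r : ℝ} (hr : r ∈ Ioo 0 R) :
    c ^ (1 / (1 + α)) * m * φ r ≤ U r := by
  have h1 : 0 < 1 + α := by linarith
  set e := 1 / (1 + α) with he
  have he0 : 0 < e := by positivity
  have hc'0 : 0 < c' := hc.trans hcc
  set w := weightExp α d with hw
  have hr0 := hr.1
  have hfin : ∀ ρ ∈ Ioo r R, c ^ e * m * (φ r - φ ρ) ≤ U r := by
    intro ρ hρ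
    have hΦr := hφ.flux_pos hr
    -- The barrier will start at ε instead of 0, since nothing is known about U at 0. The gap
    -- between c and c' pays for the flux Φ(ε) that is lost.
    obtain ⟨ε, hε, hεΦ⟩ : ∃ ε ∈ Ioo 0 r, Φ ε ≤ (1 - c / c') * Φ r := by
      have h2 : 0 < (1 - c / c') * Φ r :=
        mul_pos (by rw [sub_pos, div_lt_one hc'0]; exact hcc) hΦr
      have h3 : Tendsto Φ (𝓝[Ico 0 R] 0) (𝓝 (Φ 0)) :=
        hφ.flux_continuousOn 0 ⟨le_rfl, hφ.radius_pos⟩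
      rw [hφ.flux_zero] at h3
      have h4 : 𝓝[>] (0 : ℝ) ≤ 𝓝[Ico 0 R] 0 := by
        rw [← nhdsWithin_Ioo_eq_nhdsGT hφ.radius_pos]
        exact nhdsWithin_mono _ Ioo_subset_Ico_self
      obtain ⟨ε, hε1, hε2⟩ := (((h3.mono_left h4).eventually (gt_mem_nhds h2)).and
        (Ioo_mem_nhdsGT hr0)).exists
      exact ⟨ε, hε2, hε1.le⟩
    have hερ : ε < ρ := hε.2.trans hρ.1
    have hεR : ε ∈ Ioo 0 R := ⟨hε.1, hερ.trans hρ.2⟩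
    set K := c' * m ^ (1 + α) with hK
    have hK0 : 0 < K := by positivity
    -- This is |b'|^(1+α) for the barrier: subtracting Φ(ε) makes b' vanish at ε without changing
    -- the derivative of the flux.
    set X : ℝ → ℝ := fun s => K * (s ^ (-w) * Φ s - Φ ε * s ^ (-w)) with hX
    have hXeq : ∀ s, X s = K * s ^ (-w) * (Φ s - Φ ε) := fun s => by simp only [hX]; ring
    have hXder : ∀ s ∈ Ioo 0 R, HasDerivAt X (K * ((ν * (φ s ^ (1 + α) / s ^ γ) -
        w * (s ^ (-w) * Φ s) / s) - Φ ε * (-w) * s ^ (-w - 1))) s := fun s hs =>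
      ((hφ.hasDerivAt_slope hs).sub (hasDerivAt_const_mul_rpow _ _ hs.1)).const_mul K
    have hXpos : ∀ s ∈ Ioo ε R, 0 < X s := fun s hs => by
      rw [hXeq]
      have := hφ.flux_strictMonoOn ⟨hε.1.le, hεR.2⟩ ⟨(hε.1.trans hs.1).le, hs.2⟩ hs.1
      exact mul_pos (mul_pos hK0 (Real.rpow_pos_of_pos (hε.1.trans hs.1) _)) (sub_pos.2 this)
    set b1 : ℝ → ℝ := fun s => -(X s) ^ e with hb1
    have hb1c : ContinuousOn b1 (Ioo 0 R) := fun s hs =>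
      (((hXder s hs).continuousAt.rpow_const (Or.inr he0.le)).neg).continuousWithinAt
    have hρR : ρ ∈ Ioo 0 R := ⟨hr0.trans hρ.1, hρ.2⟩
    set b : ℝ → ℝ := fun t => ∫ s in ρ..t, b1 s with hb
    have hbder : ∀ t ∈ Ioo 0 R, HasDerivAt b (b1 t) t := fun t ht => by
      refine intervalIntegral.integral_hasDerivAt_right ?_
        (hb1c.stronglyMeasurableAtFilter isOpen_Ioo t ht) (hb1c.continuousAt (isOpen_Ioo.mem_nhds ht))
      exact (hb1c.mono (ordConnected_Ioo.uIcc_subset hρR ht)).intervalIntegrable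
    have hbρ : b ρ = 0 := intervalIntegral.integral_same
    have hsub : ∀ t ∈ Icc ε ρ, t ∈ Ioo 0 R := fun t ht =>
      ⟨hε.1.trans_le ht.1, ht.2.trans_lt hρ.2⟩
    have hcmp : ∀ t ∈ Icc ε ρ, min (U ε - b ε) (U ρ - b ρ) ≤ U t - b t := by
      intro t ht
      refine hU.comparison hε.1 hερ (hρ.2.trans hR)
        (fun t ht => (hbder t (hsub t ht)).continuousAt.continuousWithinAt)
        (fun t ht => hbder t (hsub t (Ioo_subset_Icc_self ht)))
        (fun t ht => hasDerivAt_neg_rpow_inv (α := α) (hXder t (hsub t (Ioo_subset_Icc_self ht)))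
          (hXpos t ⟨ht.1, ht.2.trans hρ.2⟩))
        (fun t ht => neg_ne_zero.2 (Real.rpow_pos_of_pos (hXpos t ⟨ht.1, ht.2.trans hρ.2⟩) _).ne')
        (fun s hs => ?_) ht
      have hsR := hsub s (Ioo_subset_Icc_self hs)
      have hs0 := hsR.1
      have hXs := hXpos s ⟨hs.1, hs.2.trans hρ.2⟩
      have hφs := hφ.pos s ⟨hs0.le, hsR.2⟩
      set X' := K * ((ν * (φ s ^ (1 + α) / s ^ γ) -
        w * (s ^ (-w) * Φ s) / s) - Φ ε * (-w) * s ^ (-w - 1)) with hX'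
      have e3 : X' + w * X s / s = K * (ν * (φ s ^ (1 + α) / s ^ γ)) := by
        rw [hX', hXeq, Real.rpow_sub_one hs0.ne']
        ring
      have h2 := mul_le_mul_of_nonneg_left (pucciRadial_ge (l := l) (L := L) (a := b1 s / s)
        (show 1 ≤ N by omega) (-(e * X s ^ (e - 1) * X')))
        (Real.rpow_nonneg (abs_nonneg (b1 s)) α)
      have h3 : |b1 s| ^ α * (L * -(e * X s ^ (e - 1) * X') + (↑N - 1) * (l * (b1 s / s))) =
          -(L / (1 + α) * (K * (ν * (φ s ^ (1 + α) / s ^ γ)))) := by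
        rw [← e3]
        exact flux_operator_eq hα hdN hXs X' s
      have h4 : (m * φ s) ^ (1 + α) ≤ U s ^ (1 + α) :=
        Real.rpow_le_rpow (by positivity) (hle s hsR) h1.le
      rw [Real.mul_rpow hm.le hφs.le] at h4
      have h5 : 0 < m ^ (1 + α) * (φ s ^ (1 + α) / s ^ γ) := by positivity
      have h6 : m ^ (1 + α) * (φ s ^ (1 + α) / s ^ γ) ≤ U s ^ (1 + α) / s ^ γ := by
        rw [← mul_div_assoc]
        gcongr
      have h7 := mul_lt_mul_of_pos_right hcν h5
      have h8 := mul_le_mul_of_nonneg_left h6 hμ.le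
      have h9 : L / (1 + α) * (c' * ν) * (m ^ (1 + α) * (φ s ^ (1 + α) / s ^ γ)) =
        L / (1 + α) * (K * (ν * (φ s ^ (1 + α) / s ^ γ))) := by rw [hK]; ring
      linarith
    -- The minimum of U - b cannot occur only at ε: b has zero slope there, while U has a definite
    -- downward slope by `exists_slope`. This replaces a boundary condition at the inner end.
    have hend : U ρ - b ρ ≤ U ε - b ε := by
      by_contra! hlt
      obtain ⟨B, hB0, hB⟩ := hU.exists_slope hμ hl hN hd hdN ⟨hε.1, hεR.2.trans hR⟩
      have hder : HasDerivAt (fun t => B * t ^ (2 - d) - b t)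
          (B * (2 - d) * ε ^ (2 - d - 1) - b1 ε) ε :=
        (hasDerivAt_const_mul_rpow _ _ hε.1).sub (hbder ε hεR)
      have h2 := hder.nonneg_of_forall_gt_le hερ fun t ht => by
        have h3 := hcmp t ⟨ht.1.le, ht.2.le⟩
        rw [min_eq_left hlt.le] at h3
        have h4 := hB t ⟨ht.1, ht.2.trans (hρ.2.trans hR)⟩
        linarith
      have h3 : b1 ε = 0 := by
        simp only [hb1, hXeq, sub_self, mul_zero, Real.zero_rpow he0.ne', neg_zero]
      rw [h3, sub_zero] at h2
      have h4 : 0 < ε ^ (2 - d - 1) := Real.rpow_pos_of_pos hε.1 _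
      have h5 : 0 < B * (d - 2) * ε ^ (2 - d - 1) := by
        have : 0 < d - 2 := by linarith
        positivity
      linarith
    have hUr := hcmp r ⟨hε.2.le, hρ.1.le⟩
    rw [min_eq_right hend, hbρ, sub_zero] at hUr
    have hUρ : 0 < U ρ := hU.pos ρ ⟨hρR.1, hρ.2.trans hR⟩
    -- By the choice of ε, Φ - Φ(ε) ≥ (c/c')Φ on [r,ρ], so b is at least as steep as c^e m φ.
    have hanti : AntitoneOn (fun t => b t - c ^ e * m * φ t) (Icc r ρ) := by
      have hsub' : ∀ t ∈ Icc r ρ, t ∈ Ioo 0 R := fun t ht => hsub t ⟨hε.2.le.trans ht.1, ht.2⟩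
      have hder : ∀ t ∈ Icc r ρ, HasDerivAt (fun t => b t - c ^ e * m * φ t)
          (b1 t - c ^ e * m * -(t ^ (-w) * Φ t) ^ e) t := fun t ht =>
        (hbder t (hsub' t ht)).sub ((hφ.hasDerivAt t (hsub' t ht)).const_mul _)
      refine antitoneOn_of_deriv_nonpos (convex_Icc _ _)
        (fun t ht => (hder t ht).continuousAt.continuousWithinAt) (fun t ht => ?_) (fun t ht => ?_)
      · rw [interior_Icc] at ht
        exact (hder t (Ioo_subset_Icc_self ht)).differentiableAt.differentiableWithinAt
      · rw [interior_Icc] at ht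
        have htI := hsub' t (Ioo_subset_Icc_self ht)
        have ht0 := htI.1
        rw [(hder t (Ioo_subset_Icc_self ht)).deriv]
        have hΦt : Φ r ≤ Φ t :=
          hφ.flux_strictMonoOn.monotoneOn ⟨hr0.le, hr.2⟩ ⟨ht0.le, htI.2⟩ ht.1.le
        have hS := hφ.slope_pos htI
        have hΦtp := hφ.flux_pos htI
        have h2 : c * m ^ (1 + α) * (t ^ (-w) * Φ t) ≤ X t := by
          have h3 : c / c' * Φ t ≤ Φ t - Φ ε := by
            have h4 : 0 ≤ 1 - c / c' := by
              rw [sub_nonneg, div_le_one hc'0]; exact hcc.le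
            have := mul_le_mul_of_nonneg_left hΦt h4
            linarith
          have h4 := mul_le_mul_of_nonneg_left h3
            (mul_pos hK0 (Real.rpow_pos_of_pos ht0 (-w))).le
          rw [hXeq]
          refine le_trans (le_of_eq ?_) h4
          rw [hK]
          field_simp
        have h3 := Real.rpow_le_rpow (by positivity) h2 he0.le
        rw [Real.mul_rpow (by positivity) hS.le, Real.mul_rpow hc.le (by positivity),
          ← Real.rpow_mul hm.le, he, show (1 + α) * (1 / (1 + α)) = 1 by field_simp,
          Real.rpow_one] at h3
        simp only [hb1]
        linarith
    have := hanti ⟨le_rfl, hρ.1.le⟩ ⟨hρ.1.le, le_rfl⟩ hρ.1.le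
    simp only [hbρ] at this
    linarith
  have hlim : Tendsto (fun ρ => c ^ e * m * (φ r - φ ρ)) (𝓝[<] R) (𝓝 (c ^ e * m * (φ r - φ R))) := by
    have h2 : Tendsto φ (𝓝[Icc 0 R] R) (𝓝 (φ R)) :=
      hφ.continuousOn R ⟨hφ.radius_pos.le, le_rfl⟩
    have h3 : 𝓝[<] R ≤ 𝓝[Icc 0 R] R := by
      rw [← nhdsWithin_Ioo_eq_nhdsLT hφ.radius_pos]
      exact nhdsWithin_mono _ Ioo_subset_Icc_self
    exact (tendsto_const_nhds.sub (h2.mono_left h3)).const_mul _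
  rw [hφ.apply_radius, sub_zero] at hlim
  exact le_of_tendsto hlim (by filter_upwards [Ioo_mem_nhdsLT hr.2] with ρ hρ using hfin ρ hρ)

theorem eigenvalue_le (hU : IsRadialSupersolution N l L α γ μ U) (hμ : 0 < μ) (hl : 0 < l)
    (hlL : l ≤ L) (hN : 3 ≤ N) (hα : -1 < α) (hd : 2 < d)
    (hdN : l * ((N : ℝ) - 1) = L * (d - 1)) {ν : ℝ} {φ Φ : ℝ → ℝ}
    (hφ : IsProfile α γ d 1 ν φ Φ) : μ ≤ L / (1 + α) * ν := by
  by_contra! hlt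
  have h1 : 0 < 1 + α := by linarith
  have hL : 0 < L := hl.trans_le hlL
  -- Shrinking to R < 1 gives U the positive lower bound U(R) on (0,R), available for the first step
  -- of the iteration, while the eigenvalue inequality persists by continuity.
  obtain ⟨R, hR0, hR1, hR⟩ : ∃ R > 0, R < 1 ∧ L / (1 + α) * (ν * R ^ (γ - (2 + α))) < μ := by
    have hc : ContinuousAt (fun x : ℝ => L / (1 + α) * (ν * x ^ (γ - (2 + α)))) 1 :=
      ((Real.continuousAt_rpow_const 1 _ (Or.inl one_ne_zero)).const_mul _).const_mul _
    have h2 := hc.tendsto.eventually (gt_mem_nhds (a := μ) (by simpa using hlt))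
    obtain ⟨R, hR, hR'⟩ := ((h2.filter_mono nhdsWithin_le_nhds).and
      (Ioo_mem_nhdsLT (zero_lt_one (α := ℝ)))).exists
    exact ⟨R, hR'.1, hR'.2, hR⟩
  have hφR := hφ.rescale hα hR0
  rw [mul_one] at hφR
  set νR := ν * R ^ (γ - (2 + α)) with hνR
  set ψ : ℝ → ℝ := fun r => φ (r / R) with hψ
  have hνR0 : 0 < L / (1 + α) * νR := mul_pos (by positivity) hφR.eigenvalue_pos
  -- The constants 1 < c = (3+ρ)/4 < c' = (1+ρ)/2 < ρ leave room both for a gain factor k > 1 and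
  -- for strict comparison.
  set ρ := μ / (L / (1 + α) * νR) with hρ
  have hρ1 : 1 < ρ := by rwa [hρ, one_lt_div hνR0]
  have hc' : L / (1 + α) * ((1 + ρ) / 2 * νR) < μ := by
    have : ρ * (L / (1 + α) * νR) = μ := by rw [hρ]; exact div_mul_cancel₀ _ hνR0.ne'
    nlinarith
  set c := (3 + ρ) / 4 with hc
  have hc1 : 1 < c := by rw [hc]; linarith
  have hRmem : R ∈ Ioo (0 : ℝ) 1 := ⟨hR0, hR1⟩
  have hUR := hU.pos R hRmem
  set k := c ^ (1 / (1 + α)) with hk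
  have hk1 : 1 < k := Real.one_lt_rpow hc1 (by positivity)
  have hiter : ∀ n : ℕ, ∀ r ∈ Ioo 0 R, k ^ n * U R * ψ r ≤ U r := by
    intro n
    induction n with
    | zero =>
      intro r hr
      have h2 := hU.le_of_lt hμ hl hN hr.1 hr.2 hR1
      have h3 := hφR.le_one ⟨hr.1.le, hr.2.le⟩
      rw [pow_zero, one_mul]
      nlinarith
    | succ n ih =>
      intro r hr
      have := hU.improve_lower_bound hμ hl hN hα hd hdN hφR hR1
        (m := k ^ n * U R) (c := c) (c' := (1 + ρ) / 2) (by positivity) (by linarith)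
        (by rw [hc]; linarith) hc' ih hr
      rw [pow_succ']
      linarith
  have hmid : R / 2 ∈ Ioo 0 R := ⟨by positivity, by linarith⟩
  have hψ0 : 0 < ψ (R / 2) := hφR.pos _ ⟨hmid.1.le, hmid.2⟩
  obtain ⟨n, hn⟩ := pow_unbounded_of_one_lt (U (R / 2) / (U R * ψ (R / 2))) hk1
  rw [div_lt_iff₀ (by positivity)] at hn
  have := hiter n _ hmid
  linarith

end IsRadialSupersolution

/-! ### The profile is a viscosity supersolution -/

/-- With a negative second derivative, x would also be a local maximum, so h would be constant near
x and the second derivative would be 0. -/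
theorem IsLocalMin.deriv_eq_zero_and_nonneg {h h1 : ℝ → ℝ} {h2 x : ℝ} (hmin : IsLocalMin h x)
    (hh : ∀ᶠ t in 𝓝 x, HasDerivAt h (h1 t) t) (hh1 : HasDerivAt h1 h2 x) :
    h1 x = 0 ∧ 0 ≤ h2 := by
  have h0 : h1 x = 0 := hmin.hasDerivAt_eq_zero hh.self_of_nhds
  refine ⟨h0, ?_⟩
  by_contra! hneg
  have hd : deriv (fun t => -h t) =ᶠ[𝓝 x] fun t => -h1 t := by
    filter_upwards [hh] with t ht using ht.fun_neg.deriv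
  have hmax : IsLocalMin (fun t => -h t) x := by
    refine isLocalMin_of_deriv_deriv_pos ?_ ?_ hh.self_of_nhds.continuousAt.neg
    · rw [hd.deriv_eq, hh1.fun_neg.deriv]
      linarith
    · rw [hd.eq_of_nhds, h0, neg_zero]
  have hconst : h =ᶠ[𝓝 x] fun _ => h x := by
    filter_upwards [hmin, hmax] with t ht1 ht2
    linarith
  have hz : h1 =ᶠ[𝓝 x] fun _ => (0 : ℝ) := by
    filter_upwards [hh, hconst.eventuallyEq_nhds] with t ht ht2
    exact (ht.congr_of_eventuallyEq ht2.symm).unique (hasDerivAt_const t _)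
  have := (hh1.congr_of_eventuallyEq hz.symm).unique (hasDerivAt_const x _)
  linarith

theorem hasDerivAt_norm_line {E : Type*} [NormedAddCommGroup E] [InnerProductSpace ℝ E]
    (x v : E) {t : ℝ} (ht : x + t • v ≠ 0) :
    HasDerivAt (fun t : ℝ => ‖x + t • v‖) (inner ℝ (x + t • v) v / ‖x + t • v‖) t := by
  have h0 : HasDerivAt (fun t : ℝ => x + t • v) v t := by
    simpa using ((hasDerivAt_id t).smul_const v).const_add x
  have h1 := h0.norm_sq.sqrt (pow_ne_zero 2 (norm_ne_zero_iff.2 ht))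
  simp only [Real.sqrt_sq (norm_nonneg _)] at h1
  refine h1.congr_deriv ?_
  field_simp

theorem hasDerivAt_line {E : Type*} [NormedAddCommGroup E] [NormedSpace ℝ E] (x v : E) (t : ℝ) :
    HasDerivAt (fun t : ℝ => x + t • v) v t := by
  simpa using ((hasDerivAt_id t).smul_const v).const_add x

theorem hasDerivAt_radial_line {E : Type*} [NormedAddCommGroup E] [InnerProductSpace ℝ E]
    {f1 : ℝ → ℝ} {f2 : ℝ} {x : E} (hx : x ≠ 0) (hf1 : HasDerivAt f1 f2 ‖x‖) (v : E) :
    HasDerivAt (fun t : ℝ => f1 ‖x + t • v‖ * (inner ℝ (x + t • v) v / ‖x + t • v‖))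
      (f2 * (inner ℝ x v / ‖x‖) ^ 2 +
        f1 ‖x‖ / ‖x‖ * (‖v‖ ^ 2 - (inner ℝ x v / ‖x‖) ^ 2)) 0 := by
  have hr0 : ‖x‖ ≠ 0 := norm_ne_zero_iff.2 hx
  have hx0 : x + (0 : ℝ) • v = x := by simp
  have hn0 : HasDerivAt (fun t : ℝ => ‖x + t • v‖) (inner ℝ x v / ‖x‖) 0 := by
    have := hasDerivAt_norm_line x v (t := 0) (by rwa [hx0])
    rwa [hx0] at this
  have hi0 : HasDerivAt (fun t : ℝ => inner ℝ (x + t • v) v) (‖v‖ ^ 2) 0 := by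
    have := (hasDerivAt_line x v 0).inner ℝ (hasDerivAt_const (0 : ℝ) v)
    simpa using this
  have hf1' : HasDerivAt f1 f2 ‖x + (0 : ℝ) • v‖ := by rwa [hx0]
  have h1 : HasDerivAt (fun t : ℝ => f1 ‖x + t • v‖) (f2 * (inner ℝ x v / ‖x‖)) 0 :=
    hf1'.comp (0 : ℝ) hn0
  refine (h1.mul (hi0.div hn0 (by rwa [hx0]))).congr_deriv ?_
  simp only [Pi.div_apply, hx0]
  field_simp

theorem hasDerivAt_fderiv_line {E : Type*} [NormedAddCommGroup E] [NormedSpace ℝ E]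
    {ψ : E → ℝ} {x : E} (hψ : ContDiffAt ℝ 2 ψ x) (v : E) :
    HasDerivAt (fun t : ℝ => fderiv ℝ ψ (x + t • v) v) (fderiv ℝ (fderiv ℝ ψ) x v v) 0 := by
  have hx0 : x + (0 : ℝ) • v = x := by simp
  have hψ2 : HasFDerivAt (fderiv ℝ ψ) (fderiv ℝ (fderiv ℝ ψ) x) (x + (0 : ℝ) • v) := by
    rw [hx0]
    exact ((hψ.fderiv_right (m := 1) (by norm_num)).differentiableAt (by norm_num)).hasFDerivAt
  have h1 := hψ2.comp_hasDerivAt (0 : ℝ) (hasDerivAt_line x v 0)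
  exact (ContinuousLinearMap.apply ℝ ℝ v).hasFDerivAt.comp_hasDerivAt (0 : ℝ) h1

/-- Second-order information on a test function that touches a radial function from below. -/
theorem radial_touching {E : Type*} [NormedAddCommGroup E] [InnerProductSpace ℝ E]
    {f f1 : ℝ → ℝ} {f2 : ℝ} {ψ : E → ℝ} {x : E} (hx : x ≠ 0)
    (hf : ∀ᶠ s in 𝓝 ‖x‖, HasDerivAt f (f1 s) s) (hf1 : HasDerivAt f1 f2 ‖x‖)
    (hψ : ContDiffAt ℝ 2 ψ x) (hmin : IsLocalMin (fun y => f ‖y‖ - ψ y) x) (v : E) :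
    fderiv ℝ ψ x v = f1 ‖x‖ / ‖x‖ * inner ℝ x v ∧
    fderiv ℝ (fderiv ℝ ψ) x v v ≤ f2 * (inner ℝ x v / ‖x‖) ^ 2 +
      f1 ‖x‖ / ‖x‖ * (‖v‖ ^ 2 - (inner ℝ x v / ‖x‖) ^ 2) := by
  have hx0 : x + (0 : ℝ) • v = x := by simp
  have hlim : Tendsto (fun t : ℝ => x + t • v) (𝓝 0) (𝓝 x) := by
    simpa using (hasDerivAt_line x v 0).continuousAt.tendsto
  have hψ1 : ∀ᶠ y in 𝓝 x, HasFDerivAt ψ (fderiv ℝ ψ y) y := by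
    filter_upwards [hψ.eventually (by simp)] with y hy
    exact (hy.differentiableAt (by norm_num)).hasFDerivAt
  have hA : ∀ᶠ t in 𝓝 (0 : ℝ), HasDerivAt (fun t : ℝ => f ‖x + t • v‖ - ψ (x + t • v))
      (f1 ‖x + t • v‖ * (inner ℝ (x + t • v) v / ‖x + t • v‖) - fderiv ℝ ψ (x + t • v) v) t := by
    filter_upwards [hlim.eventually_ne hx, hlim.norm.eventually hf, hlim.eventually hψ1]
      with t ht1 ht2 ht3
    exact (ht2.comp t (hasDerivAt_norm_line x v ht1)).sub
      (ht3.comp_hasDerivAt t (hasDerivAt_line x v t))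
  have hmin' : IsLocalMin (fun t : ℝ => f ‖x + t • v‖ - ψ (x + t • v)) 0 := by
    filter_upwards [hlim.eventually hmin] with t ht
    simpa only [hx0] using ht
  obtain ⟨e1, e2⟩ := hmin'.deriv_eq_zero_and_nonneg hA
    ((hasDerivAt_radial_line hx hf1 v).sub (hasDerivAt_fderiv_line hψ v))
  simp only [hx0] at e1
  refine ⟨?_, by linarith⟩
  linear_combination -e1

/-- A test function touching φ(|x|) from below has the same gradient and a smaller Hessian, so its
Pucci value is at most that of φ. As φ' < 0 < φ'', the latter is given by the divergence form and
equality holds in the equation. -/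
theorem IsProfile.mem_eigenvalueSet {N : ℕ} {l L α γ d ν : ℝ} {φ Φ : ℝ → ℝ} (hl : 0 < l)
    (hlL : l ≤ L) (hα : -1 < α) (hγ : 1 < γ) (hγα : γ < 2 + α) (hd : 2 < d)
    (hdN : l * ((N : ℝ) - 1) = L * (d - 1)) (hφ : IsProfile α γ d 1 ν φ Φ) :
    L / (1 + α) * ν ∈ eigenvalueSet N α γ (pucciSup l L) := by
  have hmem : ∀ x ∈ puncturedBall N, ‖x‖ ∈ Ioo (0 : ℝ) 1 := fun x hx => mem_puncturedBall_iff.1 hx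
  refine ⟨fun x => φ ‖x‖, ?_, fun x hx => ?_, fun x _ y _ h => by simp only [h], ?_⟩
  · exact hφ.continuousOn.comp continuous_norm.continuousOn
      fun x hx => Ioo_subset_Icc_self (hmem x hx)
  · exact hφ.pos _ (Ioo_subset_Ico_self (hmem x hx))
  intro x hx
  have hr := hmem x hx
  set r := ‖x‖ with hrdef
  have hx0 : x ≠ 0 := norm_pos_iff.1 hr.1
  refine ⟨fun δ hδ hball hconst => ?_, fun ψ hψ hmin hgrad => ?_⟩
  · exfalso
    -- The constancy clause is void: moving outwards by δ/2 along the ray stays in the ball and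
    -- strictly decreases φ.
    set t := δ / (2 * r) with ht
    have hr0 := hr.1
    have ht0 : 0 < t := by positivity
    have hy : (1 + t) • x ∈ Metric.ball x δ := by
      rw [Metric.mem_ball, dist_eq_norm, add_smul, one_smul, add_sub_cancel_left, norm_smul,
        Real.norm_of_nonneg ht0.le, ← hrdef, ht]
      field_simp
      linarith
    have hyn : ‖(1 + t) • x‖ = (1 + t) * r := by
      rw [norm_smul, Real.norm_of_nonneg (by positivity)]
    have h1 := hconst _ hy
    have h2 := hmem _ (hball hy)
    simp only [hyn] at h1 h2
    have h3 := hφ.strictAntiOn (Ioo_subset_Icc_self hr) (Ioo_subset_Icc_self h2) (by nlinarith)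
    exact h3.ne h1
  · set X : ℝ → ℝ := fun s => s ^ (-weightExp α d) * Φ s with hX
    have hXr := hφ.slope_pos hr
    have hXd := hφ.hasDerivAt_slope hr
    have hXneg := hφ.deriv_slope_neg hα hγ hγα hd hr
    set X' := ν * (φ r ^ (1 + α) / r ^ γ) - weightExp α d * (r ^ (-weightExp α d) * Φ r) / r with hX'
    have hf : ∀ᶠ s in 𝓝 r, HasDerivAt φ (-(X s) ^ (1 / (1 + α))) s := by
      filter_upwards [isOpen_Ioo.mem_nhds hr] with s hs using hφ.hasDerivAt s hs
    have hψx : ContDiffAt ℝ 2 ψ x := hψ.contDiffAt ((isOpen_puncturedBall N).mem_nhds hx)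
    have hf1 := hasDerivAt_neg_rpow_inv (α := α) hXd hXr
    have htouch := radial_touching hx0 hf hf1 hψx hmin
    have h1 : 0 < 1 + α := by linarith
    have hg : gradient ψ x = (-(X r) ^ (1 / (1 + α)) / r) • x := by
      refine ext_inner_right ℝ fun v => ?_
      rw [inner_gradient_left, (htouch v).1, real_inner_smul_left]
    have hgn : ‖gradient ψ x‖ = |-(X r) ^ (1 / (1 + α))| := by
      rw [hg, norm_smul, norm_div, ← hrdef, Real.norm_of_nonneg hr.1.le, Real.norm_eq_abs,
        div_mul_cancel₀ _ hr.1.ne']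
    have hXr' : 0 < X r := hXr
    set f2 := -(1 / (1 + α) * X r ^ (1 / (1 + α) - 1) * X') with hf2
    have hf2pos : 0 < f2 := by
      rw [hf2, neg_pos]
      exact mul_neg_of_pos_of_neg (mul_pos (by positivity) (Real.rpow_pos_of_pos hXr' _)) hXneg
    have hP : pucciSup l L (hessianMatrix ψ x) ≤
        pucciRadial N l L (-(X r) ^ (1 / (1 + α)) / r) f2 := by
      refine pucciSup_le_pucciRadial hl hlL (isHermitian_hessianMatrix hψx)
        (e := r⁻¹ • x) ?_ fun v => ?_
      · rw [norm_smul, norm_inv, Real.norm_of_nonneg hr.1.le, inv_mul_cancel₀ hr.1.ne']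
      · rw [hessianMatrix_dotProduct, real_inner_smul_left, inv_mul_eq_div]
        exact (htouch v).2
    have hrad : pucciRadial N l L (-(X r) ^ (1 / (1 + α)) / r) f2 =
        L * f2 + ((N : ℝ) - 1) * (l * (-(X r) ^ (1 / (1 + α)) / r)) := by
      have h2 : -(X r) ^ (1 / (1 + α)) / r < 0 :=
        div_neg_of_neg_of_pos (neg_neg_of_pos (Real.rpow_pos_of_pos hXr' _)) hr.1
      rw [pucciRadial, max_eq_left (by nlinarith), max_eq_right (by nlinarith)]
    have hkey := flux_operator_eq hα hdN hXr' X' r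
    have h3 := mul_le_mul_of_nonneg_left (hP.trans hrad.le)
      (Real.rpow_nonneg (abs_nonneg (-(X r) ^ (1 / (1 + α)))) α)
    rw [hkey] at h3
    rw [hgn]
    have h4 : X' + weightExp α d * X r / r = ν * (φ r ^ (1 + α) / r ^ γ) := by
      rw [hX']; ring
    rw [h4] at h3
    linarith

/-! ### Picone's identity -/

/-- The remainder in Picone's inequality. -/
noncomputable def piconeRemainder (α a c : ℝ) : ℝ :=
  |a| ^ (α + 2) + (α + 2) * (|c| ^ α * c) * a + (α + 1) * |c| ^ (α + 2)

theorem abs_rpow_mul_sq {α c : ℝ} (hc : c ≠ 0) : |c| ^ α * (c * c) = |c| ^ (α + 2) := by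
  rw [Real.rpow_add (abs_pos.2 hc), Real.rpow_two, sq_abs, sq]

/-- For a = -ct with c ≠ 0, the remainder is |c|^p (|t|^p - pt + p - 1) with p = α + 2. For t ≥ 0
this is the strict Bernoulli inequality at t ≠ 1; for t < 0 every term helps. -/
theorem piconeRemainder_pos {α : ℝ} (hα : -1 < α) {a c : ℝ} (hac : a ≠ -c) :
    0 < piconeRemainder α a c := by
  unfold piconeRemainder
  rcases eq_or_ne c 0 with rfl | hc
  · have ha : a ≠ 0 := by simpa using hac
    have : (0 : ℝ) ^ (α + 2) = 0 := Real.zero_rpow (by linarith)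
    simp only [abs_zero, this, mul_zero, zero_mul, add_zero]
    exact Real.rpow_pos_of_pos (abs_pos.2 ha) _
  · obtain ⟨t, rfl⟩ : ∃ t, a = -c * t := ⟨-a / c, by field_simp⟩
    have ht : t ≠ 1 := by rintro rfl; simp at hac
    have hcp : 0 < |c| ^ (α + 2) := Real.rpow_pos_of_pos (abs_pos.2 hc) _
    have e1 : |-c * t| ^ (α + 2) + (α + 2) * (|c| ^ α * c) * (-c * t) + (α + 1) * |c| ^ (α + 2) =
        |c| ^ (α + 2) * (|t| ^ (α + 2) - (α + 2) * t + (α + 1)) := by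
      rw [abs_mul, abs_neg, Real.mul_rpow (abs_nonneg _) (abs_nonneg _)]
      linear_combination (-(α + 2) * t) * abs_rpow_mul_sq (α := α) hc
    rw [e1]
    refine mul_pos hcp ?_
    rcases lt_or_ge t 0 with h | h
    · have := Real.rpow_nonneg (abs_nonneg t) (α + 2)
      nlinarith
    · have := one_add_mul_self_lt_rpow_one_add (s := t - 1) (by linarith) (sub_ne_zero.2 ht)
        (show 1 < α + 2 by linarith)
      rw [add_sub_cancel] at this
      rw [abs_of_nonneg h]
      linarith

theorem piconeRemainder_self {α : ℝ} (hα : -1 < α) (c : ℝ) : piconeRemainder α (-c) c = 0 := by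
  unfold piconeRemainder
  rcases eq_or_ne c 0 with rfl | hc
  · have : (0 : ℝ) ^ (α + 2) = 0 := Real.zero_rpow (by linarith)
    simp [this]
  · rw [abs_neg]
    linear_combination (-(α + 2)) * abs_rpow_mul_sq (α := α) hc

theorem piconeRemainder_nonneg {α : ℝ} (hα : -1 < α) (a c : ℝ) : 0 ≤ piconeRemainder α a c := by
  rcases eq_or_ne a (-c) with rfl | h
  · exact (piconeRemainder_self hα c).ge
  · exact (piconeRemainder_pos hα h).le

theorem continuous_abs_rpow_mul_self {α : ℝ} (hα : -1 < α) :
    Continuous fun c : ℝ => |c| ^ α * c := by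
  refine continuous_iff_continuousAt.2 fun c => ?_
  rcases eq_or_ne c 0 with rfl | hc
  · have h1 : Tendsto (fun c : ℝ => |c| ^ (1 + α)) (𝓝 0) (𝓝 0) := by
      have : Continuous fun c : ℝ => |c| ^ (1 + α) :=
        continuous_abs.rpow_const fun _ => Or.inr (by linarith)
      have h := this.tendsto 0
      rwa [abs_zero, Real.zero_rpow (by linarith)] at h
    rw [ContinuousAt, mul_zero]
    refine squeeze_zero_norm (fun c => ?_) h1
    rcases eq_or_ne c 0 with rfl | hc
    · simp [Real.rpow_nonneg]
    · rw [norm_mul, Real.norm_of_nonneg (by positivity), Real.norm_eq_abs, add_comm,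
        Real.rpow_add_one (abs_ne_zero.2 hc)]
  · exact (continuousAt_id.abs.rpow_const (Or.inl (abs_ne_zero.2 hc))).mul continuousAt_id

theorem continuous_piconeRemainder {α : ℝ} (hα : -1 < α) :
    Continuous fun x : ℝ × ℝ => piconeRemainder α x.1 x.2 := by
  have h1 : Continuous fun c : ℝ => |c| ^ (α + 2) :=
    continuous_abs.rpow_const fun _ => Or.inr (by linarith)
  have h2 := continuous_abs_rpow_mul_self hα
  unfold piconeRemainder
  exact ((h1.comp continuous_fst).add ((continuous_const.mul (h2.comp continuous_snd)).mul
    continuous_fst)).add (continuous_const.mul (h1.comp continuous_snd))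

/-- The logarithmic slope `-φ'/φ` of a profile. -/
noncomputable def logSlope (α d : ℝ) (φ Φ : ℝ → ℝ) (r : ℝ) : ℝ :=
  (r ^ (-weightExp α d) * Φ r) ^ (1 / (1 + α)) / φ r

namespace IsProfile

variable {α γ d ν : ℝ} {φ Φ : ℝ → ℝ}

theorem continuousOn_logSlope (hα : -1 < α) (h : IsProfile α γ d 1 ν φ Φ) :
    ContinuousOn (logSlope α d φ Φ) (Ioo 0 1) := fun r hr => by
  have h1 : 0 < 1 + α := by linarith
  exact (((h.hasDerivAt_slope hr).continuousAt.rpow_const (Or.inr (by positivity))).div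
    (h.hasDerivAt r hr).continuousAt (h.pos r ⟨hr.1.le, hr.2⟩).ne').continuousWithinAt

theorem logSlope_pos (h : IsProfile α γ d 1 ν φ Φ) {r : ℝ} (hr : r ∈ Ioo (0 : ℝ) 1) :
    0 < logSlope α d φ Φ r :=
  div_pos (Real.rpow_pos_of_pos (h.slope_pos hr) _) (h.pos r ⟨hr.1.le, hr.2⟩)

theorem hasDerivAt' (h : IsProfile α γ d 1 ν φ Φ) {r : ℝ} (hr : r ∈ Ioo (0 : ℝ) 1) :
    HasDerivAt φ (-(logSlope α d φ Φ r * φ r)) r := by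
  have := h.hasDerivAt r hr
  rwa [logSlope, div_mul_cancel₀ _ (h.pos r ⟨hr.1.le, hr.2⟩).ne']

theorem flux_div_eq (hα : -1 < α) (h : IsProfile α γ d 1 ν φ Φ) {r : ℝ} (hr : r ∈ Ioo (0 : ℝ) 1) :
    Φ r / φ r ^ (1 + α) = r ^ weightExp α d * logSlope α d φ Φ r ^ (1 + α) := by
  have h1 : 0 < 1 + α := by linarith
  have hX := h.slope_pos hr
  have hφ := h.pos r ⟨hr.1.le, hr.2⟩
  have hr0 : 0 < r ^ weightExp α d := Real.rpow_pos_of_pos hr.1 _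
  rw [logSlope, Real.div_rpow (by positivity) hφ.le, ← Real.rpow_mul hX.le,
    show 1 / (1 + α) * (1 + α) = 1 by field_simp, Real.rpow_one, Real.rpow_neg hr.1.le]
  field_simp

/-- The factor Φ/φ^(1+α) = r^w k^(1+α), k = -φ'/φ, satisfies the Riccati equation. The product rule
then leaves the potential minus the energy density, and the remaining terms assemble into the Picone
remainder. -/
theorem hasDerivAt_picone (hα : -1 < α) (h : IsProfile α γ d 1 ν φ Φ) {r : ℝ}
    (hr : r ∈ Ioo (0 : ℝ) 1) {u : ℝ → ℝ} {u' : ℝ} (hu : HasDerivAt u u' r) :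
    HasDerivAt (fun s => |u s| ^ (α + 2) * (Φ s / φ s ^ (1 + α)))
      ((r ^ weightExp α d * piconeRemainder α u' (logSlope α d φ Φ r * u r) +
        ν * (|u r| ^ (α + 2) * r ^ (weightExp α d - γ))) -
          |u'| ^ (α + 2) * r ^ weightExp α d) r := by
  have h1 : 0 < 1 + α := by linarith
  have hφ := h.pos r ⟨hr.1.le, hr.2⟩
  have hk := h.logSlope_pos hr
  have hy : HasDerivAt (fun s => Φ s / φ s ^ (1 + α))
      (ν * r ^ (weightExp α d - γ) +
        (1 + α) * (r ^ weightExp α d * logSlope α d φ Φ r ^ (1 + α)) * logSlope α d φ Φ r) r := by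
    refine ((h.flux_hasDerivAt r hr).div ((h.hasDerivAt' hr).rpow_const (p := 1 + α)
      (Or.inl hφ.ne')) (Real.rpow_pos_of_pos hφ _).ne').congr_deriv ?_
    rw [← h.flux_div_eq hα hr, Real.rpow_sub_one hφ.ne']
    have : φ r ^ (1 + α) ≠ 0 := (Real.rpow_pos_of_pos hφ _).ne'
    field_simp
    ring
  have hu2 : HasDerivAt (fun s => |u s| ^ (α + 2)) ((α + 2) * |u r| ^ (α + 2 - 2) * u r * u') r :=
    (hasDerivAt_abs_rpow (u r) (by linarith : 1 < α + 2)).comp r hu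
  refine (hu2.mul hy).congr_deriv ?_
  rw [h.flux_div_eq hα hr, piconeRemainder, add_sub_cancel_right]
  set k := logSlope α d φ Φ r
  have e1 : |k * u r| ^ α * (k * u r) = k ^ (1 + α) * (|u r| ^ α * u r) := by
    rw [abs_mul, abs_of_pos hk, Real.mul_rpow hk.le (abs_nonneg _), add_comm 1 α,
      Real.rpow_add_one hk.ne']
    ring
  have e2 : |k * u r| ^ (α + 2) = k ^ (1 + α) * k * |u r| ^ (α + 2) := by
    rw [abs_mul, abs_of_pos hk, Real.mul_rpow hk.le (abs_nonneg _), ← Real.rpow_add_one hk.ne']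
    ring_nf
  rw [e1, e2]
  ring

/-- Picone's inequality for test functions. -/
theorem picone_testFun (hα : -1 < α) (h : IsProfile α γ d 1 ν φ Φ) {u : ℝ → ℝ}
    (hu : IsTestFun u) :
    ∫⁻ r in Ioo (0 : ℝ) 1, ENNReal.ofReal
      (r ^ weightExp α d * piconeRemainder α (deriv u r) (logSlope α d φ Φ r * u r) +
        ν * (|u r| ^ (α + 2) * r ^ (weightExp α d - γ))) ≤
    ∫⁻ r in Ioo (0 : ℝ) 1, ENNReal.ofReal (|deriv u r| ^ (α + 2) * r ^ weightExp α d) := by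
  obtain ⟨hu2, -, b, hb, hub⟩ := hu
  have hu2' : ContDiffOn ℝ 2 u (Ioo 0 1) := hu2.mono Ioo_subset_Icc_self
  have huc := hu2'.continuousOn
  have hu'c : ContinuousOn (deriv u) (Ioo 0 1) :=
    hu2'.continuousOn_deriv_of_isOpen isOpen_Ioo (by norm_num)
  have huder : ∀ r ∈ Ioo (0 : ℝ) 1, HasDerivAt u (deriv u r) r := fun r hr =>
    ((hu2'.contDiffAt (isOpen_Ioo.mem_nhds hr)).differentiableAt (by norm_num)).hasDerivAt
  have hpow : ∀ e : ℝ, ContinuousOn (fun r : ℝ => r ^ e) (Ioo 0 1) := fun e =>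
    continuousOn_id.rpow_const fun r hr => Or.inl hr.1.ne'
  set F : ℝ → ℝ := fun r =>
    r ^ weightExp α d * piconeRemainder α (deriv u r) (logSlope α d φ Φ r * u r) +
        ν * (|u r| ^ (α + 2) * r ^ (weightExp α d - γ)) with hF
  set G : ℝ → ℝ := fun r => |deriv u r| ^ (α + 2) * r ^ weightExp α d with hG
  have hFc : ContinuousOn F (Ioo 0 1) :=
    ((hpow _).mul ((continuous_piconeRemainder hα).comp_continuousOn
      (hu'c.prodMk ((h.continuousOn_logSlope hα).mul huc)))).add
      (continuousOn_const.mul ((huc.abs.rpow_const fun _ _ => Or.inr (by linarith)).mul (hpow _)))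
  have hGc : ContinuousOn G (Ioo 0 1) :=
    (hu'c.abs.rpow_const fun _ _ => Or.inr (by linarith)).mul (hpow _)
  have hF0 : ∀ r ∈ Ioo (0 : ℝ) 1, 0 ≤ F r := fun r hr => by
    have := hr.1
    have := piconeRemainder_nonneg hα (deriv u r) (logSlope α d φ Φ r * u r)
    have := h.eigenvalue_pos
    positivity
  have hG0 : ∀ r ∈ Ioo (0 : ℝ) 1, 0 ≤ G r := fun r hr => by
    have := hr.1
    positivity
  -- Integrating the identity over [a,c], the boundary term vanishes at c since u(c) = 0. At a it is
  -- nonnegative and can be dropped, so no behaviour at 0 is required.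
  have key : ∀ a c : ℝ, 0 < a → a ≤ c → c < 1 → u c = 0 →
      ∫⁻ r in Ioo a c, ENNReal.ofReal (F r) ≤ ∫⁻ r in Ioo a c, ENNReal.ofReal (G r) := by
    intro a c ha hac hc huc0
    have hsub : Icc a c ⊆ Ioo 0 1 := fun r hr => ⟨ha.trans_le hr.1, hr.2.trans_lt hc⟩
    have hsub' : Ioo a c ⊆ Ioo 0 1 := Ioo_subset_Icc_self.trans hsub
    have hFi : IntervalIntegrable F volume a c := by
      refine ContinuousOn.intervalIntegrable ?_
      rw [uIcc_of_le hac]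
      exact hFc.mono hsub
    have hGi : IntervalIntegrable G volume a c := by
      refine ContinuousOn.intervalIntegrable ?_
      rw [uIcc_of_le hac]
      exact hGc.mono hsub
    have hint : ∫ r in a..c, (F r - G r) = _ :=
      intervalIntegral.integral_eq_sub_of_hasDerivAt (a := a) (b := c)
      (f := fun s => |u s| ^ (α + 2) * (Φ s / φ s ^ (1 + α))) (f' := fun r => F r - G r)
      (fun r hr => by
        rw [uIcc_of_le hac] at hr
        exact h.hasDerivAt_picone hα (hsub hr) (huder r (hsub hr))) (hFi.sub hGi)
    rw [intervalIntegral.integral_sub hFi hGi, huc0, abs_zero,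
      Real.zero_rpow (by linarith), zero_mul] at hint
    have haI := hsub ⟨le_rfl, hac⟩
    have hP : 0 ≤ |u a| ^ (α + 2) * (Φ a / φ a ^ (1 + α)) := by
      have := h.flux_pos haI
      have := h.pos a ⟨ha.le, haI.2⟩
      positivity
    have hFi' := (intervalIntegrable_iff_integrableOn_Ioo_of_le hac).1 hFi
    have hGi' := (intervalIntegrable_iff_integrableOn_Ioo_of_le hac).1 hGi
    rw [← ofReal_integral_eq_lintegral_ofReal hFi', ← ofReal_integral_eq_lintegral_ofReal hGi']
    · refine ENNReal.ofReal_le_ofReal ?_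
      rw [← integral_Ioc_eq_integral_Ioo, ← integral_Ioc_eq_integral_Ioo,
        ← intervalIntegral.integral_of_le hac, ← intervalIntegral.integral_of_le hac]
      linarith
    · filter_upwards [ae_restrict_mem measurableSet_Ioo] with r hr using hG0 r (hsub' hr)
    · filter_upwards [ae_restrict_mem measurableSet_Ioo] with r hr using hF0 r (hsub' hr)
  have hlim0 : Tendsto (fun n : ℕ => 1 / ((n : ℝ) + 1)) atTop (𝓝 0) :=
    tendsto_one_div_add_atTop_nhds_zero_nat
  have hlim1 : Tendsto (fun n : ℕ => 1 - 1 / ((n : ℝ) + 1)) atTop (𝓝 1) := by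
    simpa using hlim0.const_sub 1
  have hcov := aecover_Ioo_of_Ioo (μ := volume) hlim0 hlim1
  have hsets : ∀ n : ℕ, Ioo (1 / ((n : ℝ) + 1)) (1 - 1 / ((n : ℝ) + 1)) ⊆ Ioo 0 1 := fun n r hr => by
    have : (0 : ℝ) < 1 / (n + 1) := by positivity
    exact ⟨this.trans hr.1, hr.2.trans (by linarith)⟩
  have hres : ∀ n : ℕ, (volume.restrict (Ioo (0 : ℝ) 1)).restrict
      (Ioo (1 / ((n : ℝ) + 1)) (1 - 1 / ((n : ℝ) + 1))) =
      volume.restrict (Ioo (1 / ((n : ℝ) + 1)) (1 - 1 / ((n : ℝ) + 1))) := fun n => by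
    rw [Measure.restrict_restrict measurableSet_Ioo, inter_eq_self_of_subset_left (hsets n)]
  have hFm := (hFc.aemeasurable (μ := volume) measurableSet_Ioo).ennreal_ofReal
  have hGm := (hGc.aemeasurable (μ := volume) measurableSet_Ioo).ennreal_ofReal
  refine le_of_tendsto_of_tendsto (hcov.lintegral_tendsto_of_nat hFm)
    (hcov.lintegral_tendsto_of_nat hGm) ?_
  filter_upwards [hlim1.eventually (lt_mem_nhds hb.2), hlim0.eventually (gt_mem_nhds one_half_pos)]
    with n hn hn2
  have : (0 : ℝ) < 1 / (n + 1) := by positivity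
  rw [hres]
  exact key _ _ this (by linarith) (by linarith) (hub _ ⟨hn.le, by linarith⟩)

end IsProfile

/-! ### The energy space as a closure in a weighted space -/

/-- The derivative of `v`, multiplied by the weight `r^(w/(α+2))`. -/
noncomputable def weightedDeriv (α d : ℝ) (v : ℝ → ℝ) (r : ℝ) : ℝ :=
  r ^ (weightExp α d / (α + 2)) * deriv v r

theorem measurable_weightedDeriv (α d : ℝ) (v : ℝ → ℝ) : Measurable (weightedDeriv α d v) :=
  (measurable_id.pow_const _).mul (measurable_deriv v)

theorem lintegral_weighted_eq {α : ℝ} (hα : -1 < α) (d : ℝ) (h : ℝ → ℝ) :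
    ∫⁻ r in Ioo (0 : ℝ) 1, ENNReal.ofReal (|h r| ^ (α + 2) * r ^ weightExp α d) =
      eLpNorm (fun r => r ^ (weightExp α d / (α + 2)) * h r) (ENNReal.ofReal (α + 2))
        (volume.restrict (Ioo 0 1)) ^ (α + 2) := by
  have hp : 0 < α + 2 := by linarith
  rw [eLpNorm_eq_lintegral_rpow_enorm_toReal (by simpa using hp) ENNReal.ofReal_ne_top,
    ENNReal.toReal_ofReal hp.le, ← ENNReal.rpow_mul, one_div, inv_mul_cancel₀ hp.ne',
    ENNReal.rpow_one]
  refine setLIntegral_congr_fun measurableSet_Ioo fun r hr => ?_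
  have hr0 := hr.1
  rw [Real.enorm_eq_ofReal_abs, ENNReal.ofReal_rpow_of_nonneg (abs_nonneg _) hp.le, abs_mul,
    abs_of_pos (Real.rpow_pos_of_pos hr0 _), Real.mul_rpow (by positivity) (abs_nonneg _),
    ← Real.rpow_mul hr0.le, div_mul_cancel₀ _ hp.ne', mul_comm]

theorem IsTestFun.memLp_weightedDeriv {α d : ℝ} (hα : -1 < α) (hd : 2 < d) {u : ℝ → ℝ}
    (hu : IsTestFun u) :
    MemLp (weightedDeriv α d u) (ENNReal.ofReal (α + 2)) (volume.restrict (Ioo 0 1)) := by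
  obtain ⟨hu2, -, -⟩ := hu
  have hc : ContinuousOn (derivWithin u (Icc 0 1)) (Icc 0 1) :=
    hu2.continuousOn_derivWithin (uniqueDiffOn_Icc zero_lt_one) (by norm_num)
  obtain ⟨K, hK⟩ := isCompact_Icc.exists_bound_of_continuousOn hc
  refine MemLp.of_bound (measurable_weightedDeriv α d u).aestronglyMeasurable K ?_
  filter_upwards [ae_restrict_mem measurableSet_Ioo] with r hr
  have h1 := hK r (Ioo_subset_Icc_self hr)
  rw [derivWithin_of_mem_nhds (Icc_mem_nhds hr.1 hr.2)] at h1
  have hp : 0 < α + 2 := by linarith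
  have hw := weightExp_pos hα hd
  have h2 : r ^ (weightExp α d / (α + 2)) ≤ 1 :=
    Real.rpow_le_one hr.1.le hr.2.le (by positivity)
  have h3 : 0 ≤ r ^ (weightExp α d / (α + 2)) := Real.rpow_nonneg hr.1.le _
  rw [weightedDeriv, norm_mul, Real.norm_of_nonneg h3]
  nlinarith [norm_nonneg (deriv u r)]

section MemH01

variable {α d : ℝ} {v : ℝ → ℝ} {u : ℕ → ℝ → ℝ}

theorem tendsto_eLpNorm_weightedDeriv (hα : -1 < α)
    (h : Tendsto (fun n => ∫⁻ r in Ioo (0 : ℝ) 1,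
      ENNReal.ofReal (|deriv (u n) r - deriv v r| ^ (α + 2) * r ^ weightExp α d)) atTop (𝓝 0)) :
    Tendsto (fun n => eLpNorm (weightedDeriv α d (u n) - weightedDeriv α d v)
      (ENNReal.ofReal (α + 2)) (volume.restrict (Ioo 0 1))) atTop (𝓝 0) := by
  have hp : 0 < α + 2 := by linarith
  have h1 : ∀ n, ∫⁻ r in Ioo (0 : ℝ) 1,
      ENNReal.ofReal (|deriv (u n) r - deriv v r| ^ (α + 2) * r ^ weightExp α d) =
      eLpNorm (weightedDeriv α d (u n) - weightedDeriv α d v)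
      (ENNReal.ofReal (α + 2)) (volume.restrict (Ioo 0 1)) ^ (α + 2) := fun n => by
    rw [lintegral_weighted_eq hα d (fun r => deriv (u n) r - deriv v r)]
    congr 2
    funext r
    simp only [weightedDeriv, Pi.sub_apply]
    ring
  simp_rw [h1] at h
  have h2 := ENNReal.continuous_rpow_const (y := 1 / (α + 2)) |>.tendsto 0 |>.comp h
  rw [ENNReal.zero_rpow_of_pos (by positivity)] at h2
  refine h2.congr fun n => ?_
  simp only [Function.comp]
  rw [← ENNReal.rpow_mul, mul_one_div_cancel hp.ne', ENNReal.rpow_one]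

theorem memLp_weightedDeriv (hα : -1 < α) (hd : 2 < d) (hu : ∀ n, IsTestFun (u n))
    (h : Tendsto (fun n => eLpNorm (weightedDeriv α d (u n) - weightedDeriv α d v)
      (ENNReal.ofReal (α + 2)) (volume.restrict (Ioo 0 1))) atTop (𝓝 0)) :
    MemLp (weightedDeriv α d v) (ENNReal.ofReal (α + 2)) (volume.restrict (Ioo 0 1)) := by
  obtain ⟨n, hn⟩ := (h.eventually (gt_mem_nhds ENNReal.zero_lt_top)).exists
  have h1 : MemLp (weightedDeriv α d (u n) - weightedDeriv α d v) (ENNReal.ofReal (α + 2))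
      (volume.restrict (Ioo 0 1)) :=
    ⟨((measurable_weightedDeriv α d (u n)).sub
      (measurable_weightedDeriv α d v)).aestronglyMeasurable, hn⟩
  have h2 := ((hu n).memLp_weightedDeriv (α := α) (d := d) hα hd).sub h1
  rwa [sub_sub_cancel] at h2

theorem MemH01.lintegral_lt_top (hα : -1 < α) (hd : 2 < d) (hv : MemH01 α d v) :
    ∫⁻ r in Ioo (0 : ℝ) 1, ENNReal.ofReal (|deriv v r| ^ (α + 2) * r ^ weightExp α d) < ∞ := by
  obtain ⟨u, hu, -, hlim⟩ := hv
  rw [lintegral_weighted_eq hα d (deriv v)]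
  exact ENNReal.rpow_lt_top_of_nonneg (by linarith)
    (memLp_weightedDeriv hα hd hu (tendsto_eLpNorm_weightedDeriv hα hlim)).2.ne

theorem MemH01.energy_eq (hα : -1 < α) (hd : 2 < d) (hv : MemH01 α d v) :
    ENNReal.ofReal (energy α d v) =
      ∫⁻ r in Ioo (0 : ℝ) 1, ENNReal.ofReal (|deriv v r| ^ (α + 2) * r ^ weightExp α d) := by
  rw [energy, integral_eq_lintegral_of_nonneg_ae, ENNReal.ofReal_toReal]
  · exact (hv.lintegral_lt_top hα hd).ne
  · filter_upwards [ae_restrict_mem measurableSet_Ioo] with r hr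
    have := hr.1
    positivity
  · have := measurable_deriv v
    have : Measurable fun r => |deriv v r| ^ (α + 2) := (this.abs).pow_const _
    exact (this.mul (measurable_id.pow_const _)).aestronglyMeasurable

/-- Away from 0 the weight is bounded below, so on [a,b] weighted convergence of the derivatives
implies convergence in L¹ by Hölder. The fundamental theorem of calculus for test functions passes
to the limit. -/
theorem MemH01.sub_eq_integral (hα : -1 < α) (hd : 2 < d) (hv : MemH01 α d v) {a b : ℝ}
    (ha : 0 < a) (hab : a ≤ b) (hb : b < 1) :
    IntervalIntegrable (deriv v) volume a b ∧ v b - v a = ∫ r in a..b, deriv v r := by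
  obtain ⟨u, hu, hpt, hlim⟩ := hv
  have hp1 : 1 ≤ ENNReal.ofReal (α + 2) := by
    rw [ENNReal.one_le_ofReal]
    linarith
  have hp : 0 < α + 2 := by linarith
  have hw := weightExp_pos hα hd
  have hD := tendsto_eLpNorm_weightedDeriv hα hlim
  set e := weightExp α d / (α + 2) with he
  have he0 : 0 < e := by positivity
  have hsub : Ioo a b ⊆ Ioo 0 1 := Ioo_subset_Ioo ha.le hb.le
  have hle : ∀ f : ℝ → ℝ, eLpNorm f (ENNReal.ofReal (α + 2)) (volume.restrict (Ioo a b)) ≤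
      ENNReal.ofReal (a ^ (-e)) * eLpNorm (fun r => r ^ e * f r) (ENNReal.ofReal (α + 2))
        (volume.restrict (Ioo 0 1)) := fun f => by
    refine le_trans (eLpNorm_le_mul_eLpNorm_of_ae_le_mul (g := fun r => r ^ e * f r)
      (c := a ^ (-e)) ?_ _)
      (mul_le_mul_right (eLpNorm_mono_measure _ (Measure.restrict_mono hsub le_rfl)) _)
    filter_upwards [ae_restrict_mem measurableSet_Ioo] with r hr
    have hr0 := ha.trans hr.1
    rw [norm_mul, Real.norm_of_nonneg (Real.rpow_nonneg hr0.le e), ← mul_assoc]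
    refine le_mul_of_one_le_left (norm_nonneg _) ?_
    rw [Real.rpow_neg ha.le, inv_mul_eq_div, one_le_div (Real.rpow_pos_of_pos ha e)]
    exact Real.rpow_le_rpow ha.le hr.1.le he0.le
  have hfin : ∀ f : ℝ → ℝ, Measurable f →
      eLpNorm f 1 (volume.restrict (Ioo a b)) ≤
        eLpNorm f (ENNReal.ofReal (α + 2)) (volume.restrict (Ioo a b)) *
          (volume.restrict (Ioo a b)) univ ^
            (1 / (1 : ℝ≥0∞).toReal - 1 / (ENNReal.ofReal (α + 2)).toReal) :=
    fun f hf => eLpNorm_le_eLpNorm_mul_rpow_measure_univ hp1 hf.aestronglyMeasurable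
  set K := (volume.restrict (Ioo a b)) univ ^
            (1 / (1 : ℝ≥0∞).toReal - 1 / (ENNReal.ofReal (α + 2)).toReal) with hK
  have hKtop : K ≠ ∞ := by
    refine ENNReal.rpow_ne_top_of_nonneg ?_ (measure_ne_top _ _)
    rw [ENNReal.toReal_one, ENNReal.toReal_ofReal hp.le, sub_nonneg, div_le_div_iff₀ hp one_pos]
    linarith
  have hint : ∀ f : ℝ → ℝ, MemLp (weightedDeriv α d f) (ENNReal.ofReal (α + 2))
      (volume.restrict (Ioo 0 1)) → IntegrableOn (deriv f) (Ioo a b) := fun f hf => by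
    rw [IntegrableOn, ← memLp_one_iff_integrable]
    refine ⟨(measurable_deriv f).aestronglyMeasurable, ?_⟩
    refine (hfin _ (measurable_deriv f)).trans_lt (ENNReal.mul_lt_top ?_ hKtop.lt_top)
    exact (hle _).trans_lt (ENNReal.mul_lt_top ENNReal.ofReal_lt_top hf.2)
  have hvint := hint v (memLp_weightedDeriv hα hd hu hD)
  have huint := fun n => hint (u n) ((hu n).memLp_weightedDeriv hα hd)
  refine ⟨(intervalIntegrable_iff_integrableOn_Ioo_of_le hab).2 hvint, ?_⟩
  have hL1 : Tendsto (fun n => eLpNorm (deriv (u n) - deriv v) 1 (volume.restrict (Ioo a b)))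
      atTop (𝓝 0) := by
    have h1 : Tendsto (fun n => ENNReal.ofReal (a ^ (-e)) *
        eLpNorm (weightedDeriv α d (u n) - weightedDeriv α d v)
        (ENNReal.ofReal (α + 2)) (volume.restrict (Ioo 0 1)) * K) atTop (𝓝 0) := by
      have h2 := ENNReal.Tendsto.const_mul (a := ENNReal.ofReal (a ^ (-e))) hD
        (Or.inr ENNReal.ofReal_ne_top)
      have h3 := ENNReal.Tendsto.mul_const h2 (Or.inr hKtop)
      simpa using h3
    refine tendsto_of_tendsto_of_tendsto_of_le_of_le tendsto_const_nhds h1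
      (fun n => zero_le) (fun n => ?_)
    refine (hfin _ ((measurable_deriv _).sub (measurable_deriv _))).trans
      (mul_le_mul_left ((hle _).trans (le_of_eq ?_)) _)
    congr 2
    funext r
    simp only [weightedDeriv, Pi.sub_apply, he]
    ring
  have hlimint := tendsto_integral_of_L1' (deriv v) hvint.aestronglyMeasurable
    (Eventually.of_forall huint) hL1
  have hpt' : Tendsto (fun n => u n b - u n a) atTop (𝓝 (v b - v a)) :=
    (hpt b ⟨ha.trans_le hab, hb⟩).sub (hpt a ⟨ha, hab.trans_lt hb⟩)
  have heq : ∀ n, ∫ r in Ioo a b, deriv (u n) r = u n b - u n a := fun n => by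
    rw [← integral_Ioc_eq_integral_Ioo, ← intervalIntegral.integral_of_le hab]
    refine intervalIntegral.integral_deriv_eq_sub (fun r hr => ?_)
      ((intervalIntegrable_iff_integrableOn_Ioo_of_le hab).2 (huint n))
    rw [uIcc_of_le hab] at hr
    exact ((hu n).1.contDiffAt (Icc_mem_nhds (ha.trans_le hr.1)
      (hr.2.trans_lt hb))).differentiableAt (by norm_num)
  simp_rw [heq] at hlimint
  rw [intervalIntegral.integral_of_le hab, integral_Ioc_eq_integral_Ioo]
  exact tendsto_nhds_unique hpt' hlimint

/-- Picone's inequality in `𝓗₀¹`. -/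
theorem MemH01.picone {γ ν : ℝ} {φ Φ : ℝ → ℝ} (hα : -1 < α)
    (hφ : IsProfile α γ d 1 ν φ Φ) (hv : MemH01 α d v) :
    ∫⁻ r in Ioo (0 : ℝ) 1, ENNReal.ofReal
      (r ^ weightExp α d * piconeRemainder α (deriv v r) (logSlope α d φ Φ r * v r) +
        ν * (|v r| ^ (α + 2) * r ^ (weightExp α d - γ))) ≤
    ∫⁻ r in Ioo (0 : ℝ) 1, ENNReal.ofReal (|deriv v r| ^ (α + 2) * r ^ weightExp α d) := by
  obtain ⟨u, hu, hpt, hlim⟩ := hv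
  have hp : 0 < α + 2 := by linarith
  have hD := tendsto_eLpNorm_weightedDeriv hα hlim
  have hmeas := fun n => (measurable_weightedDeriv α d (u n)).aestronglyMeasurable
    (μ := volume.restrict (Ioo (0 : ℝ) 1))
  -- Along a subsequence the derivatives converge almost everywhere. Fatou's lemma then handles the
  -- left side, and Minkowski's inequality bounds the energies of the approximants.
  obtain ⟨ns, hns, hae⟩ := (tendstoInMeasure_of_tendsto_eLpNorm
    (by simpa using hp) hmeas (measurable_weightedDeriv α d v).aestronglyMeasurable
    hD).exists_seq_tendsto_ae
  set F : (ℝ → ℝ) → ℝ → ℝ≥0∞ := fun f r => ENNReal.ofReal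
      (r ^ weightExp α d * piconeRemainder α (deriv f r) (logSlope α d φ Φ r * f r) +
        ν * (|f r| ^ (α + 2) * r ^ (weightExp α d - γ))) with hF
  have hFlim : ∀ᵐ r ∂volume.restrict (Ioo (0 : ℝ) 1),
      Tendsto (fun n => F (u (ns n)) r) atTop (𝓝 (F v r)) := by
    filter_upwards [hae, ae_restrict_mem measurableSet_Ioo] with r h1 hr
    have hr0 : r ^ (weightExp α d / (α + 2)) ≠ 0 := (Real.rpow_pos_of_pos hr.1 _).ne'
    have h2 : Tendsto (fun n => deriv (u (ns n)) r) atTop (𝓝 (deriv v r)) := by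
      have := h1.const_mul (r ^ (weightExp α d / (α + 2)))⁻¹
      simpa [weightedDeriv, inv_mul_cancel_left₀ hr0] using this
    have h3 : Tendsto (fun n => u (ns n) r) atTop (𝓝 (v r)) :=
      (hpt r hr).comp hns.tendsto_atTop
    refine ENNReal.tendsto_ofReal ?_
    have h4 := ((continuous_piconeRemainder hα).tendsto
      (deriv v r, logSlope α d φ Φ r * v r)).comp (h2.prodMk_nhds (h3.const_mul _))
    exact (h4.const_mul _).add
      (((h3.abs.rpow_const (Or.inr hp.le)).mul_const _).const_mul _)
  have hFm : ∀ n, AEMeasurable (F (u (ns n))) (volume.restrict (Ioo (0 : ℝ) 1)) := fun n => by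
    refine AEMeasurable.ennreal_ofReal ?_
    have hc : ContinuousOn (u (ns n)) (Ioo 0 1) := (hu _).1.continuousOn.mono Ioo_subset_Icc_self
    have hum := hc.aemeasurable (μ := volume) measurableSet_Ioo
    have hkm := (hφ.continuousOn_logSlope hα).aemeasurable (μ := volume) measurableSet_Ioo
    have hdm := (measurable_deriv (u (ns n))).aemeasurable
      (μ := volume.restrict (Ioo (0 : ℝ) 1))
    have hid : ∀ e : ℝ, AEMeasurable (fun r : ℝ => r ^ e) (volume.restrict (Ioo (0 : ℝ) 1)) :=
      fun e => (measurable_id.pow_const e).aemeasurable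
    have h1 := (continuous_piconeRemainder hα).measurable.comp_aemeasurable
      (hdm.prodMk (hkm.mul hum))
    have h2 : AEMeasurable (fun r => |u (ns n) r| ^ (α + 2)) (volume.restrict (Ioo (0 : ℝ) 1)) :=
      (measurable_id.abs.pow_const _).comp_aemeasurable hum
    exact ((hid _).mul h1).add ((h2.mul (hid _)).const_mul _)
  have hbound : Tendsto (fun n => (eLpNorm (weightedDeriv α d v) (ENNReal.ofReal (α + 2))
      (volume.restrict (Ioo 0 1)) + eLpNorm (weightedDeriv α d (u (ns n)) - weightedDeriv α d v)
      (ENNReal.ofReal (α + 2)) (volume.restrict (Ioo 0 1))) ^ (α + 2)) atTop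
      (𝓝 (∫⁻ r in Ioo (0 : ℝ) 1,
        ENNReal.ofReal (|deriv v r| ^ (α + 2) * r ^ weightExp α d))) := by
    rw [lintegral_weighted_eq hα d (deriv v)]
    have h1 := (hD.comp hns.tendsto_atTop).const_add (eLpNorm (weightedDeriv α d v)
      (ENNReal.ofReal (α + 2)) (volume.restrict (Ioo 0 1)))
    rw [add_zero] at h1
    exact ((ENNReal.continuous_rpow_const (y := α + 2)).tendsto _).comp h1
  calc ∫⁻ r in Ioo (0 : ℝ) 1, F v r
      = ∫⁻ r in Ioo (0 : ℝ) 1, liminf (fun n => F (u (ns n)) r) atTop := by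
        refine lintegral_congr_ae ?_
        filter_upwards [hFlim] with r hr using hr.liminf_eq.symm
    _ ≤ liminf (fun n => ∫⁻ r in Ioo (0 : ℝ) 1, F (u (ns n)) r) atTop := lintegral_liminf_le' hFm
    _ ≤ liminf (fun n => (eLpNorm (weightedDeriv α d v) (ENNReal.ofReal (α + 2))
      (volume.restrict (Ioo 0 1)) + eLpNorm (weightedDeriv α d (u (ns n)) - weightedDeriv α d v)
      (ENNReal.ofReal (α + 2)) (volume.restrict (Ioo 0 1))) ^ (α + 2)) atTop := by
        refine liminf_le_liminf (Eventually.of_forall fun n => ?_)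
        refine (hφ.picone_testFun hα (hu _)).trans ?_
        rw [lintegral_weighted_eq hα d]
        refine ENNReal.rpow_le_rpow ?_ hp.le
        have h1 := eLpNorm_add_le (p := ENNReal.ofReal (α + 2))
          (measurable_weightedDeriv α d v).aestronglyMeasurable
          ((hmeas (ns n)).sub (measurable_weightedDeriv α d v).aestronglyMeasurable)
          (by rw [ENNReal.one_le_ofReal]; linarith)
        rwa [add_sub_cancel] at h1
    _ = _ := hbound.liminf_eq

end MemH01

/-! ### Lower bound for the energy and the case of equality -/

section Minimizers

variable {α γ d ν : ℝ} {φ Φ v : ℝ → ℝ}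

/-- The integral of a nonintegrable function is 0 by convention, so the normalization to 1 already
contains integrability. -/
theorem integrableOn_of_mem_admissible (hv : v ∈ admissible α γ d) :
    IntegrableOn (fun r => |v r| ^ (α + 2) * r ^ (weightExp α d - γ)) (Ioo 0 1) := by
  by_contra hcon
  have := hv.2
  rw [integral_undef hcon] at this
  exact zero_ne_one this

theorem lintegral_eq_one_of_mem_admissible (hv : v ∈ admissible α γ d) :
    ∫⁻ r in Ioo (0 : ℝ) 1, ENNReal.ofReal (|v r| ^ (α + 2) * r ^ (weightExp α d - γ)) = 1 := by
  rw [← ofReal_integral_eq_lintegral_ofReal (integrableOn_of_mem_admissible hv), hv.2, ENNReal.ofReal_one]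
  filter_upwards [ae_restrict_mem measurableSet_Ioo] with r hr
  have := hr.1
  positivity

theorem MemH01.continuousOn (hα : -1 < α) (hd : 2 < d) (hv : MemH01 α d v) :
    ContinuousOn v (Ioo 0 1) := by
  intro x hx
  have ha : 0 < x / 2 := by linarith [hx.1]
  have hab : x / 2 ≤ (x + 1) / 2 := by linarith [hx.1]
  have hb : (x + 1) / 2 < 1 := by linarith [hx.2]
  have hint := (hv.sub_eq_integral hα hd ha hab hb).1
  have h1 := intervalIntegral.continuousOn_primitive_interval' hint (a := x / 2) left_mem_uIcc
  rw [uIcc_of_le hab] at h1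
  have h2 : ContinuousOn v (Icc (x / 2) ((x + 1) / 2)) := by
    refine (continuousOn_const (c := v (x / 2)).add h1).congr fun r hr => ?_
    have := (hv.sub_eq_integral hα hd ha hr.1 (hr.2.trans_lt hb)).2
    change v r = v (x / 2) + ∫ t in (x / 2)..r, deriv v t
    rw [← this]
    ring
  exact (h2.continuousAt (Icc_mem_nhds (by linarith [hx.1]) (by linarith [hx.2]))).continuousWithinAt

theorem picone_add (hα : -1 < α) (hφ : IsProfile α γ d 1 ν φ Φ)
    (hv : v ∈ admissible α γ d) :
    (∫⁻ r in Ioo (0 : ℝ) 1, ENNReal.ofReal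
      (r ^ weightExp α d * piconeRemainder α (deriv v r) (logSlope α d φ Φ r * v r))) +
        ENNReal.ofReal ν ≤
    ∫⁻ r in Ioo (0 : ℝ) 1, ENNReal.ofReal (|deriv v r| ^ (α + 2) * r ^ weightExp α d) := by
  have h1 := hv.1.picone hα hφ
  have hν := hφ.eigenvalue_pos.le
  have hint : AEMeasurable (fun r => ENNReal.ofReal
      (ν * (|v r| ^ (α + 2) * r ^ (weightExp α d - γ)))) (volume.restrict (Ioo (0 : ℝ) 1)) := by
    exact ((integrableOn_of_mem_admissible hv).aestronglyMeasurable.aemeasurable.const_mul ν).ennreal_ofReal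
  refine le_trans (le_of_eq ?_) h1
  rw [← mul_one (ENNReal.ofReal ν), ← lintegral_eq_one_of_mem_admissible hv,
    ← lintegral_const_mul' _ _ ENNReal.ofReal_ne_top]
  simp_rw [← ENNReal.ofReal_mul hν]
  rw [← lintegral_add_right' _ hint]
  refine setLIntegral_congr_fun measurableSet_Ioo fun r hr => ?_
  have hr0 := hr.1
  refine (ENNReal.ofReal_add ?_ (by positivity)).symm
  exact mul_nonneg (by positivity) (piconeRemainder_nonneg hα _ _)

theorem IsProfile.le_energy (hα : -1 < α) (hd : 2 < d) (hφ : IsProfile α γ d 1 ν φ Φ)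
    (hv : v ∈ admissible α γ d) : ν ≤ energy α d v := by
  have h1 := le_trans le_add_self (picone_add hα hφ hv)
  rw [← hv.1.energy_eq hα hd] at h1
  have h2 : 0 < energy α d v := by
    have := (ENNReal.ofReal_pos.2 hφ.eigenvalue_pos).trans_le h1
    exact ENNReal.ofReal_pos.1 this
  exact (ENNReal.ofReal_le_ofReal_iff h2.le).1 h1

/-- A positive function that realizes equality in Picone's inequality is a multiple of the
profile. -/
theorem IsProfile.eq_const_mul (hα : -1 < α) (hd : 2 < d) (hφ : IsProfile α γ d 1 ν φ Φ)
    (hv : v ∈ admissible α γ d) (he : energy α d v = ν) :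
    ∃ c, ∀ r ∈ Ioo (0 : ℝ) 1, v r = c * φ r := by
  have h1 := picone_add hα hφ hv
  rw [← hv.1.energy_eq hα hd, he] at h1
  have hvc := hv.1.continuousOn hα hd
  have hkc := hφ.continuousOn_logSlope hα
  -- If the energy equals ν, nothing is left for the remainder, so it vanishes almost everywhere and
  -- v' = -k v almost everywhere.
  have hzero : ∫⁻ r in Ioo (0 : ℝ) 1, ENNReal.ofReal
      (r ^ weightExp α d * piconeRemainder α (deriv v r) (logSlope α d φ Φ r * v r)) = 0 := by
    by_contra hne
    have := ENNReal.lt_add_right (a := ENNReal.ofReal ν) ENNReal.ofReal_ne_top hne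
    rw [add_comm] at this
    exact absurd h1 this.not_ge
  have hmeas : AEMeasurable (fun r => ENNReal.ofReal
      (r ^ weightExp α d * piconeRemainder α (deriv v r) (logSlope α d φ Φ r * v r)))
      (volume.restrict (Ioo (0 : ℝ) 1)) := by
    have hum := (hkc.mul hvc).aemeasurable (μ := volume) measurableSet_Ioo
    have hdm := (measurable_deriv v).aemeasurable (μ := volume.restrict (Ioo (0 : ℝ) 1))
    have h2 := (continuous_piconeRemainder hα).measurable.comp_aemeasurable (hdm.prodMk hum)
    exact (((measurable_id.pow_const _).aemeasurable).mul h2).ennreal_ofReal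
  rw [lintegral_eq_zero_iff' hmeas] at hzero
  have hae : ∀ᵐ r ∂volume.restrict (Ioo (0 : ℝ) 1),
      deriv v r = -(logSlope α d φ Φ r * v r) := by
    filter_upwards [hzero, ae_restrict_mem measurableSet_Ioo] with r h2 hr
    by_contra hne
    have h3 := mul_pos (Real.rpow_pos_of_pos hr.1 (weightExp α d)) (piconeRemainder_pos hα hne)
    exact (ENNReal.ofReal_pos.2 h3).ne' h2
  have hgc : ContinuousOn (fun r => -(logSlope α d φ Φ r * v r)) (Ioo 0 1) := (hkc.mul hvc).neg
  -- Since k v is continuous, the integral form of v' = -k v upgrades it to every point. Hence v/φ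
  -- has zero derivative.
  have hder : ∀ r ∈ Ioo (0 : ℝ) 1, HasDerivAt v (-(logSlope α d φ Φ r * v r)) r := by
    intro r hr
    have ha : 0 < r / 2 := by linarith [hr.1]
    have har : r / 2 < r := by linarith [hr.1]
    have heq : ∀ s ∈ Ioo (r / 2) 1, v s = v (r / 2) +
        ∫ t in (r / 2)..s, -(logSlope α d φ Φ t * v t) := fun s hs => by
      have h2 := (hv.1.sub_eq_integral hα hd ha hs.1.le hs.2).2
      have h3 : ∫ t in (r / 2)..s, deriv v t =
          ∫ t in (r / 2)..s, -(logSlope α d φ Φ t * v t) := by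
        rw [intervalIntegral.integral_of_le hs.1.le, intervalIntegral.integral_of_le hs.1.le]
        refine integral_congr_ae (ae_restrict_of_ae_restrict_of_subset ?_ hae)
        exact fun t ht => ⟨ha.trans ht.1, ht.2.trans_lt hs.2⟩
      linarith
    have h4 : HasDerivAt (fun s => v (r / 2) + ∫ t in (r / 2)..s, -(logSlope α d φ Φ t * v t))
        (-(logSlope α d φ Φ r * v r)) r := by
      refine (intervalIntegral.integral_hasDerivAt_right ?_
        (hgc.stronglyMeasurableAtFilter isOpen_Ioo r hr)
        (hgc.continuousAt (isOpen_Ioo.mem_nhds hr))).const_add _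
      exact (hgc.mono (ordConnected_Ioo.uIcc_subset ⟨ha, har.trans hr.2⟩ hr)).intervalIntegrable
    refine h4.congr_of_eventuallyEq ?_
    filter_upwards [Ioo_mem_nhds har hr.2] with s hs using heq s hs
  have hq : ∀ r ∈ Ioo (0 : ℝ) 1, HasDerivAt (fun s => v s / φ s) 0 r := fun r hr => by
    have hp := (hφ.pos r ⟨hr.1.le, hr.2⟩).ne'
    refine ((hder r hr).div (hφ.hasDerivAt' hr) hp).congr_deriv ?_
    rw [div_eq_zero_iff]
    left
    ring
  obtain ⟨c, hc⟩ := isOpen_Ioo.exists_is_const_of_deriv_eq_zero isPreconnected_Ioo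
    (fun r hr => (hq r hr).differentiableAt.differentiableWithinAt)
    (fun r hr => (hq r hr).deriv)
  refine ⟨c, fun r hr => ?_⟩
  rw [← hc r hr, div_mul_cancel₀ _ (hφ.pos r ⟨hr.1.le, hr.2⟩).ne']

/-! ### Approximation by test functions -/

/-- A smooth cutoff that vanishes near `0` and `1`. -/
noncomputable def cutoff (n : ℕ) (r : ℝ) : ℝ :=
  Real.smoothTransition ((n + 2) * r - 1) * Real.smoothTransition ((n + 2) * (1 - r) - 1)

theorem contDiff_cutoff (n : ℕ) : ContDiff ℝ 1 (cutoff n) := by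
  have h : ContDiff ℝ 1 Real.smoothTransition := Real.smoothTransition.contDiff
  exact (h.comp (by fun_prop)).mul (h.comp (by fun_prop))

theorem cutoff_eq_zero {n : ℕ} {r : ℝ} (h : r ≤ 1 / (n + 2) ∨ 1 - 1 / (n + 2) ≤ r) :
    cutoff n r = 0 := by
  have hn : (0 : ℝ) < n + 2 := by positivity
  rcases h with h | h
  · rw [le_div_iff₀ hn] at h
    rw [cutoff, Real.smoothTransition.zero_of_nonpos (by linarith), zero_mul]
  · have h' : 1 - r ≤ 1 / (n + 2) := by linarith
    rw [le_div_iff₀ hn] at h'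
    rw [cutoff, Real.smoothTransition.zero_of_nonpos (x := (n + 2) * (1 - r) - 1) (by linarith),
      mul_zero]

theorem cutoff_nonneg (n : ℕ) (r : ℝ) : 0 ≤ cutoff n r :=
  mul_nonneg (Real.smoothTransition.nonneg _) (Real.smoothTransition.nonneg _)

theorem cutoff_le_one (n : ℕ) (r : ℝ) : cutoff n r ≤ 1 :=
  mul_le_one₀ (Real.smoothTransition.le_one _) (Real.smoothTransition.nonneg _)
    (Real.smoothTransition.le_one _)

theorem tendsto_cutoff {r : ℝ} (hr : r ∈ Ioo (0 : ℝ) 1) :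
    Tendsto (fun n => cutoff n r) atTop (𝓝 1) := by
  refine tendsto_const_nhds.congr' ?_
  have h1 : ∀ x : ℝ, 0 < x → ∀ᶠ n : ℕ in atTop, 1 ≤ ((n : ℝ) + 2) * x - 1 := fun x hx => by
    have : Tendsto (fun n : ℕ => ((n : ℝ) + 2) * x - 1) atTop atTop :=
      tendsto_atTop_add_const_right _ _
        ((tendsto_atTop_add_const_right _ _ tendsto_natCast_atTop_atTop).atTop_mul_const hx)
    exact this.eventually_ge_atTop 1
  filter_upwards [h1 r hr.1, h1 (1 - r) (by linarith [hr.2])] with n h2 h3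
  rw [cutoff, Real.smoothTransition.one_of_one_le h2, Real.smoothTransition.one_of_one_le h3,
    mul_one]

theorem contDiff_cutoff_mul {f : ℝ → ℝ} (hf : ContDiffOn ℝ 1 f (Ioo 0 1)) (n : ℕ) :
    ContDiff ℝ 1 (fun r => cutoff n r * f r) := by
  refine contDiff_iff_contDiffAt.2 fun r => ?_
  have hn : (0 : ℝ) < 1 / (n + 2) := by positivity
  by_cases hr : r ∈ Ioo (0 : ℝ) 1
  · exact (contDiff_cutoff n).contDiffAt.mul (hf.contDiffAt (isOpen_Ioo.mem_nhds hr))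
  · have h0 : (fun r => cutoff n r * f r) =ᶠ[𝓝 r] fun _ => 0 := by
      rcases le_or_gt r 0 with h | h
      · filter_upwards [Iio_mem_nhds (h.trans_lt hn)] with s hs
        rw [cutoff_eq_zero (Or.inl (le_of_lt hs)), zero_mul]
      · have h2 : 1 ≤ r := by
          by_contra! hlt
          exact hr ⟨h, hlt⟩
        filter_upwards [Ioi_mem_nhds (show 1 - 1 / ((n : ℝ) + 2) < r by linarith)] with s hs
        rw [cutoff_eq_zero (Or.inr (le_of_lt hs)), zero_mul]
    exact contDiffAt_const.congr_of_eventuallyEq h0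

/-- A `C²` function on `(0,1)` with integrable derivative and finite energy that vanishes at `1`
belongs to `𝓗₀¹`. -/
theorem memH01_of_contDiffOn (hα : -1 < α) {v1 : ℝ → ℝ}
    (hv : ∀ r ∈ Ioo (0 : ℝ) 1, HasDerivAt v (v1 r) r) (hv1 : ContDiffOn ℝ 1 v1 (Ioo 0 1))
    (hint : IntervalIntegrable v1 volume 0 1) (hend : Tendsto v (𝓝[<] 1) (𝓝 0))
    (hen : ∫⁻ r in Ioo (0 : ℝ) 1, ENNReal.ofReal (|v1 r| ^ (α + 2) * r ^ weightExp α d) ≠ ∞) :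
    MemH01 α d v := by
  have hp : 0 < α + 2 := by linarith
  -- The derivative, not v, is cut off, and then integrated back from 1. The approximants are C²
  -- with zero slope at 0 and vanish near 1, and no derivative of the cutoff has to be estimated.
  set g : ℕ → ℝ → ℝ := fun n r => cutoff n r * v1 r with hg
  have hgc : ∀ n, ContDiff ℝ 1 (g n) := contDiff_cutoff_mul hv1
  set u : ℕ → ℝ → ℝ := fun n r => ∫ s in (1 : ℝ)..r, g n s with hu
  have hud : ∀ n r, HasDerivAt (u n) (g n r) r := fun n r =>
    (hgc n).continuous.integral_hasStrictDerivAt 1 r |>.hasDerivAt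
  have hudv : ∀ n, deriv (u n) = g n := fun n => funext fun r => (hud n r).deriv
  have hmeas1 : AEMeasurable v1 (volume.restrict (Ioo (0 : ℝ) 1)) :=
    hv1.continuousOn.aemeasurable measurableSet_Ioo
  -- With n + 2 rather than n + 1 this endpoint lies in (0,1) even for n = 0.
  refine ⟨u, fun n => ⟨?_, ?_, 1 - 1 / (n + 2), ?_, fun r hr => ?_⟩, fun r hr => ?_, ?_⟩
  · refine ContDiff.contDiffOn ?_
    rw [show (2 : WithTop ℕ∞) = 1 + 1 by norm_num, contDiff_succ_iff_deriv]
    refine ⟨fun r => (hud n r).differentiableAt, by simp, ?_⟩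
    rw [hudv]
    exact hgc n
  · rw [(hud n 0).hasDerivWithinAt.derivWithin
      (uniqueDiffOn_Icc zero_lt_one 0 ⟨le_rfl, zero_le_one⟩)]
    simp only [hg]
    rw [cutoff_eq_zero (Or.inl (by positivity)), zero_mul]
  · have h1 : (0 : ℝ) < 1 / (n + 2) := by positivity
    have h2 : 1 / ((n : ℝ) + 2) < 1 := by
      rw [div_lt_one (by positivity)]
      have : (0 : ℝ) ≤ n := by positivity
      linarith
    exact ⟨by linarith, by linarith⟩
  · refine intervalIntegral.integral_zero_ae ?_
    refine Eventually.of_forall fun s hs => ?_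
    rw [uIoc_of_ge hr.2] at hs
    simp only [hg]
    rw [cutoff_eq_zero (Or.inr (hr.1.trans hs.1.le)), zero_mul]
  · have hsub : IntervalIntegrable v1 volume r 1 := by
      refine hint.mono_set ?_
      rw [uIcc_of_le hr.2.le, uIcc_of_le zero_le_one]
      exact Icc_subset_Icc_left hr.1.le
    have hFTC : ∫ s in r..1, v1 s = 0 - v r := by
      refine intervalIntegral.integral_eq_sub_of_hasDerivAt_of_tendsto hr.2
        (fun s hs => hv s ⟨hr.1.trans hs.1, hs.2⟩) hsub ?_ hend
      exact ((hv r hr).continuousAt.tendsto).mono_left nhdsWithin_le_nhds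
    have hlim : Tendsto (fun n => ∫ s in r..1, g n s) atTop (𝓝 (∫ s in r..1, v1 s)) := by
      refine intervalIntegral.tendsto_integral_filter_of_dominated_convergence (fun s => |v1 s|)
        (Eventually.of_forall fun n => (hgc n).continuous.aestronglyMeasurable)
        (Eventually.of_forall fun n => Eventually.of_forall fun s _ => ?_) hsub.abs ?_
      · rw [norm_mul, Real.norm_of_nonneg (cutoff_nonneg n s), Real.norm_eq_abs]
        exact mul_le_of_le_one_left (abs_nonneg _) (cutoff_le_one n s)
      · have h1 : ∀ᵐ s : ℝ, s ≠ 1 := by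
          simp [ae_iff]
        filter_upwards [h1] with s hs1 hs
        rw [uIoc_of_le hr.2.le] at hs
        have := (tendsto_cutoff ⟨hr.1.trans hs.1, lt_of_le_of_ne hs.2 hs1⟩).mul_const (v1 s)
        rwa [one_mul] at this
    have h2 : ∀ n, u n r = -∫ s in r..1, g n s := fun n => intervalIntegral.integral_symm _ _
    simp_rw [h2]
    rw [hFTC] at hlim
    simpa using hlim.neg
  · have h0 : ∫⁻ r in Ioo (0 : ℝ) 1, (0 : ℝ≥0∞) = 0 := lintegral_zero
    rw [← h0]
    refine tendsto_lintegral_of_dominated_convergence' (fun r =>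
      ENNReal.ofReal (|v1 r| ^ (α + 2) * r ^ weightExp α d)) (fun n => ?_) (fun n => ?_) hen ?_
    · have h1 : Measurable fun r => |deriv (u n) r - deriv v r| ^ (α + 2) :=
        ((measurable_deriv _).sub (measurable_deriv _)).abs.pow_const _
      exact (h1.mul (measurable_id.pow_const _)).ennreal_ofReal.aemeasurable
    · filter_upwards [ae_restrict_mem measurableSet_Ioo] with r hr
      refine ENNReal.ofReal_le_ofReal ?_
      refine mul_le_mul_of_nonneg_right ?_ (Real.rpow_nonneg hr.1.le _)
      refine Real.rpow_le_rpow (abs_nonneg _) ?_ hp.le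
      rw [hudv, (hv r hr).deriv, show g n r - v1 r = (cutoff n r - 1) * v1 r by
        simp only [hg]; ring, abs_mul]
      refine mul_le_of_le_one_left (abs_nonneg _) ?_
      rw [abs_le]
      exact ⟨by linarith [cutoff_nonneg n r], by linarith [cutoff_le_one n r]⟩
    · filter_upwards [ae_restrict_mem measurableSet_Ioo] with r hr
      have h1 : Tendsto (fun n => deriv (u n) r - deriv v r) atTop (𝓝 0) := by
        have := ((tendsto_cutoff hr).mul_const (v1 r)).sub_const (v1 r)
        simp only [one_mul, sub_self] at this
        refine this.congr fun n => ?_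
        rw [hudv, (hv r hr).deriv]
      have h2 := ((h1.abs.rpow_const (Or.inr hp.le)).mul_const (r ^ weightExp α d))
      have h3 := ENNReal.tendsto_ofReal h2
      simpa [Real.zero_rpow hp.ne'] using h3

end Minimizers

/-! ### The profile as a minimizer -/

namespace IsProfile

variable {α γ d ν : ℝ} {φ Φ : ℝ → ℝ}

theorem contDiffOn_deriv (h : IsProfile α γ d 1 ν φ Φ) :
    ContDiffOn ℝ 1 (fun r => -(r ^ (-weightExp α d) * Φ r) ^ (1 / (1 + α))) (Ioo 0 1) := by
  have hpow : ∀ e : ℝ, ContinuousOn (fun r : ℝ => r ^ e) (Ioo 0 1) := fun e =>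
    continuousOn_id.rpow_const fun r hr => Or.inl hr.1.ne'
  have hφc : ContinuousOn φ (Ioo 0 1) := h.continuousOn.mono Ioo_subset_Icc_self
  have hΦc : ContinuousOn Φ (Ioo 0 1) := h.flux_continuousOn.mono Ioo_subset_Ico_self
  have hX : ContDiffOn ℝ 1 (fun r => r ^ (-weightExp α d) * Φ r) (Ioo 0 1) := by
    rw [show (1 : WithTop ℕ∞) = 0 + 1 by norm_num, contDiffOn_succ_iff_deriv_of_isOpen isOpen_Ioo]
    refine ⟨fun r hr => (h.hasDerivAt_slope hr).differentiableAt.differentiableWithinAt, by simp, ?_⟩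
    rw [contDiffOn_zero]
    refine ContinuousOn.congr (f := fun r => ν * (φ r ^ (1 + α) / r ^ γ) -
      weightExp α d * (r ^ (-weightExp α d) * Φ r) / r) ?_ fun r hr => (h.hasDerivAt_slope hr).deriv
    refine (continuousOn_const.mul (ContinuousOn.div ?_ (hpow γ) fun r hr =>
      (Real.rpow_pos_of_pos hr.1 _).ne')).sub
      (((continuousOn_const.mul ((hpow _).mul hΦc))).div continuousOn_id fun r hr => hr.1.ne')
    exact hφc.rpow_const fun r hr => Or.inl (h.pos r ⟨hr.1.le, hr.2⟩).ne'
  exact (hX.rpow_const_of_ne fun r hr => (h.slope_pos hr).ne').neg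

theorem tendsto_one (h : IsProfile α γ d 1 ν φ Φ) : Tendsto φ (𝓝[<] 1) (𝓝 0) := by
  have h2 : Tendsto φ (𝓝[Icc 0 1] 1) (𝓝 (φ 1)) := h.continuousOn 1 ⟨zero_le_one, le_rfl⟩
  rw [h.apply_radius] at h2
  refine h2.mono_left ?_
  rw [← nhdsWithin_Ioo_eq_nhdsLT zero_lt_one]
  exact nhdsWithin_mono _ Ioo_subset_Icc_self

theorem flux_le_const (hα : -1 < α) (hγα : γ < 2 + α) (hd : 2 < d)
    (h : IsProfile α γ d 1 ν φ Φ) {r : ℝ} (hr : r ∈ Ioo (0 : ℝ) 1) :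
    Φ r ≤ ν / (weightExp α d - γ + 1) := by
  have ha : 0 < weightExp α d - γ + 1 := by linarith [weightExp_sub_gt hα hγα hd]
  refine (h.flux_le hα hγα hd ⟨hr.1.le, hr.2⟩).trans ?_
  rw [← mul_div_assoc]
  refine div_le_div_of_nonneg_right ?_ ha.le
  exact mul_le_of_le_one_right h.eigenvalue_pos.le (Real.rpow_le_one hr.1.le hr.2.le ha.le)

/-- -φ is continuous on [0,1] with nonnegative derivative inside, which makes the derivative
integrable without any estimate at the endpoints. -/
theorem intervalIntegrable_deriv (h : IsProfile α γ d 1 ν φ Φ) :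
    IntervalIntegrable (fun r => (r ^ (-weightExp α d) * Φ r) ^ (1 / (1 + α))) volume 0 1 := by
  rw [intervalIntegrable_iff_integrableOn_Ioc_of_le zero_le_one]
  refine intervalIntegral.integrableOn_deriv_of_nonneg (g := fun r => -φ r) h.continuousOn.neg
    (fun r hr => ?_) fun r hr => (Real.rpow_pos_of_pos (h.slope_pos hr) _).le
  have := (h.hasDerivAt r hr).fun_neg
  rwa [neg_neg] at this

theorem energyDensity_eq (hα : -1 < α) (h : IsProfile α γ d 1 ν φ Φ) {r : ℝ}
    (hr : r ∈ Ioo (0 : ℝ) 1) :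
    |-(r ^ (-weightExp α d) * Φ r) ^ (1 / (1 + α))| ^ (α + 2) * r ^ weightExp α d =
      Φ r * (r ^ (-weightExp α d) * Φ r) ^ (1 / (1 + α)) := by
  have h1 : 0 < 1 + α := by linarith
  have hX := h.slope_pos hr
  have hw : r ^ (-weightExp α d) * r ^ weightExp α d = 1 := by
    rw [← Real.rpow_add hr.1, neg_add_cancel, Real.rpow_zero]
  rw [abs_neg, abs_of_pos (Real.rpow_pos_of_pos hX _), ← Real.rpow_mul hX.le,
    show 1 / (1 + α) * (α + 2) = 1 / (1 + α) + 1 by field_simp; ring, Real.rpow_add_one hX.ne']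
  linear_combination ((r ^ (-weightExp α d) * Φ r) ^ (1 / (1 + α)) * Φ r) * hw

theorem intervalIntegrable_energyDensity (hα : -1 < α) (hγα : γ < 2 + α) (hd : 2 < d)
    (h : IsProfile α γ d 1 ν φ Φ) :
    IntervalIntegrable (fun r => Φ r * (r ^ (-weightExp α d) * Φ r) ^ (1 / (1 + α))) volume 0 1 := by
  have hc := h.intervalIntegrable_deriv
  rw [intervalIntegrable_iff_integrableOn_Ioo_of_le zero_le_one] at hc ⊢
  have hΦm : AEStronglyMeasurable Φ (volume.restrict (Ioo (0 : ℝ) 1)) :=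
    (h.flux_continuousOn.mono Ioo_subset_Ico_self).aestronglyMeasurable measurableSet_Ioo
  refine hc.bdd_mul (c := ν / (weightExp α d - γ + 1)) hΦm ?_
  filter_upwards [ae_restrict_mem measurableSet_Ioo] with r hr
  rw [Real.norm_of_nonneg (h.flux_pos hr).le]
  exact h.flux_le_const hα hγα hd hr

theorem intervalIntegrable_potential (hα : -1 < α) (hγα : γ < 2 + α) (hd : 2 < d)
    (h : IsProfile α γ d 1 ν φ Φ) :
    IntervalIntegrable (fun r => φ r ^ (α + 2) * r ^ (weightExp α d - γ)) volume 0 1 := by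
  have hc : IntervalIntegrable (fun r : ℝ => r ^ (weightExp α d - γ)) volume 0 1 :=
    intervalIntegral.intervalIntegrable_rpow' (weightExp_sub_gt hα hγα hd)
  rw [intervalIntegrable_iff_integrableOn_Ioo_of_le zero_le_one] at hc ⊢
  have hφc : ContinuousOn (fun r => φ r ^ (α + 2)) (Ioo 0 1) :=
    (h.continuousOn.mono Ioo_subset_Icc_self).rpow_const fun _ _ => Or.inr (by linarith)
  refine hc.bdd_mul (c := 1) (hφc.aestronglyMeasurable measurableSet_Ioo) ?_
  filter_upwards [ae_restrict_mem measurableSet_Ioo] with r hr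
  have hp := (h.pos r ⟨hr.1.le, hr.2⟩).le
  rw [Real.norm_of_nonneg (Real.rpow_nonneg hp _)]
  exact Real.rpow_le_one hp (h.le_one (Ioo_subset_Icc_self hr)) (by linarith)

/-- Integrate the derivative of φΦ. The boundary terms vanish: at 0 because Φ(0) = 0, at 1 because φ
→ 0 and Φ is bounded. -/
theorem integral_energyDensity (hα : -1 < α) (hγα : γ < 2 + α) (hd : 2 < d)
    (h : IsProfile α γ d 1 ν φ Φ) :
    ∫ r in (0 : ℝ)..1, Φ r * (r ^ (-weightExp α d) * Φ r) ^ (1 / (1 + α)) =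
      ν * ∫ r in (0 : ℝ)..1, φ r ^ (α + 2) * r ^ (weightExp α d - γ) := by
  have hE := h.intervalIntegrable_energyDensity hα hγα hd
  have hP := (h.intervalIntegrable_potential hα hγα hd).const_mul ν
  have hder : ∀ r ∈ Ioo (0 : ℝ) 1, HasDerivAt (fun s => φ s * Φ s)
      (ν * (φ r ^ (α + 2) * r ^ (weightExp α d - γ)) -
        Φ r * (r ^ (-weightExp α d) * Φ r) ^ (1 / (1 + α))) r := fun r hr => by
    refine ((h.hasDerivAt r hr).mul (h.flux_hasDerivAt r hr)).congr_deriv ?_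
    rw [show α + 2 = 1 + α + 1 by ring, Real.rpow_add_one (h.pos r ⟨hr.1.le, hr.2⟩).ne']
    ring
  have hlim0 : Tendsto (fun s => φ s * Φ s) (𝓝[>] 0) (𝓝 0) := by
    have h1 : ContinuousOn (fun s => φ s * Φ s) (Ico 0 1) :=
      (h.continuousOn.mono Ico_subset_Icc_self).mul h.flux_continuousOn
    have h2 : Tendsto (fun s => φ s * Φ s) (𝓝[Ico 0 1] 0) (𝓝 (φ 0 * Φ 0)) :=
      h1 0 ⟨le_rfl, zero_lt_one⟩
    rw [h.flux_zero, mul_zero] at h2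
    refine h2.mono_left ?_
    rw [← nhdsWithin_Ioo_eq_nhdsGT zero_lt_one]
    exact nhdsWithin_mono _ Ioo_subset_Ico_self
  have hlim1 : Tendsto (fun s => φ s * Φ s) (𝓝[<] 1) (𝓝 0) := by
    have h1 := h.tendsto_one.mul_const (ν / (weightExp α d - γ + 1))
    rw [zero_mul] at h1
    refine squeeze_zero' ?_ ?_ h1
    · filter_upwards [Ioo_mem_nhdsLT (zero_lt_one (α := ℝ))] with r hr using
        mul_nonneg (h.pos r ⟨hr.1.le, hr.2⟩).le (h.flux_pos hr).le
    · filter_upwards [Ioo_mem_nhdsLT (zero_lt_one (α := ℝ))] with r hr using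
        mul_le_mul_of_nonneg_left (h.flux_le_const hα hγα hd hr) (h.pos r ⟨hr.1.le, hr.2⟩).le
  have := intervalIntegral.integral_eq_sub_of_hasDerivAt_of_tendsto zero_lt_one hder (hP.sub hE)
    hlim0 hlim1
  rw [intervalIntegral.integral_sub hP hE, intervalIntegral.integral_const_mul] at this
  linarith

theorem integral_potential_pos (hα : -1 < α) (hγα : γ < 2 + α) (hd : 2 < d)
    (h : IsProfile α γ d 1 ν φ Φ) :
    0 < ∫ r in (0 : ℝ)..1, φ r ^ (α + 2) * r ^ (weightExp α d - γ) :=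
  intervalIntegral.intervalIntegral_pos_of_pos_on (h.intervalIntegrable_potential hα hγα hd)
    (fun r hr => mul_pos (Real.rpow_pos_of_pos (h.pos r ⟨hr.1.le, hr.2⟩) _)
      (Real.rpow_pos_of_pos hr.1 _)) zero_lt_one

theorem memH01_const_mul (hα : -1 < α) (hγα : γ < 2 + α) (hd : 2 < d)
    (h : IsProfile α γ d 1 ν φ Φ) (c : ℝ) : MemH01 α d (fun r => c * φ r) := by
  refine memH01_of_contDiffOn hα (fun r hr => (h.hasDerivAt r hr).const_mul c)
    (contDiffOn_const.mul h.contDiffOn_deriv) (h.intervalIntegrable_deriv.neg.const_mul c) ?_ ?_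
  · simpa using h.tendsto_one.const_mul c
  · have hE := (h.intervalIntegrable_energyDensity hα hγα hd).const_mul (|c| ^ (α + 2))
    rw [intervalIntegrable_iff_integrableOn_Ioo_of_le zero_le_one] at hE
    refine ne_of_lt (lt_of_le_of_lt (lintegral_mono_ae ?_) hE.2)
    filter_upwards [ae_restrict_mem measurableSet_Ioo] with r hr
    rw [← ofReal_norm]
    refine ENNReal.ofReal_le_ofReal ((le_of_eq ?_).trans (Real.le_norm_self _))
    rw [abs_mul, Real.mul_rpow (abs_nonneg _) (abs_nonneg _), mul_assoc, h.energyDensity_eq hα hr]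

theorem energy_const_mul (hα : -1 < α) (hγα : γ < 2 + α) (hd : 2 < d)
    (h : IsProfile α γ d 1 ν φ Φ) (c : ℝ) :
    energy α d (fun r => c * φ r) =
      |c| ^ (α + 2) * (ν * ∫ r in (0 : ℝ)..1, φ r ^ (α + 2) * r ^ (weightExp α d - γ)) := by
  rw [← h.integral_energyDensity hα hγα hd, ← intervalIntegral.integral_const_mul,
    intervalIntegral.integral_of_le zero_le_one, integral_Ioc_eq_integral_Ioo, energy]
  refine setIntegral_congr_fun measurableSet_Ioo fun r hr => ?_
  simp only [((h.hasDerivAt r hr).const_mul c).deriv]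
  rw [abs_mul, Real.mul_rpow (abs_nonneg _) (abs_nonneg _), mul_assoc, h.energyDensity_eq hα hr]

theorem exists_minimizer (hα : -1 < α) (hγα : γ < 2 + α) (hd : 2 < d)
    (h : IsProfile α γ d 1 ν φ Φ) :
    ∃ c > 0, (fun r => c * φ r) ∈ admissible α γ d ∧ energy α d (fun r => c * φ r) = ν := by
  have hp : 0 < α + 2 := by linarith
  have hJ := h.integral_potential_pos hα hγα hd
  set J := ∫ r in (0 : ℝ)..1, φ r ^ (α + 2) * r ^ (weightExp α d - γ) with hJdef
  -- The constant J^(-1/(α+2)) normalizes the potential integral J of φ to 1, by homogeneity of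
  -- degree α + 2.
  have hc0 : 0 < (J ^ (1 / (α + 2)))⁻¹ := inv_pos.2 (Real.rpow_pos_of_pos hJ _)
  have hcJ : |(J ^ (1 / (α + 2)))⁻¹| ^ (α + 2) = J⁻¹ := by
    rw [abs_of_pos hc0, Real.inv_rpow (Real.rpow_nonneg hJ.le _), ← Real.rpow_mul hJ.le,
      one_div_mul_cancel hp.ne', Real.rpow_one]
  refine ⟨(J ^ (1 / (α + 2)))⁻¹, hc0, ⟨h.memH01_const_mul hα hγα hd _, ?_⟩, ?_⟩
  · have h1 : ∫ r in Ioo (0 : ℝ) 1, |(J ^ (1 / (α + 2)))⁻¹ * φ r| ^ (α + 2) *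
        r ^ (weightExp α d - γ) = J⁻¹ * J := by
      have hJ' : J = ∫ r in Ioo (0 : ℝ) 1, φ r ^ (α + 2) * r ^ (weightExp α d - γ) := by
        rw [hJdef, intervalIntegral.integral_of_le zero_le_one, integral_Ioc_eq_integral_Ioo]
      calc _ = ∫ r in Ioo (0 : ℝ) 1, J⁻¹ * (φ r ^ (α + 2) * r ^ (weightExp α d - γ)) :=
            setIntegral_congr_fun measurableSet_Ioo fun r hr => by
              rw [abs_mul, Real.mul_rpow (abs_nonneg _) (abs_nonneg _), hcJ,
                abs_of_pos (h.pos r ⟨hr.1.le, hr.2⟩), mul_assoc]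
        _ = J⁻¹ * ∫ r in Ioo (0 : ℝ) 1, φ r ^ (α + 2) * r ^ (weightExp α d - γ) :=
            integral_const_mul _ _
        _ = J⁻¹ * J := by rw [← hJ']
    rw [h1, inv_mul_cancel₀ hJ.ne']
  · rw [h.energy_const_mul hα hγα hd, hcJ, ← hJdef]
    field_simp

theorem varEigenvalue_eq (hα : -1 < α) (hγα : γ < 2 + α) (hd : 2 < d)
    (h : IsProfile α γ d 1 ν φ Φ) : varEigenvalue α γ d = ν := by
  obtain ⟨c, -, hc, hE⟩ := h.exists_minimizer hα hγα hd
  refine IsLeast.csInf_eq ⟨⟨_, hc, hE⟩, ?_⟩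
  rintro _ ⟨v, hv, rfl⟩
  exact h.le_energy hα hd hv

end IsProfile

/-! ### Both eigenvalues from one profile -/

theorem exists_isProfile {α γ d : ℝ} (hα : -1 < α) (hγα : γ < 2 + α) (hd : 2 < d) :
    ∃ ν φ Φ, IsProfile α γ d 1 ν φ Φ := by
  obtain ⟨R, φ, Φ, h⟩ := exists_isProfile_one (α := α) (γ := γ) (d := d) hα hγα hd
  have := h.rescale hα (inv_pos.2 h.radius_pos)
  rw [inv_mul_cancel₀ h.radius_pos.ne'] at this
  exact ⟨_, _, _, this⟩

theorem IsProfile.isGreatest_eigenvalueSet {N : ℕ} {l L α γ d ν : ℝ} {φ Φ : ℝ → ℝ} (hl : 0 < l)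
    (hlL : l ≤ L) (hN : 3 ≤ N) (hα : -1 < α) (hγ : 1 < γ) (hγα : γ < 2 + α) (hd : 2 < d)
    (hdN : l * ((N : ℝ) - 1) = L * (d - 1)) (hφ : IsProfile α γ d 1 ν φ Φ) :
    IsGreatest (eigenvalueSet N α γ (pucciSup l L)) (L / (1 + α) * ν) := by
  refine ⟨hφ.mem_eigenvalueSet hl hlL hα hγ hγα hd hdN, ?_⟩
  rintro μ ⟨u, hc, hpos, hrad, hu⟩
  rcases le_or_gt μ 0 with hμ | hμ
  · have h1 : 0 < 1 + α := by linarith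
    have := hφ.eigenvalue_pos
    have : 0 < L := hl.trans_le hlL
    exact hμ.trans (by positivity)
  · obtain ⟨U, hU⟩ := hu.exists_radial (by omega) hlL hμ hc hpos hrad
    exact hU.eigenvalue_le hμ hl hlL hN hα hd hdN hφ

/-- For v = cφ, |v'|^α v' is -c^(1+α) |φ'|^(1+α), so its strict monotonicity is that of the slope in
`deriv_slope_neg`. -/
theorem IsProfile.properties_const_mul {α γ d ν c : ℝ} {φ Φ v : ℝ → ℝ} (hα : -1 < α) (hγ : 1 < γ)
    (hγα : γ < 2 + α) (hd : 2 < d) (hφ : IsProfile α γ d 1 ν φ Φ) (hc : 0 < c)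
    (hv : ∀ r ∈ Ioo (0 : ℝ) 1, v r = c * φ r) :
    (∃ C : ℝ, ∀ r ∈ Ioo (0 : ℝ) 1, |v r| ≤ C) ∧
      (∀ r ∈ Ioo (0 : ℝ) 1, deriv v r < 0) ∧
      (∀ r ∈ Ioo (0 : ℝ) 1, 0 < deriv (fun s => |deriv v s| ^ α * deriv v s) r) := by
  have hder : ∀ r ∈ Ioo (0 : ℝ) 1,
      deriv v r = c * -(r ^ (-weightExp α d) * Φ r) ^ (1 / (1 + α)) := fun r hr => by
    have h1 : v =ᶠ[𝓝 r] fun s => c * φ s := by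
      filter_upwards [isOpen_Ioo.mem_nhds hr] with s hs using hv s hs
    rw [h1.deriv_eq, ((hφ.hasDerivAt r hr).const_mul c).deriv]
  refine ⟨⟨c, fun r hr => ?_⟩, fun r hr => ?_, fun r hr => ?_⟩
  · have h1 := hφ.pos r ⟨hr.1.le, hr.2⟩
    rw [hv r hr, abs_of_pos (mul_pos hc h1)]
    exact mul_le_of_le_one_right hc.le (hφ.le_one (Ioo_subset_Icc_self hr))
  · rw [hder r hr]
    exact mul_neg_of_pos_of_neg hc (neg_neg_of_pos (Real.rpow_pos_of_pos (hφ.slope_pos hr) _))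
  · have h1 : (fun s => |deriv v s| ^ α * deriv v s) =ᶠ[𝓝 r]
        fun s => -(c ^ α * c) * (s ^ (-weightExp α d) * Φ s) := by
      filter_upwards [isOpen_Ioo.mem_nhds hr] with s hs
      rw [hder s hs, abs_mul, abs_of_pos hc, Real.mul_rpow hc.le (abs_nonneg _)]
      linear_combination (c ^ α * c) * abs_neg_rpow_inv_rpow_mul_self hα (hφ.slope_pos hs)
    rw [h1.deriv_eq, ((hφ.hasDerivAt_slope hr).const_mul _).deriv]
    have h2 : 0 < c ^ α * c := mul_pos (Real.rpow_pos_of_pos hc _) hc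
    exact mul_pos_of_neg_of_neg (neg_neg_of_pos h2) (hφ.deriv_slope_neg hα hγ hγα hd hr)

theorem mainTheorem5 (N : ℕ) (l L : ℝ) (hl : 0 < l) (hlL : l ≤ L)
    (hN : 2 < dimPlus N l L)
    (α γ : ℝ) (hα : -1 < α) (hγ : 1 < γ) (hγα : γ < 2 + α) :
    ((eigenvalueSet N α γ (pucciSup l L)).Nonempty ∧
      BddAbove (eigenvalueSet N α γ (pucciSup l L)) ∧
      radialEigenvalue N α γ (pucciSup l L)
        = L / (α + 1) * varEigenvalue α γ (dimPlus N l L)) ∧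
    (∃ v : ℝ → ℝ, IsPositiveMinimizer α γ (dimPlus N l L) v) ∧
    (∀ v : ℝ → ℝ, IsPositiveMinimizer α γ (dimPlus N l L) v →
      (∃ C : ℝ, ∀ r ∈ Ioo (0 : ℝ) 1, |v r| ≤ C) ∧
      (∀ r ∈ Ioo (0 : ℝ) 1, deriv v r < 0) ∧
      (∀ r ∈ Ioo (0 : ℝ) 1, 0 < deriv (fun s => |deriv v s| ^ α * deriv v s) r)) := by
  have hL : 0 < L := hl.trans_le hlL
  have hdN : l * ((N : ℝ) - 1) = L * (dimPlus N l L - 1) := by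
    rw [dimPlus]
    field_simp
    ring
  -- For N ≤ 2 and l ≤ L the dimension-like parameter would be at most 2.
  have hN3 : 3 ≤ N := by
    by_contra! hlt
    have h1 : (N : ℝ) ≤ 2 := by exact_mod_cast Nat.lt_succ_iff.1 hlt
    nlinarith
  obtain ⟨ν, φ, Φ, hφ⟩ := exists_isProfile (α := α) (γ := γ) hα hγα hN
  have hvar := hφ.varEigenvalue_eq hα hγα hN
  have hgreat := hφ.isGreatest_eigenvalueSet hl hlL hN3 hα hγ hγα hN hdN
  refine ⟨⟨hgreat.nonempty, hgreat.bddAbove, ?_⟩, ?_, fun v hv => ?_⟩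
  · rw [radialEigenvalue, hgreat.csSup_eq, hvar, add_comm]
  · obtain ⟨c, hc, hmem, hE⟩ := hφ.exists_minimizer hα hγα hN
    exact ⟨_, hmem, hE.trans hvar.symm, fun r hr => mul_pos hc (hφ.pos r ⟨hr.1.le, hr.2⟩)⟩
  · obtain ⟨hmem, hE, hpos⟩ := hv
    obtain ⟨c, hc⟩ := hφ.eq_const_mul hα hN hmem (hE.trans hvar)
    have hhalf : (1 / 2 : ℝ) ∈ Ioo (0 : ℝ) 1 := ⟨by norm_num, by norm_num⟩
    have hc0 : 0 < c := by
      have h1 := hpos _ hhalf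
      rw [hc _ hhalf] at h1
      exact (pos_iff_pos_of_mul_pos h1).2 (hφ.pos _ ⟨hhalf.1.le, hhalf.2⟩)
    exact hφ.properties_const_mul hα hγ hγα hN hc0 hc
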